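/- Setting. Let $V:\mathbb R\to\mathbb R$ be $1$-periodic and locally square integrable, let $E\in\mathbb R$, let $D\subset\mathbb C$ be open, and let $W$ be analytic on $D$. Let $\kappa$ be an analytic branch on $D$ of the complex momentum $\kappa(\varphi)=k(E-W(\varphi))$, where $k$ is the Bloch quasi-momentum of $-\frac{d^2}{dx^2}+V$; that is, $\kappa$ is analytic on $D$ and, for every $\varphi\in D$, the equation $-\psi''+V\psi=(E-W(\varphi))\psi$ has a solution $\psi\not\equiv0$ on $\mathbb R$ with $\psi(x+1)=e^{i\kappa(\varphi)}\psi(x)$ for all $x$. Let $\gamma\subset D$ be a curve parametrized by a $C^2$ map of $[0,1]$ into $D$ (up to the end points), going from $\zeta_1$ to $\zeta_2$, and let $\gamma'$ be $\gamma$ without its end points. The curve $\gamma$ is called strictly vertical if it is regular and there is $\delta_1>0$ such that the argument $\theta$ of its tangent vector satisfies $\delta_1<\theta<\pi-\delta_1$ at every point. It is called strictly canonical if it is strictly vertical and there are $\delta_2,\delta_3>0$ such that $$\operatorname{Im}\int_\varphi^{\varphi'}\kappa\,ds\ \ge\ \delta_2\operatorname{Im}(\varphi'-\varphi),\qquad \operatorname{Im}\int_\varphi^{\varphi'}(\kappa-\pi)\,ds\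 \le\ -\delta_3\operatorname{Im}(\varphi'-\varphi)$$ for all $\varphi,\varphi'\in\gamma$ with $\varphi$ preceding $\varphi'$. All integrals are taken along $\gamma$. Let $0<b<a<1$. For $f:\gamma'\to\mathbb C$ put $f_a(\varphi)=|\varphi-\zeta_1|^a|\varphi-\zeta_2|^af(\varphi)$ and $$\|f\|_{a,b}=\sup_{\varphi\in\gamma'}|f_a(\varphi)|+\sup_{\varphi\ne\varphi'\in\gamma'}\frac{|f_a(\varphi)-f_a(\varphi')|}{|\varphi-\varphi'|^b},$$ and let $C_{a,b}(\gamma)$ be the space of the $f$ with $\|f\|_{a,b}<\infty$. For $\varepsilon>0$ and $\varphi\in\gamma'$ define $$L_+f(\varphi)=\frac1{2i\varepsilon}\int_\gamma\Big(\cot\frac{\pi(\varphi'-\varphi-0)}{\varepsilon}-i\Big)f(\varphi')\,d\varphi',$$ $$K_+f(\varphi)=\frac1{2i\varepsilon}\int_\gamma\Big(\cot\frac{\pi(\varphi'-\varphi-0)}{\varepsilon}-i\Big)e^{\frac{2i}{\varepsilon}\int_\varphi^{\varphi'}\kappa\,ds}f(\varphi')\,d\varphi',$$ where $\varphi'-\varphi-0$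 means that $\varphi'-\varphi-h$ is written in place of $\varphi'-\varphi$ and the limit $h\to0$ through positive real numbers is taken. Proposition 3.2. If $\gamma$ is strictly canonical, then there is a constant $C>0$, independent of $\varepsilon$, such that for all $0<\varepsilon\le1$ the operator $K_+$ is well defined and bounded on $C_{a,b}(\gamma)$, with $$\|K_+\|\le C\varepsilon^{-a-b}.$$ By comparison (Lemma 3.4), if $\gamma$ is only strictly vertical, then there is a constant $C>0$, independent of $\varepsilon$, such that for all $0<\varepsilon\le1$ the operator $L_+$ is well defined and bounded on $C_{a,b}(\gamma)$, with $$\|L_+\|\le C\varepsilon^{-1-a}.$$ -/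

import Mathlib

open Set Filter Topology MeasureTheory
open scoped ENNReal

noncomputable section

/-! ### The complex momentum -/

/-- `ψ` is a solution on the real line of `-ψ'' + V ψ = ℰ ψ`, with a (possibly discontinuous) locally
integrable potential `V`: `ψ` is differentiable and `ψ'` is the absolutely continuous function with
`ψ'' = (V - ℰ) ψ` almost everywhere, written in integrated form. -/
def IsSchrodingerSolution (V : ℝ → ℝ) (ℰ : ℂ) (ψ : ℝ → ℂ) : Prop :=
  ∃ ψ' : ℝ → ℂ, (∀ x, HasDerivAt ψ (ψ' x) x) ∧
    ∀ x, ψ' x = ψ' 0 + ∫ y in (0 : ℝ)..x, ((V y : ℂ) - ℰ) * ψ y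

/-- `k` is a value of the Bloch quasi-momentum at the energy `ℰ` of the periodic operator
`-d²/dx² + V`, with `V` of period one: there is a nontrivial Bloch solution with Floquet multiplier
`exp (i k)`. -/
def IsQuasimomentum (V : ℝ → ℝ) (ℰ k : ℂ) : Prop :=
  ∃ ψ : ℝ → ℂ, ψ ≠ 0 ∧ IsSchrodingerSolution V ℰ ψ ∧
    ∀ x, ψ (x + 1) = Complex.exp (Complex.I * k) * ψ x

/-- `κ` is, on the set `D`, an analytic branch of the (multi-valued) complex momentum
`κ(φ) = k(E - W(φ))`, where `k` is the Bloch quasi-momentum of `-d²/dx² + V`. -/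
def IsComplexMomentumBranch (V : ℝ → ℝ) (W : ℂ → ℂ) (E : ℝ) (D : Set ℂ) (κ : ℂ → ℂ) : Prop :=
  AnalyticOnNhd ℂ κ D ∧ ∀ φ ∈ D, IsQuasimomentum V ((E : ℂ) - W φ) (κ φ)

/-! ### Curves

A curve is given by a parametrization `γ : ℝ → ℂ`, of which only the restriction to `[0, 1]`
matters. It goes from `ζ₁ = γ 0` to `ζ₂ = γ 1`. -/

/-- The velocity of the curve (one-sided at the end points). -/
def curveVelocity (γ : ℝ → ℂ) (t : ℝ) : ℂ := derivWithin γ (Icc 0 1) t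

/-- The curve without its end points. -/
def openCurve (γ : ℝ → ℂ) : Set ℂ := γ '' Ioo 0 1

/-- The integral of `g` along the arc of the curve from `γ s` to `γ t`. -/
def arcIntegral (γ : ℝ → ℂ) (g : ℂ → ℂ) (s t : ℝ) : ℂ :=
  ∫ u in s..t, g (γ u) * curveVelocity γ u

/-- Strictly vertical curves: the curve is regular, runs upwards, and its angle `θ` with the lines
`Im z = const` satisfies `δ₁ < θ < π - δ₁` at all its points. -/
def IsStrictlyVertical (γ : ℝ → ℂ) : Prop :=
  ∃ δ₁ : ℝ, 0 < δ₁ ∧ ∀ t ∈ Icc (0 : ℝ) 1,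
    δ₁ < (curveVelocity γ t).arg ∧ (curveVelocity γ t).arg < Real.pi - δ₁

/-- Strictly canonical curves with respect to the branch `κ` of the complex momentum. The
inequalities are imposed for `φ = γ s` preceding `φ' = γ t` on the curve. -/
def IsStrictlyCanonical (γ : ℝ → ℂ) (κ : ℂ → ℂ) : Prop :=
  IsStrictlyVertical γ ∧ ∃ δ₂ δ₃ : ℝ, 0 < δ₂ ∧ 0 < δ₃ ∧
    ∀ s t : ℝ, 0 ≤ s → s ≤ t → t ≤ 1 →
      δ₂ * (γ t - γ s).im ≤ (arcIntegral γ κ s t).im ∧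
      (arcIntegral γ (fun z => κ z - (Real.pi : ℂ)) s t).im ≤ -δ₃ * (γ t - γ s).im

/-! ### The weighted Hölder space -/

/-- `f_a(φ) = |φ - ζ₁|^a |φ - ζ₂|^a f(φ)`. -/
def weightedFun (γ : ℝ → ℂ) (a : ℝ) (f : ℂ → ℂ) (φ : ℂ) : ℂ :=
  ((‖φ - γ 0‖ ^ a * ‖φ - γ 1‖ ^ a : ℝ) : ℂ) * f φ

/-- The norm of `C_{a,b}(γ)`, with values in `[0, ∞]`. Only the values of `f` on the curve without
its end points matter. (The pairs `φ = φ'` contribute `0 / 0 = 0` to the second supremum.) -/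
def holderNorm (γ : ℝ → ℂ) (a b : ℝ) (f : ℂ → ℂ) : ℝ≥0∞ :=
  (⨆ φ ∈ openCurve γ, ‖weightedFun γ a f φ‖ₑ) +
    ⨆ φ ∈ openCurve γ, ⨆ φ' ∈ openCurve γ,
      edist (weightedFun γ a f φ) (weightedFun γ a f φ') / edist φ φ' ^ b

/-- Membership in `C_{a,b}(γ)`. -/
def MemWeightedHolder (γ : ℝ → ℂ) (a b : ℝ) (f : ℂ → ℂ) : Prop := holderNorm γ a b f < ∞

/-! ### The singular integral operators -/

/-- The integrand, in the parameter `t` of `φ' = γ t`, of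
`∫_γ (cot (π (φ' - φ - h) / ε) - i) F(φ') dφ'` with `F(γ t)` written `F t`. -/
def cotIntegrand (γ : ℝ → ℂ) (ε : ℝ) (φ : ℂ) (F : ℝ → ℂ) (h t : ℝ) : ℂ :=
  (Complex.cot ((Real.pi : ℂ) * (γ t - φ - (h : ℂ)) / (ε : ℂ)) - Complex.I) * F t *
    curveVelocity γ t

/-- The singular integral
`(1 / (2 i ε)) ∫_γ (cot (π (φ' - φ - 0) / ε) - i) F(φ') dφ'` exists and has the value `v`; here
`- 0` means that `φ' - φ` is replaced by `φ' - φ - h`, and `h` tends to zero through positive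
real numbers. -/
def HasCotIntegral (γ : ℝ → ℂ) (ε : ℝ) (φ : ℂ) (F : ℝ → ℂ) (v : ℂ) : Prop :=
  (∀ᶠ h in 𝓝[>] (0 : ℝ), IntervalIntegrable (cotIntegrand γ ε φ F h) volume 0 1) ∧
    Tendsto (fun h : ℝ => 1 / (2 * Complex.I * (ε : ℂ)) *
      ∫ t in (0 : ℝ)..1, cotIntegrand γ ε φ F h t) (𝓝[>] (0 : ℝ)) (𝓝 v)

/-- `g = L₊ f` on the curve without its end points:
`L₊ f(φ) = (1 / (2 i ε)) ∫_γ (cot (π (φ' - φ - 0) / ε) - i) f(φ') dφ'`. -/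
def IsLPlus (γ : ℝ → ℂ) (ε : ℝ) (f g : ℂ → ℂ) : Prop :=
  ∀ s ∈ Ioo (0 : ℝ) 1, HasCotIntegral γ ε (γ s) (fun t => f (γ t)) (g (γ s))

/-- `g = K₊ f` on the curve without its end points:
`K₊ f(φ) =
  (1 / (2 i ε)) ∫_γ (cot (π (φ' - φ - 0) / ε) - i) exp ((2 i / ε) ∫_φ^φ' κ) f(φ') dφ'`,
where the inner integral is taken along the curve. -/
def IsKPlus (γ : ℝ → ℂ) (κ : ℂ → ℂ) (ε : ℝ) (f g : ℂ → ℂ) : Prop :=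
  ∀ s ∈ Ioo (0 : ℝ) 1, HasCotIntegral γ ε (γ s)
    (fun t => Complex.exp (2 * Complex.I / (ε : ℂ) * arcIntegral γ κ s t) * f (γ t)) (g (γ s))

/-- The operator with the graph `T` (`T f g` means `g = T f`, as functions on the curve without its
end points) is everywhere defined on `C_{a,b}(γ)`, maps it to itself, and has operator norm at most
`M` there. -/
def HasHolderOpNormLE (γ : ℝ → ℂ) (a b : ℝ) (T : (ℂ → ℂ) → (ℂ → ℂ) → Prop) (M : ℝ) : Prop :=
  ∀ f : ℂ → ℂ, MemWeightedHolder γ a b f →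
    ∃ g : ℂ → ℂ, T f g ∧ holderNorm γ a b g ≤ ENNReal.ofReal M * holderNorm γ a b f

end

/-!
In the parameter of the curve, `φ = γ s` and `φ' = γ t`, the identity
`cot w - i = 2 i / (exp (2 i w) - 1)` turns the kernel of `K₊` into `(1 / ε) exp Y / (exp X - 1) γ' t`
with `X = 2 π i (φ' - φ) / ε` and `Y = (2 i / ε) ∫ κ`. Since the curve is strictly vertical,
`|Re X|` is comparable to `|X|`, so that `φ' = φ` is the only pole. The kernel is written as the
Hilbert kernel `1 / (2 π i (t - s))` plus a remainder (`smoothKernel`), and the limit in which the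
displacement `h` tends to zero acts on the first part only, by Sokhotski's formula
(`tendsto_integral_curveKernel`).

The Hilbert transform is bounded on the weighted Hölder space of the unit interval
(`exists_unitHilbert_bound`). A cutoff reduces this to one end point, hence to the half-line. There
`s ^ a` times the transform of `t ^ (-a) G t` is the integral of `u ^ (-a) G (s u) / (u - 1)`, which
commutes with dilations: outside the window `1 / 2 ≤ u ≤ 3 / 2` a Hölder bound for `G` passes
through the integral, thanks to `b < a < 1`, and inside the window the classical local estimate
applies (`exists_unit_hilbert_bound`).

The remainder is at most `(C / ε) B |t - s|`, and its increments in `s` gain the factor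
`min 1 (|s₁ - s₂| / ε) ≤ |s₁ - s₂| ^ b ε ^ (-b)` (`exists_remKernel_bound`). Here `B` majorizes
`ε / (ε + τ)` and, up to a constant, the exponential factors `exp Y` (for `t > s`) and `exp (Y - X)`
(for `t < s`). The operator norm is therefore at most a constant times `1 + A ε ^ (-b)`, where `A`
bounds the integral of `(1 / ε) B |t - s|` against the inverse weight
(`exists_curveOperator_bound`). On a strictly canonical curve both exponential factors decay like `exp (-d |t - s| / ε)`, so that
`B τ = ε / (ε + τ)` is allowed and `A` is of the order `ε ^ (-a)`, which gives `ε ^ (-a - b)`. For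
`L₊` there is no decay: `B = 1` and `A` is of the order `1 / ε`, which gives
`ε ^ (-1 - b) ≤ ε ^ (-1 - a)`.
-/

noncomputable section

/-! ### Divided exponentials -/

/-- The entire function `(exp x - 1) / x`. -/
def phi1 : ℂ → ℂ := dslope Complex.exp 0

/-- The entire function `(exp x - 1 - x) / x ^ 2`. -/
def phi2 : ℂ → ℂ := dslope phi1 0

lemma mul_phi1 (x : ℂ) : x * phi1 x = Complex.exp x - 1 := by
  have := sub_smul_dslope Complex.exp 0 x
  simpa [phi1] using this

lemma phi1_zero : phi1 0 = 1 := by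
  simp [phi1]

lemma mul_phi2 (x : ℂ) : x * phi2 x = phi1 x - 1 := by
  have := sub_smul_dslope phi1 0 x
  rw [phi1_zero] at this
  simpa [phi2] using this

lemma differentiable_dslope {f : ℂ → ℂ} (hf : Differentiable ℂ f) :
    Differentiable ℂ (dslope f 0) := by
  rw [← differentiableOn_univ]
  exact (Complex.differentiableOn_dslope univ_mem).2 hf.differentiableOn

lemma differentiable_phi1 : Differentiable ℂ phi1 := differentiable_dslope Complex.differentiable_exp

lemma differentiable_phi2 : Differentiable ℂ phi2 := differentiable_dslope differentiable_phi1

lemma exists_bound_lipschitz_closedBall {f : ℂ → ℂ} (hf : Differentiable ℂ f) (r : ℝ) :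
    ∃ C : ℝ, 0 ≤ C ∧ (∀ x, ‖x‖ ≤ r → ‖f x‖ ≤ C) ∧
      ∀ x x', ‖x‖ ≤ r → ‖x'‖ ≤ r → ‖f x - f x'‖ ≤ C * ‖x - x'‖ := by
  have h1 : ContDiff ℝ 1 f := (hf.contDiff (n := 1)).restrict_scalars ℝ
  obtain ⟨K, hK⟩ := h1.contDiffOn.exists_lipschitzOnWith one_ne_zero
    (convex_closedBall (0 : ℂ) r) (isCompact_closedBall 0 r)
  obtain ⟨B, hB⟩ := (isCompact_closedBall (0 : ℂ) r).exists_bound_of_continuousOn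
    hf.continuous.continuousOn
  refine ⟨max K (max B 0), by positivity, fun x hx => ?_, fun x x' hx hx' => ?_⟩
  · exact (hB x (by simpa using hx)).trans (le_max_of_le_right (le_max_left _ _))
  · refine (hK.norm_sub_le (by simpa using hx) (by simpa using hx')).trans ?_
    gcongr
    exact le_max_left _ _

lemma norm_exp_sub_exp_le {x y : ℂ} {m : ℝ} (hx : x.re ≤ m) (hy : y.re ≤ m) :
    ‖Complex.exp x - Complex.exp y‖ ≤ Real.exp m * ‖x - y‖ := by
  refine Convex.norm_image_sub_le_of_norm_hasDerivWithin_le (s := {z : ℂ | z.re ≤ m})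
    (f' := Complex.exp) (fun z _ => (Complex.hasDerivAt_exp z).hasDerivWithinAt) (fun z hz => ?_)
    (convex_halfSpace_re_le m) hy hx
  rw [Complex.norm_exp]
  exact Real.exp_le_exp.2 hz

/-- In a double cone around the real axis the function `phi1` is bounded below: its zeros lie on
the imaginary axis. -/
lemma le_norm_phi1 {x : ℂ} {r c : ℝ} (hr : ‖x‖ ≤ r) (hc0 : 0 ≤ c) (hc1 : c ≤ 1)
    (hc : c * ‖x‖ ≤ |x.re|) : c * Real.exp (-r) ≤ ‖phi1 x‖ := by
  have hr0 : 0 ≤ r := (norm_nonneg x).trans hr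
  by_cases hx : x = 0
  · subst hx
    rw [phi1_zero, norm_one]
    have : Real.exp (-r) ≤ 1 := Real.exp_le_one_iff.2 (by linarith)
    nlinarith [Real.exp_pos (-r)]
  have hxp : 0 < ‖x‖ := norm_pos_iff.2 hx
  have hre : |x.re| ≤ r := (Complex.abs_re_le_norm x).trans hr
  have h1 : |x.re| * Real.exp (-r) ≤ |Real.exp x.re - 1| := by
    rcases le_total 0 x.re with h | h
    · rw [abs_of_nonneg h, abs_of_nonneg (by linarith [Real.add_one_le_exp x.re])]
      have : Real.exp (-r) ≤ 1 := Real.exp_le_one_iff.2 (by linarith)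
      nlinarith [Real.add_one_le_exp x.re]
    · rw [abs_of_nonpos h, abs_of_nonpos (by linarith [Real.exp_le_one_iff.2 h])]
      have h2 : Real.exp (-r) ≤ Real.exp x.re :=
        Real.exp_le_exp.2 (by linarith [neg_abs_le x.re])
      have h3 : 1 - x.re ≤ Real.exp (-x.re) := by linarith [Real.add_one_le_exp (-x.re)]
      have h4 : Real.exp x.re * Real.exp (-x.re) = 1 := by rw [← Real.exp_add]; simp
      nlinarith [Real.exp_pos x.re]
  have h2 : |Real.exp x.re - 1| ≤ ‖Complex.exp x - 1‖ := by
    have := abs_norm_sub_norm_le (Complex.exp x) 1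
    rwa [Complex.norm_exp, norm_one] at this
  rw [← mul_phi1, norm_mul] at h2
  have h3 : c * ‖x‖ * Real.exp (-r) ≤ ‖x‖ * ‖phi1 x‖ :=
    (mul_le_mul_of_nonneg_right hc (Real.exp_pos _).le).trans (h1.trans h2)
  have h4 : ‖x‖ * (c * Real.exp (-r)) ≤ ‖x‖ * ‖phi1 x‖ := by linarith
  exact le_of_mul_le_mul_left h4 hxp

/-! ### Averages over segments -/

/-- `g` is bounded by `M` and Lipschitz with the constant `M`. -/
def LipBdd (M : ℝ) (g : ℝ → ℂ) : Prop :=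
  (∀ s t, ‖g s - g t‖ ≤ M * |s - t|) ∧ ∀ t, ‖g t‖ ≤ M

/-- The average of `g` over the segment with the end points `s` and `t`; it is the divided
difference of a primitive of `g`, and it equals `g s` for `s = t`. -/
def avg (g : ℝ → ℂ) (s t : ℝ) : ℂ := ∫ u in (0 : ℝ)..1, g (s + u * (t - s))

namespace LipBdd

variable {M : ℝ} {g : ℝ → ℂ}

lemma nonneg (hg : LipBdd M g) : 0 ≤ M := (norm_nonneg _).trans (hg.2 0)

lemma continuous (hg : LipBdd M g) : Continuous g := by
  have : LipschitzWith ⟨M, hg.nonneg⟩ g :=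
    LipschitzWith.of_dist_le_mul fun s t => by
      rw [dist_eq_norm, Real.dist_eq]; exact hg.1 s t
  exact this.continuous

lemma intervalIntegrable (hg : LipBdd M g) (s t : ℝ) : IntervalIntegrable g volume s t :=
  hg.continuous.intervalIntegrable s t

lemma integral_eq_avg (g : ℝ → ℂ) (s t : ℝ) : ∫ u in s..t, g u = ((t - s : ℝ) : ℂ) * avg g s t := by
  have := intervalIntegral.smul_integral_comp_add_mul (a := 0) (b := 1) g (t - s) s
  simp only [mul_zero, mul_one, add_zero, add_sub_cancel] at this
  rw [← this, avg, Complex.real_smul]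
  simp only [mul_comm]

lemma norm_avg_le (hg : LipBdd M g) (s t : ℝ) : ‖avg g s t‖ ≤ M := by
  have := intervalIntegral.norm_integral_le_of_norm_le_const (a := 0) (b := 1) (C := M)
    (f := fun u => g (s + u * (t - s))) fun u _ => hg.2 _
  simpa [avg] using this

lemma norm_avg_sub_avg_le (hg : LipBdd M g) (s t s' t' : ℝ) :
    ‖avg g s t - avg g s' t'‖ ≤ M * (|s - s'| + |t - t'|) := by
  have hc := hg.continuous
  have := intervalIntegral.norm_integral_le_of_norm_le_const (a := 0) (b := 1)
    (C := M * (|s - s'| + |t - t'|))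
    (f := fun u => g (s + u * (t - s)) - g (s' + u * (t' - s'))) fun u hu => ?_
  · rw [intervalIntegral.integral_sub (by apply Continuous.intervalIntegrable; fun_prop)
      (by apply Continuous.intervalIntegrable; fun_prop)] at this
    simpa [avg] using this
  · rw [uIoc_of_le zero_le_one] at hu
    refine (hg.1 _ _).trans (mul_le_mul_of_nonneg_left ?_ hg.nonneg)
    have : s + u * (t - s) - (s' + u * (t' - s')) = (1 - u) * (s - s') + u * (t - t') := by ring
    rw [this]
    refine (abs_add_le _ _).trans ?_
    rw [abs_mul, abs_mul, abs_of_nonneg hu.1.le, abs_of_nonneg (by linarith [hu.2] : 0 ≤ 1 - u)]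
    nlinarith [hu.1, hu.2, abs_nonneg (s - s'), abs_nonneg (t - t')]

lemma avg_self (g : ℝ → ℂ) (t : ℝ) : avg g t t = g t := by simp [avg]

lemma le_im_avg (hg : LipBdd M g) {c : ℝ} (hc : ∀ t, c ≤ (g t).im) (s t : ℝ) :
    c ≤ (avg g s t).im := by
  have hcont := hg.continuous
  have hi : IntervalIntegrable (fun u => g (s + u * (t - s))) volume 0 1 := by
    apply Continuous.intervalIntegrable; fun_prop
  have h1 : (avg g s t).im = ∫ u in (0 : ℝ)..1, (g (s + u * (t - s))).im := by
    rw [avg, intervalIntegral.integral_of_le zero_le_one, intervalIntegral.integral_of_le zero_le_one]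
    exact (integral_im (𝕜 := ℂ) hi.1).symm
  rw [h1]
  have h2 : ∫ _u in (0 : ℝ)..1, c ≤ ∫ u in (0 : ℝ)..1, (g (s + u * (t - s))).im := by
    refine intervalIntegral.integral_mono_on zero_le_one (by simp) ?_ fun u _ => hc _
    apply Continuous.intervalIntegrable
    fun_prop
  simpa using h2

lemma avg_symm (g : ℝ → ℂ) (s t : ℝ) : avg g s t = avg g t s := by
  by_cases h : s = t
  · rw [h]
  have h1 := integral_eq_avg g s t
  rw [intervalIntegral.integral_symm, integral_eq_avg g t s] at h1
  have h2 : ((t - s : ℝ) : ℂ) ≠ 0 := by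
    rw [Complex.ofReal_ne_zero]; exact sub_ne_zero.2 (Ne.symm h)
  refine (mul_left_cancel₀ h2 ?_)
  rw [← h1]; push_cast; ring

end LipBdd

/-! ### The kernel without its Cauchy singularity -/

lemma norm_div_sub_div_le {a a' b b' : ℂ} {m A : ℝ} (hm : 0 < m) (hb : m ≤ ‖b‖) (hb' : m ≤ ‖b'‖)
    (ha : ‖a'‖ ≤ A) : ‖a / b - a' / b'‖ ≤ ‖a - a'‖ / m + A * ‖b - b'‖ / m ^ 2 := by
  have hb0 : b ≠ 0 := norm_pos_iff.1 (hm.trans_le hb)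
  have hb0' : b' ≠ 0 := norm_pos_iff.1 (hm.trans_le hb')
  have h : a / b - a' / b' = (a - a') / b + a' * (b' - b) / (b * b') := by
    field_simp
    ring
  rw [h]
  refine (norm_add_le _ _).trans (add_le_add ?_ ?_)
  · rw [norm_div]; gcongr
  · rw [norm_div, norm_mul, norm_mul, norm_sub_rev b' b, pow_two]
    have hA : 0 ≤ A := (norm_nonneg _).trans ha
    gcongr

/-- The regular part of `exp y / (exp x - 1) - 1 / x`, where `q` stands for `y / x`. -/
def regularPart (x y q : ℂ) : ℂ := (q * phi1 y - phi2 x) / phi1 x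

lemma regularPart_eq {x y q : ℂ} (hx : x ≠ 0) (hy : y = q * x) (he : Complex.exp x - 1 ≠ 0) :
    Complex.exp y / (Complex.exp x - 1) - 1 / x = regularPart x y q := by
  have h1 := mul_phi1 x
  have h2 := mul_phi2 x
  have h3 := mul_phi1 y
  have h0 : phi1 x ≠ 0 := by
    intro h; rw [h, mul_zero] at h1; exact he h1.symm
  have hey : Complex.exp y = 1 + y * phi1 y := by rw [h3]; ring
  rw [regularPart, ← h1, hey]
  have h2' : phi1 x = 1 + x * phi2 x := by rw [h2]; ring
  have h4 : x * phi1 x ≠ 0 := mul_ne_zero hx h0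
  field_simp
  rw [hy]
  linear_combination (-1 : ℂ) * h2'

lemma exists_regularPart_bound (r : ℝ) {c : ℝ} (hc : 0 < c) (hc1 : c ≤ 1) :
    ∃ C : ℝ, 0 ≤ C ∧ ∀ x y q x' y' q' : ℂ, ‖x‖ ≤ r → ‖y‖ ≤ r → ‖q‖ ≤ r → ‖x'‖ ≤ r → ‖y'‖ ≤ r →
      ‖q'‖ ≤ r → c * ‖x‖ ≤ |x.re| → c * ‖x'‖ ≤ |x'.re| →
      ‖regularPart x y q‖ ≤ C ∧
      ‖regularPart x y q - regularPart x' y' q'‖ ≤ C * (‖x - x'‖ + ‖y - y'‖ + ‖q - q'‖) := by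
  obtain ⟨C1, h10, h1b, h1l⟩ := exists_bound_lipschitz_closedBall differentiable_phi1 r
  obtain ⟨C2, h20, h2b, h2l⟩ := exists_bound_lipschitz_closedBall differentiable_phi2 r
  by_cases hr : 0 ≤ r
  swap
  · exact ⟨0, le_rfl, fun x y q x' y' q' hx => absurd ((norm_nonneg x).trans hx) hr⟩
  set m := c * Real.exp (-r) with hm
  have hm0 : 0 < m := by positivity
  set A := r * C1 + C2 with hA
  have hA0 : 0 ≤ A := by positivity
  have hnum : ∀ x y q : ℂ, ‖x‖ ≤ r → ‖y‖ ≤ r → ‖q‖ ≤ r → ‖q * phi1 y - phi2 x‖ ≤ A := by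
    intro x y q hx hy hq
    refine (norm_sub_le _ _).trans (add_le_add ?_ (h2b x hx))
    rw [norm_mul]
    exact mul_le_mul hq (h1b y hy) (norm_nonneg _) hr
  refine ⟨A / m + ((A + C1) / m + A * C1 / m ^ 2), by positivity,
    fun x y q x' y' q' hx hy hq hx' hy' hq' hcx hcx' => ?_⟩
  have hl := le_norm_phi1 hx hc.le hc1 hcx
  have hl' := le_norm_phi1 hx' hc.le hc1 hcx'
  constructor
  · have : ‖regularPart x y q‖ ≤ A / m := by
      rw [regularPart, norm_div]
      exact div_le_div₀ hA0 (hnum x y q hx hy hq) hm0 hl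
    have h2 : 0 ≤ (A + C1) / m + A * C1 / m ^ 2 := by positivity
    linarith
  · refine (norm_div_sub_div_le hm0 hl hl' (hnum x' y' q' hx' hy' hq')).trans ?_
    have e1 : ‖q * phi1 y - phi2 x - (q' * phi1 y' - phi2 x')‖ ≤
        (A + C1) * (‖x - x'‖ + ‖y - y'‖ + ‖q - q'‖) := by
      have : q * phi1 y - phi2 x - (q' * phi1 y' - phi2 x') =
        q * (phi1 y - phi1 y') + (q - q') * phi1 y' - (phi2 x - phi2 x') := by ring
      rw [this]
      refine (norm_sub_le _ _).trans ((add_le_add_left (norm_add_le _ _) _).trans ?_)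
      rw [norm_mul, norm_mul]
      have a1 : ‖q‖ * ‖phi1 y - phi1 y'‖ ≤ r * (C1 * ‖y - y'‖) :=
        mul_le_mul hq (h1l y y' hy hy') (norm_nonneg _) hr
      have a2 : ‖q - q'‖ * ‖phi1 y'‖ ≤ ‖q - q'‖ * C1 :=
        mul_le_mul_of_nonneg_left (h1b _ hy') (norm_nonneg _)
      have a3 := h2l x x' hx hx'
      have n1 := norm_nonneg (x - x')
      have n2 := norm_nonneg (y - y')
      have n3 := norm_nonneg (q - q')
      have : 0 ≤ r * C1 := by positivity
      rw [hA]
      nlinarith [mul_nonneg this n1, mul_nonneg this n3, mul_nonneg h20 n2, mul_nonneg h20 n3,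
        mul_nonneg h10 n1, mul_nonneg h10 n2]
    have e2 : ‖phi1 x - phi1 x'‖ ≤ C1 * (‖x - x'‖ + ‖y - y'‖ + ‖q - q'‖) := by
      refine (h1l x x' hx hx').trans (mul_le_mul_of_nonneg_left ?_ h10)
      linarith [norm_nonneg (y - y'), norm_nonneg (q - q')]
    set S := ‖x - x'‖ + ‖y - y'‖ + ‖q - q'‖ with hS
    have hS0 : 0 ≤ S := by positivity
    have e3 : A * ‖phi1 x - phi1 x'‖ / m ^ 2 ≤ A * (C1 * S) / m ^ 2 := by gcongr
    have e4 : ‖q * phi1 y - phi2 x - (q' * phi1 y' - phi2 x')‖ / m ≤ (A + C1) * S / m := by gcongr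
    have : (A / m + ((A + C1) / m + A * C1 / m ^ 2)) * S =
        A / m * S + (A + C1) * S / m + A * (C1 * S) / m ^ 2 := by ring
    rw [this]
    have : 0 ≤ A / m * S := by positivity
    linarith

/-- Where `exp x` stays away from `1`, the quotient `exp y / (1 - exp x)` is as large and as regular
as `exp y`. -/
lemma exists_quotient_bound {κ₀ : ℝ} (hκ : 0 < κ₀) :
    ∃ C : ℝ, 0 ≤ C ∧ ∀ x y x' y' : ℂ, x.re ≤ -κ₀ → x'.re ≤ -κ₀ →
      ‖Complex.exp y / (1 - Complex.exp x)‖ ≤ C * ‖Complex.exp y‖ ∧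
      ‖Complex.exp y / (1 - Complex.exp x) - Complex.exp y' / (1 - Complex.exp x')‖ ≤
        C * (‖x - x'‖ + ‖y - y'‖) * (‖Complex.exp y‖ + ‖Complex.exp y'‖) := by
  set m := 1 - Real.exp (-κ₀) with hm
  have hm0 : 0 < m := by
    have : Real.exp (-κ₀) < 1 := by
      rw [← Real.exp_zero]; exact Real.exp_lt_exp.2 (by linarith)
    linarith
  have hlow : ∀ x : ℂ, x.re ≤ -κ₀ → m ≤ ‖1 - Complex.exp x‖ := by
    intro x hx
    have h1 := norm_sub_norm_le 1 (Complex.exp x)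
    rw [norm_one, Complex.norm_exp] at h1
    have h2 : Real.exp x.re ≤ Real.exp (-κ₀) := Real.exp_le_exp.2 hx
    linarith
  refine ⟨1 / m + 1 / m ^ 2, by positivity, fun x y x' y' hx hx' => ⟨?_, ?_⟩⟩
  · rw [norm_div]
    have : ‖Complex.exp y‖ / ‖1 - Complex.exp x‖ ≤ ‖Complex.exp y‖ / m := by
      gcongr; exact hlow x hx
    have h2 : 0 ≤ 1 / m ^ 2 * ‖Complex.exp y‖ := by positivity
    calc _ ≤ ‖Complex.exp y‖ / m := this
      _ ≤ _ := by rw [add_mul, one_div_mul_eq_div]; linarith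
  · refine (norm_div_sub_div_le hm0 (hlow x hx) (hlow x' hx') le_rfl).trans ?_
    have e1 : ‖Complex.exp y - Complex.exp y'‖ ≤
        (‖Complex.exp y‖ + ‖Complex.exp y'‖) * ‖y - y'‖ := by
      have := norm_exp_sub_exp_le (le_max_left y.re y'.re) (le_max_right y.re y'.re)
      refine this.trans (mul_le_mul_of_nonneg_right ?_ (norm_nonneg _))
      rw [Complex.norm_exp, Complex.norm_exp]
      rcases max_cases y.re y'.re with ⟨h, _⟩ | ⟨h, _⟩ <;> rw [h] <;>
        linarith [Real.exp_pos y.re, Real.exp_pos y'.re]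
    have e2 : ‖1 - Complex.exp x - (1 - Complex.exp x')‖ ≤ ‖x - x'‖ := by
      have h1 : (1 - Complex.exp x - (1 - Complex.exp x')) = -(Complex.exp x - Complex.exp x') := by
        ring
      rw [h1, norm_neg]
      have := norm_exp_sub_exp_le (m := 0) (hx.trans (by linarith)) (hx'.trans (by linarith))
      simpa using this
    set S := ‖Complex.exp y‖ + ‖Complex.exp y'‖ with hS
    have hS0 : 0 ≤ S := by positivity
    have hS1 : ‖Complex.exp y'‖ ≤ S := by rw [hS]; linarith [norm_nonneg (Complex.exp y)]
    have e3 : ‖Complex.exp y'‖ * ‖1 - Complex.exp x - (1 - Complex.exp x')‖ / m ^ 2 ≤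
        S * ‖x - x'‖ / m ^ 2 := by gcongr
    have e4 : ‖Complex.exp y - Complex.exp y'‖ / m ≤ S * ‖y - y'‖ / m := by gcongr
    have e5 : (1 / m + 1 / m ^ 2) * (‖x - x'‖ + ‖y - y'‖) * S =
      S * ‖y - y'‖ / m + S * ‖x - x'‖ / m ^ 2 +
        (S * ‖x - x'‖ / m + S * ‖y - y'‖ / m ^ 2) := by ring
    rw [e5]
    have : 0 ≤ S * ‖x - x'‖ / m + S * ‖y - y'‖ / m ^ 2 := by positivity
    linarith

/-- The exponent `2 π i (φ' - φ) / ε` along the curve with the velocity `v`; the increment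
`φ' - φ` is written as `t - s` times the average of `v`. -/
def expX (ε : ℝ) (v : ℝ → ℂ) (s t : ℝ) : ℂ :=
  2 * Real.pi * Complex.I / ε * (((t - s : ℝ) : ℂ) * avg v s t)

/-- The exponent `(2 i / ε) ∫ κ` along the curve, with `p` the density of `κ dφ`. -/
def expY (ε : ℝ) (p : ℝ → ℂ) (s t : ℝ) : ℂ :=
  2 * Complex.I / ε * (((t - s : ℝ) : ℂ) * avg p s t)

/-- The kernel of `K₊` minus its Cauchy part `1 / (2 π i (φ' - φ))`. -/
def remKernel (ε : ℝ) (v p : ℝ → ℂ) (s t : ℝ) : ℂ :=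
  1 / ε * (Complex.exp (expY ε p s t) / (Complex.exp (expX ε v s t) - 1) - 1 / expX ε v s t)

lemma expX_re (ε : ℝ) (v : ℝ → ℂ) (s t : ℝ) :
    (expX ε v s t).re = -(2 * Real.pi / ε * ((t - s) * (avg v s t).im)) := by
  have : expX ε v s t =
      ((2 * Real.pi / ε * (t - s) : ℝ) : ℂ) * (Complex.I * avg v s t) := by
    rw [expX]; push_cast; ring
  rw [this, Complex.re_ofReal_mul]
  simp
  ring

section Estimates

variable {c M : ℝ} {v p : ℝ → ℂ} {ε : ℝ}

lemma norm_expX (hε : 0 < ε) (s t : ℝ) :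
    ‖expX ε v s t‖ = 2 * Real.pi / ε * (|t - s| * ‖avg v s t‖) := by
  rw [expX, norm_mul, norm_mul, Complex.norm_real, norm_div]
  simp [abs_of_pos hε, abs_of_pos Real.pi_pos]

lemma norm_expY (hε : 0 < ε) (s t : ℝ) :
    ‖expY ε p s t‖ = 2 / ε * (|t - s| * ‖avg p s t‖) := by
  rw [expY, norm_mul, norm_mul, Complex.norm_real, norm_div]
  simp [abs_of_pos hε]

lemma expX_sub (hv : LipBdd M v) (ε : ℝ) (s₁ s₂ t : ℝ) :
    expX ε v s₁ t - expX ε v s₂ t = expX ε v s₁ s₂ := by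
  simp only [expX, ← LipBdd.integral_eq_avg]
  rw [← mul_sub, ← intervalIntegral.integral_add_adjacent_intervals
    (hv.intervalIntegrable s₁ s₂) (hv.intervalIntegrable s₂ t), add_sub_cancel_right]

lemma expY_sub (hp : LipBdd M p) (ε : ℝ) (s₁ s₂ t : ℝ) :
    expY ε p s₁ t - expY ε p s₂ t = expY ε p s₁ s₂ := by
  simp only [expY, ← LipBdd.integral_eq_avg]
  rw [← mul_sub, ← intervalIntegral.integral_add_adjacent_intervals
    (hp.intervalIntegrable s₁ s₂) (hp.intervalIntegrable s₂ t), add_sub_cancel_right]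

lemma norm_expX_le (hv : LipBdd M v) (hε : 0 < ε) (s t : ℝ) :
    ‖expX ε v s t‖ ≤ 2 * Real.pi * M * (|s - t| / ε) := by
  rw [norm_expX hε, abs_sub_comm s t]
  have := hv.norm_avg_le s t
  calc 2 * Real.pi / ε * (|t - s| * ‖avg v s t‖) ≤ 2 * Real.pi / ε * (|t - s| * M) := by
        gcongr
    _ = _ := by ring

lemma norm_expY_le (hp : LipBdd M p) (hε : 0 < ε) (s t : ℝ) :
    ‖expY ε p s t‖ ≤ 2 * M * (|s - t| / ε) := by
  rw [norm_expY hε, abs_sub_comm s t]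
  have := hp.norm_avg_le s t
  calc 2 / ε * (|t - s| * ‖avg p s t‖) ≤ 2 / ε * (|t - s| * M) := by
        gcongr
    _ = _ := by ring

lemma le_norm_avg (hv : LipBdd M v) (hvc : ∀ t, c ≤ (v t).im) (s t : ℝ) : c ≤ ‖avg v s t‖ :=
  (hv.le_im_avg hvc s t).trans ((le_abs_self _).trans (Complex.abs_im_le_norm _))

lemma le_norm_expX (hv : LipBdd M v) (hvc : ∀ t, c ≤ (v t).im) (hε : 0 < ε) (s t : ℝ) :
    c * (|t - s| / ε) ≤ ‖expX ε v s t‖ := by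
  rw [norm_expX hε]
  have h1 := le_norm_avg hv hvc s t
  have h2 : 0 ≤ |t - s| / ε * ‖avg v s t‖ := by positivity
  calc c * (|t - s| / ε) ≤ ‖avg v s t‖ * (|t - s| / ε) := by gcongr
    _ ≤ (2 * Real.pi) * (|t - s| / ε * ‖avg v s t‖) := by nlinarith [Real.pi_gt_three]
    _ = _ := by ring

lemma expX_ne_zero (hc : 0 < c) (hv : LipBdd M v) (hvc : ∀ t, c ≤ (v t).im) (hε : 0 < ε)
    {s t : ℝ} (hst : s ≠ t) : expX ε v s t ≠ 0 := by
  have h := le_norm_expX hv hvc hε s t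
  have : 0 < c * (|t - s| / ε) := by
    have : 0 < |t - s| := abs_pos.2 (sub_ne_zero.2 hst.symm)
    positivity
  exact norm_pos_iff.1 (this.trans_le h)

lemma expX_re_le (hv : LipBdd M v) (hvc : ∀ t, c ≤ (v t).im) (hc : 0 < c) (hε : 0 < ε) {s t : ℝ}
    (hst : s ≤ t) : (expX ε v s t).re ≤ -(c * ((t - s) / ε)) := by
  rw [expX_re, neg_le_neg_iff]
  have h1 := hv.le_im_avg hvc s t
  have h2 : 0 ≤ (t - s) / ε := div_nonneg (by linarith) hε.le
  have h3 : c * ((t - s) / ε) ≤ (avg v s t).im * ((t - s) / ε) := by gcongr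
  have h4 : 2 * Real.pi / ε * ((t - s) * (avg v s t).im) =
    2 * Real.pi * ((avg v s t).im * ((t - s) / ε)) := by ring
  rw [h4]
  have h5 : 0 ≤ c * ((t - s) / ε) := by positivity
  nlinarith [Real.pi_gt_three]

lemma expX_symm (ε : ℝ) (v : ℝ → ℂ) (s t : ℝ) : expX ε v t s = -expX ε v s t := by
  rw [expX, expX, LipBdd.avg_symm v t s]; push_cast; ring

lemma le_abs_re_expX (hv : LipBdd M v) (hvc : ∀ t, c ≤ (v t).im) (hc : 0 < c) (hε : 0 < ε)
    (s t : ℝ) : c / M * ‖expX ε v s t‖ ≤ |(expX ε v s t).re| := by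
  have h1 := hv.le_im_avg hvc s t
  have h2 := hv.norm_avg_le s t
  have hM : 0 < M := hc.trans_le ((le_norm_avg hv hvc s t).trans h2)
  rw [norm_expX hε, expX_re, abs_neg, abs_mul, abs_mul, abs_of_pos (hc.trans_le h1),
    abs_of_pos (by positivity : 0 < 2 * Real.pi / ε)]
  have h3 : c / M * ‖avg v s t‖ ≤ (avg v s t).im := by
    calc c / M * ‖avg v s t‖ ≤ c / M * M := by gcongr
      _ = c := by field_simp
      _ ≤ _ := h1
  calc _ = 2 * Real.pi / ε * (|t - s| * (c / M * ‖avg v s t‖)) := by ring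
    _ ≤ _ := by gcongr

lemma exp_expX_sub_one_ne_zero (hc : 0 < c) (hv : LipBdd M v) (hvc : ∀ t, c ≤ (v t).im)
    (hε : 0 < ε) {s t : ℝ} (hst : s ≠ t) {y : ℝ} :
    Complex.exp (expX ε v s t + y * Complex.I) - 1 ≠ 0 := by
  intro h
  have h1 : ‖Complex.exp (expX ε v s t + y * Complex.I)‖ = 1 := by rw [sub_eq_zero.1 h, norm_one]
  have hre : (expX ε v s t + y * Complex.I).re = (expX ε v s t).re := by simp
  rw [Complex.norm_exp, Real.exp_eq_one_iff, hre, expX_re] at h1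
  have h2 := hc.trans_le (hv.le_im_avg hvc s t)
  have h3 : t - s ≠ 0 := sub_ne_zero.2 hst.symm
  have : 2 * Real.pi / ε * ((t - s) * (avg v s t).im) ≠ 0 := by positivity
  exact this (neg_eq_zero.1 h1)

lemma expY_eq (hc : 0 < c) (hv : LipBdd M v) (hvc : ∀ t, c ≤ (v t).im) (s t : ℝ) :
    expY ε p s t = avg p s t / (Real.pi * avg v s t) * expX ε v s t := by
  have h0 : avg v s t ≠ 0 := norm_pos_iff.1 (hc.trans_le (le_norm_avg hv hvc s t))
  have hpi : (Real.pi : ℂ) ≠ 0 := by simp [Real.pi_ne_zero]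
  rw [expX, expY]
  field_simp

lemma remKernel_eq_regularPart (hc : 0 < c) (hv : LipBdd M v) (hvc : ∀ t, c ≤ (v t).im)
    (hε : 0 < ε) {s t : ℝ} (hst : s ≠ t) :
    remKernel ε v p s t = 1 / ε * regularPart (expX ε v s t) (expY ε p s t)
      (avg p s t / (Real.pi * avg v s t)) := by
  rw [remKernel, regularPart_eq (expX_ne_zero hc hv hvc hε hst) (expY_eq hc hv hvc s t)]
  have := exp_expX_sub_one_ne_zero hc hv hvc hε hst (y := 0)
  simpa using this

lemma remKernel_of_lt (ε : ℝ) (v p : ℝ → ℂ) (s t : ℝ) :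
    remKernel ε v p s t = 1 / ε * (-(Complex.exp (expY ε p s t) /
      (1 - Complex.exp (expX ε v s t))) - 1 / expX ε v s t) := by
  rw [remKernel, ← div_neg, neg_sub]

lemma remKernel_of_gt (ε : ℝ) (v p : ℝ → ℂ) (s t : ℝ) :
    remKernel ε v p s t = 1 / ε * (Complex.exp (expY ε p s t - expX ε v s t) /
      (1 - Complex.exp (-expX ε v s t)) - 1 / expX ε v s t) := by
  have h : Complex.exp (expX ε v s t) - 1 =
      Complex.exp (expX ε v s t) * (1 - Complex.exp (-expX ε v s t)) := by
    rw [mul_sub, ← Complex.exp_add]; simp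
  rw [remKernel, Complex.exp_sub, h, div_div]

/-- At distances up to `ε` from the pole both exponents are bounded, and the remainder is a Lipschitz
function of the exponents and of their quotient. -/
lemma exists_near_bound (hc : 0 < c) (hv : LipBdd M v) (hvc : ∀ t, c ≤ (v t).im)
    (hp : LipBdd M p) : ∃ C : ℝ, 0 ≤ C ∧ ∀ ε : ℝ, 0 < ε → ε ≤ 1 → ∀ s₁ s₂ t : ℝ, s₁ ≠ t → s₂ ≠ t →
      |t - s₁| ≤ ε → |s₁ - s₂| ≤ ε / 4 →
      ‖remKernel ε v p s₁ t‖ ≤ C / ε ∧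
      ‖remKernel ε v p s₁ t - remKernel ε v p s₂ t‖ ≤ C / ε * (|s₁ - s₂| / ε) := by
  have hcM : c ≤ M := (le_norm_avg hv hvc 0 0).trans (hv.norm_avg_le 0 0)
  have hM : 0 < M := hc.trans_le hcM
  set r := 2 * Real.pi * M * 2 + M / c with hr
  have hr1 : 2 * Real.pi * M * 2 ≤ r := by rw [hr]; have : 0 ≤ M / c := by positivity
                                           linarith
  have hr2 : M / c ≤ r := by rw [hr]; have : 0 ≤ 2 * Real.pi * M * 2 := by positivity
                             linarith
  obtain ⟨C, hC0, hC⟩ := exists_regularPart_bound r (c := c / M) (by positivity)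
    ((div_le_one hM).2 hcM)
  set Q := M / c + M * (Real.pi * M) / c ^ 2 with hQ
  refine ⟨C + C * (2 * Real.pi * M + 2 * M + Q), by positivity,
    fun ε hε hε1 s₁ s₂ t h1 h2 hn hd => ?_⟩
  have hn2 : |t - s₂| ≤ 2 * ε := by
    have := abs_sub_le t s₁ s₂; linarith
  have bx : ∀ s, |t - s| ≤ 2 * ε → ‖expX ε v s t‖ ≤ r := fun s hs => by
    refine (norm_expX_le hv hε s t).trans (le_trans ?_ hr1)
    gcongr
    rw [div_le_iff₀ hε, abs_sub_comm]; exact hs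
  have bY : ∀ s, |t - s| ≤ 2 * ε → ‖expY ε p s t‖ ≤ r := fun s hs => by
    refine (norm_expY_le hp hε s t).trans (le_trans ?_ hr1)
    have : |s - t| / ε ≤ 2 := by rw [div_le_iff₀ hε, abs_sub_comm]; exact hs
    have h0 : 0 ≤ |s - t| / ε := by positivity
    nlinarith [Real.pi_gt_three, mul_le_mul_of_nonneg_left this hM.le]
  have hden : ∀ s, c ≤ ‖(Real.pi : ℂ) * avg v s t‖ := fun s => by
    rw [norm_mul, Complex.norm_real, Real.norm_of_nonneg Real.pi_pos.le]
    nlinarith [Real.pi_gt_three, le_norm_avg hv hvc s t]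
  have bq : ∀ s, ‖avg p s t / (Real.pi * avg v s t)‖ ≤ r := fun s => by
    rw [norm_div]
    exact (div_le_div₀ hM.le (hp.norm_avg_le s t) hc (hden s)).trans hr2
  have key := hC _ _ _ _ _ _ (bx s₁ (by linarith)) (bY s₁ (by linarith)) (bq s₁) (bx s₂ hn2)
    (bY s₂ hn2) (bq s₂) (le_abs_re_expX hv hvc hc hε s₁ t) (le_abs_re_expX hv hvc hc hε s₂ t)
  rw [remKernel_eq_regularPart hc hv hvc hε h1, remKernel_eq_regularPart hc hv hvc hε h2]
  have hnε : ‖(1 / ε : ℂ)‖ = 1 / ε := by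
    rw [norm_div, norm_one, Complex.norm_real, Real.norm_of_nonneg hε.le]
  set K := C * (2 * Real.pi * M + 2 * M + Q) with hK
  have hK0 : 0 ≤ K := by positivity
  constructor
  · rw [norm_mul, hnε, one_div_mul_eq_div]
    gcongr
    linarith [key.1]
  · rw [← mul_sub, norm_mul, hnε]
    have e1 : ‖expX ε v s₁ t - expX ε v s₂ t‖ ≤ 2 * Real.pi * M * (|s₁ - s₂| / ε) := by
      rw [expX_sub hv]; exact norm_expX_le hv hε _ _
    have e2 : ‖expY ε p s₁ t - expY ε p s₂ t‖ ≤ 2 * M * (|s₁ - s₂| / ε) := by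
      rw [expY_sub hp]; exact norm_expY_le hp hε _ _
    have e3 : ‖avg p s₁ t / (Real.pi * avg v s₁ t) - avg p s₂ t / (Real.pi * avg v s₂ t)‖ ≤
        Q * (|s₁ - s₂| / ε) := by
      refine (norm_div_sub_div_le hc (hden s₁) (hden s₂) (hp.norm_avg_le s₂ t)).trans ?_
      have f1 := hp.norm_avg_sub_avg_le s₁ t s₂ t
      have f2 := hv.norm_avg_sub_avg_le s₁ t s₂ t
      simp only [sub_self, abs_zero, add_zero] at f1 f2
      rw [← mul_sub, norm_mul, Complex.norm_real, Real.norm_of_nonneg Real.pi_pos.le]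
      have f3 : |s₁ - s₂| ≤ |s₁ - s₂| / ε := by
        rw [le_div_iff₀ hε]; nlinarith [abs_nonneg (s₁ - s₂)]
      calc _ ≤ M * |s₁ - s₂| / c + M * (Real.pi * (M * |s₁ - s₂|)) / c ^ 2 := by gcongr
        _ = Q * |s₁ - s₂| := by rw [hQ]; ring
        _ ≤ _ := by gcongr
    calc 1 / ε * _ ≤ 1 / ε * (C * (2 * Real.pi * M * (|s₁ - s₂| / ε) + 2 * M * (|s₁ - s₂| / ε) +
          Q * (|s₁ - s₂| / ε))) := by
          gcongr
          exact key.2.trans (by gcongr)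
      _ = K / ε * (|s₁ - s₂| / ε) := by rw [hK]; ring
      _ ≤ _ := by gcongr; linarith

/-- At distances larger than `ε` from the pole the exponential quotient and the Cauchy kernel are
estimated separately. -/
lemma exists_far_bound (hc : 0 < c) (hv : LipBdd M v) (hvc : ∀ t, c ≤ (v t).im)
    (hp : LipBdd M p) {C₀ : ℝ} (hC₀ : 0 ≤ C₀) :
    ∃ C : ℝ, 0 ≤ C ∧ ∀ ε : ℝ, 0 < ε → ∀ B : ℝ → ℝ, (∀ τ, 0 ≤ τ → ε / (ε + τ) ≤ B τ) →
      (∀ s ∈ Icc (0 : ℝ) 1, ∀ t ∈ Icc (0 : ℝ) 1, s < t →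
        ‖Complex.exp (expY ε p s t)‖ ≤ C₀ * B |t - s|) →
      (∀ s ∈ Icc (0 : ℝ) 1, ∀ t ∈ Icc (0 : ℝ) 1, t < s →
        ‖Complex.exp (expY ε p s t - expX ε v s t)‖ ≤ C₀ * B |t - s|) →
      ∀ s₁ ∈ Icc (0 : ℝ) 1, ∀ s₂ ∈ Icc (0 : ℝ) 1, ∀ t ∈ Icc (0 : ℝ) 1,
        ε < |t - s₁| → |s₁ - s₂| ≤ ε / 4 →
      ‖remKernel ε v p s₁ t‖ ≤ C / ε * B |t - s₁| ∧
      ‖remKernel ε v p s₁ t - remKernel ε v p s₂ t‖ ≤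
        C / ε * (|s₁ - s₂| / ε) * (B |t - s₁| + B |t - s₂|) := by
  have hcM : c ≤ M := (le_norm_avg hv hvc 0 0).trans (hv.norm_avg_le 0 0)
  have hM : 0 < M := hc.trans_le hcM
  obtain ⟨C, hC0, hC⟩ := exists_quotient_bound (κ₀ := c / 2) (by positivity)
  set K := 2 * Real.pi * M + (2 * M + 2 * Real.pi * M) with hK
  have hK0 : 0 ≤ K := by positivity
  refine ⟨C * C₀ + 3 / c + (C * K * C₀ + 2 * Real.pi * M * (2 / c * (3 / c))), by positivity,
    fun ε hε B hB hpos hneg s₁ hs₁ s₂ hs₂ t ht hfar hd => ?_⟩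
  have hfar2 : 3 / 4 * ε ≤ |t - s₂| := by
    have := abs_sub_le t s₂ s₁
    rw [abs_sub_comm s₂ s₁] at this
    linarith
  have hnε : ‖(1 / ε : ℂ)‖ = 1 / ε := by
    rw [norm_div, norm_one, Complex.norm_real, Real.norm_of_nonneg hε.le]
  have hBn : ∀ τ, 0 ≤ B |τ| := fun τ => le_trans (by positivity) (hB |τ| (abs_nonneg _))
  -- The Cauchy part.
  have hX : ∀ s, 3 / 4 * ε ≤ |t - s| → c / 2 ≤ ‖expX ε v s t‖ ∧
      ‖1 / expX ε v s t‖ ≤ 3 / c * B |t - s| := by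
    intro s hs
    have h1 := le_norm_expX hv hvc hε s t
    have h2 : 3 / 4 ≤ |t - s| / ε := by rwa [le_div_iff₀ hε]
    have h3 : c * (|t - s| / ε) ≥ c * (3 / 4) := by gcongr
    refine ⟨by linarith, ?_⟩
    rw [norm_div, norm_one]
    have h4 : 0 < |t - s| := by linarith
    calc 1 / ‖expX ε v s t‖ ≤ 1 / (c * (|t - s| / ε)) := by gcongr
      _ = 1 / c * (ε / |t - s|) := by field_simp
      _ ≤ 1 / c * (3 * (ε / (ε + |t - s|))) := by
          gcongr
          rw [← mul_div_assoc, div_le_div_iff₀ h4 (by positivity)]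
          nlinarith
      _ ≤ 1 / c * (3 * B |t - s|) := by
          gcongr; exact hB _ (abs_nonneg _)
      _ = _ := by ring
  have hX1 := hX s₁ (by linarith)
  have hX2 := hX s₂ hfar2
  have hXd : ‖expX ε v s₁ t - expX ε v s₂ t‖ ≤ 2 * Real.pi * M * (|s₁ - s₂| / ε) := by
    rw [expX_sub hv]; exact norm_expX_le hv hε _ _
  have hYd : ‖expY ε p s₁ t - expY ε p s₂ t‖ ≤ 2 * M * (|s₁ - s₂| / ε) := by
    rw [expY_sub hp]; exact norm_expY_le hp hε _ _
  set δ := |s₁ - s₂| / ε with hδ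
  have hδ0 : 0 ≤ δ := by positivity
  have hXinv : ‖1 / expX ε v s₁ t - 1 / expX ε v s₂ t‖ ≤
      2 * Real.pi * M * (2 / c * (3 / c)) * δ * (B |t - s₁| + B |t - s₂|) := by
    have n1 : expX ε v s₁ t ≠ 0 := norm_pos_iff.1 (lt_of_lt_of_le (by positivity) hX1.1)
    have n2 : expX ε v s₂ t ≠ 0 := norm_pos_iff.1 (lt_of_lt_of_le (by positivity) hX2.1)
    have : 1 / expX ε v s₁ t - 1 / expX ε v s₂ t =
      -(expX ε v s₁ t - expX ε v s₂ t) * (1 / expX ε v s₁ t) * (1 / expX ε v s₂ t) := by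
      field_simp; ring
    rw [this, norm_mul, norm_mul, norm_neg]
    have h5 : ‖1 / expX ε v s₁ t‖ ≤ 2 / c := by
      rw [norm_div, norm_one, div_le_div_iff₀ (lt_of_lt_of_le (by positivity) hX1.1) hc]
      linarith [hX1.1]
    have b0 := hBn (t - s₂)
    calc _ ≤ (2 * Real.pi * M * δ) * (2 / c) * (3 / c * B |t - s₂|) := by
          gcongr
          exact hX2.2
      _ = 2 * Real.pi * M * (2 / c * (3 / c)) * δ * (0 + B |t - s₂|) := by ring
      _ ≤ _ := by gcongr; exact hBn _
  -- The two sides of the pole: for `s < t` the real part of `X` is negative, and for `t < s`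
  -- numerator and denominator are first divided by `exp X`.
  have main : ∀ (σ : ℂ) (x₁ y₁ x₂ y₂ : ℂ), ‖σ‖ = 1 → x₁.re ≤ -(c / 2) → x₂.re ≤ -(c / 2) →
      ‖Complex.exp y₁‖ ≤ C₀ * B |t - s₁| → ‖Complex.exp y₂‖ ≤ C₀ * B |t - s₂| →
      ‖x₁ - x₂‖ + ‖y₁ - y₂‖ ≤ K * δ →
      remKernel ε v p s₁ t = 1 / ε * (σ * (Complex.exp y₁ / (1 - Complex.exp x₁)) -
        1 / expX ε v s₁ t) →
      remKernel ε v p s₂ t = 1 / ε * (σ * (Complex.exp y₂ / (1 - Complex.exp x₂)) -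
        1 / expX ε v s₂ t) →
      ‖remKernel ε v p s₁ t‖ ≤
        (C * C₀ + 3 / c + (C * K * C₀ + 2 * Real.pi * M * (2 / c * (3 / c)))) / ε * B |t - s₁| ∧
      ‖remKernel ε v p s₁ t - remKernel ε v p s₂ t‖ ≤
        (C * C₀ + 3 / c + (C * K * C₀ + 2 * Real.pi * M * (2 / c * (3 / c)))) / ε * δ *
          (B |t - s₁| + B |t - s₂|) := by
    intro σ x₁ y₁ x₂ y₂ hσ hx₁ hx₂ hy₁ hy₂ hxy e₁ e₂
    have key := hC x₁ y₁ x₂ y₂ hx₁ hx₂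
    have b1 := hBn (t - s₁)
    have b2 := hBn (t - s₂)
    set L := C * K * C₀ + 2 * Real.pi * M * (2 / c * (3 / c)) with hL
    have hL0 : 0 ≤ L := by positivity
    constructor
    · rw [e₁, norm_mul, hnε]
      calc 1 / ε * _ ≤ 1 / ε * (C * (C₀ * B |t - s₁|) + 3 / c * B |t - s₁|) := by
            gcongr
            refine (norm_sub_le _ _).trans (add_le_add ?_ hX1.2)
            rw [norm_mul, hσ, one_mul]
            exact key.1.trans (by gcongr)
        _ = (C * C₀ + 3 / c + 0) / ε * B |t - s₁| := by ring
        _ ≤ _ := by gcongr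
    · have : remKernel ε v p s₁ t - remKernel ε v p s₂ t = 1 / ε * (σ *
          (Complex.exp y₁ / (1 - Complex.exp x₁) - Complex.exp y₂ / (1 - Complex.exp x₂)) -
          (1 / expX ε v s₁ t - 1 / expX ε v s₂ t)) := by rw [e₁, e₂]; ring
      rw [this, norm_mul, hnε]
      calc 1 / ε * _ ≤ 1 / ε * (C * (K * δ) * (C₀ * B |t - s₁| + C₀ * B |t - s₂|) +
            2 * Real.pi * M * (2 / c * (3 / c)) * δ * (B |t - s₁| + B |t - s₂|)) := by
            gcongr
            refine (norm_sub_le _ _).trans (add_le_add ?_ hXinv)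
            rw [norm_mul, hσ, one_mul]
            exact key.2.trans (by gcongr)
        _ = (0 + L) / ε * δ * (B |t - s₁| + B |t - s₂|) := by rw [hL]; ring
        _ ≤ _ := by gcongr; positivity
  rcases lt_or_ge s₁ t with h | h
  · rw [abs_of_pos (by linarith : 0 < t - s₁)] at hfar
    have h2 : s₂ < t := by
      have := neg_abs_le (s₁ - s₂); linarith
    have hr : ∀ s, s < t → 3 / 4 * ε ≤ t - s → (expX ε v s t).re ≤ -(c / 2) := by
      intro s hs hs'
      refine (expX_re_le hv hvc hc hε hs.le).trans (neg_le_neg ?_)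
      have h2 : 3 / 4 ≤ (t - s) / ε := by rwa [le_div_iff₀ hε]
      nlinarith
    refine main (-1) (expX ε v s₁ t) (expY ε p s₁ t) (expX ε v s₂ t) (expY ε p s₂ t) (by simp)
      (hr s₁ h (by linarith)) (hr s₂ h2 ?_) (hpos s₁ hs₁ t ht h) (hpos s₂ hs₂ t ht h2) ?_ ?_ ?_
    · rwa [abs_of_pos (by linarith : 0 < t - s₂)] at hfar2
    · have : K * δ = 2 * Real.pi * M * δ + 2 * M * δ + 2 * Real.pi * M * δ := by rw [hK]; ring
      rw [this]
      have : 0 ≤ 2 * Real.pi * M * δ := by positivity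
      linarith
    · rw [remKernel_of_lt]; ring
    · rw [remKernel_of_lt]; ring
  · have h : t < s₁ := by
      rcases h.lt_or_eq with h | h
      · exact h
      · rw [h] at hfar; simp at hfar; linarith
    rw [abs_of_neg (by linarith : t - s₁ < 0)] at hfar
    have h2 : t < s₂ := by
      have := le_abs_self (s₁ - s₂); linarith
    have hr : ∀ s, t < s → 3 / 4 * ε ≤ s - t → (-expX ε v s t).re ≤ -(c / 2) := by
      intro s hs hs'
      rw [← expX_symm]
      refine (expX_re_le hv hvc hc hε hs.le).trans (neg_le_neg ?_)
      have h2 : 3 / 4 ≤ (s - t) / ε := by rwa [le_div_iff₀ hε]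
      nlinarith
    refine main 1 (-expX ε v s₁ t) (expY ε p s₁ t - expX ε v s₁ t) (-expX ε v s₂ t)
      (expY ε p s₂ t - expX ε v s₂ t) (by simp)
      (hr s₁ h (by linarith)) (hr s₂ h2 ?_) (hneg s₁ hs₁ t ht h) (hneg s₂ hs₂ t ht h2) ?_ ?_ ?_
    · rw [abs_of_neg (by linarith : t - s₂ < 0)] at hfar2; linarith
    · have e1 : -expX ε v s₁ t - -expX ε v s₂ t = -(expX ε v s₁ t - expX ε v s₂ t) := by ring
      have e2 : expY ε p s₁ t - expX ε v s₁ t - (expY ε p s₂ t - expX ε v s₂ t) =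
        (expY ε p s₁ t - expY ε p s₂ t) - (expX ε v s₁ t - expX ε v s₂ t) := by ring
      rw [e1, e2, norm_neg]
      have := norm_sub_le (expY ε p s₁ t - expY ε p s₂ t) (expX ε v s₁ t - expX ε v s₂ t)
      have : K * δ = 2 * Real.pi * M * δ + (2 * M * δ + 2 * Real.pi * M * δ) := by rw [hK]; ring
      linarith
    · rw [remKernel_of_gt]; ring
    · rw [remKernel_of_gt]; ring

/-- Size and regularity of the kernel without its Cauchy singularity, in terms of a majorant `B` of
the exponential factor. -/
lemma exists_remKernel_bound (hc : 0 < c) (hv : LipBdd M v) (hvc : ∀ t, c ≤ (v t).im)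
    (hp : LipBdd M p) {C₀ : ℝ} (hC₀ : 0 ≤ C₀) :
    ∃ C : ℝ, 0 ≤ C ∧ ∀ ε : ℝ, 0 < ε → ε ≤ 1 → ∀ B : ℝ → ℝ,
      (∀ τ, 0 ≤ τ → ε / (ε + τ) ≤ B τ) →
      (∀ s ∈ Icc (0 : ℝ) 1, ∀ t ∈ Icc (0 : ℝ) 1, s < t →
        ‖Complex.exp (expY ε p s t)‖ ≤ C₀ * B |t - s|) →
      (∀ s ∈ Icc (0 : ℝ) 1, ∀ t ∈ Icc (0 : ℝ) 1, t < s →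
        ‖Complex.exp (expY ε p s t - expX ε v s t)‖ ≤ C₀ * B |t - s|) →
      (∀ s ∈ Icc (0 : ℝ) 1, ∀ t ∈ Icc (0 : ℝ) 1, s ≠ t →
        ‖remKernel ε v p s t‖ ≤ C / ε * B |t - s|) ∧
      ∀ s₁ ∈ Icc (0 : ℝ) 1, ∀ s₂ ∈ Icc (0 : ℝ) 1, ∀ t ∈ Icc (0 : ℝ) 1, s₁ ≠ t → s₂ ≠ t →
      ‖remKernel ε v p s₁ t - remKernel ε v p s₂ t‖ ≤
        C / ε * min 1 (|s₁ - s₂| / ε) * (B |t - s₁| + B |t - s₂|) := by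
  obtain ⟨C₁, hC₁, h₁⟩ := exists_near_bound hc hv hvc hp
  obtain ⟨C₂, hC₂, h₂⟩ := exists_far_bound hc hv hvc hp hC₀
  set C := 3 * C₁ + C₂ with hC
  have hCn : 0 ≤ C := by positivity
  refine ⟨4 * C, by positivity, fun ε hε hε1 B hB hpos hneg => ?_⟩
  have hBn : ∀ τ, 0 ≤ B |τ| := fun τ => le_trans (by positivity) (hB |τ| (abs_nonneg _))
  -- Up to distances of order `ε` the majorant `B` is bounded below, so that it may be inserted.
  have hBnear : ∀ τ, |τ| ≤ 5 / 4 * ε → 1 ≤ 3 * B |τ| := by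
    intro τ hτ
    have h := hB |τ| (abs_nonneg _)
    have : 1 / 3 ≤ ε / (ε + |τ|) := by
      rw [div_le_div_iff₀ (by norm_num) (by positivity)]; linarith
    linarith
  have size : ∀ s ∈ Icc (0 : ℝ) 1, ∀ t ∈ Icc (0 : ℝ) 1, s ≠ t →
        ‖remKernel ε v p s t‖ ≤ C / ε * B |t - s| := by
    intro s hs t ht hst
    have b := hBn (t - s)
    rcases le_or_gt |t - s| ε with h | h
    · have := (h₁ ε hε hε1 s s t hst hst h (by simp; positivity)).1
      have hb := hBnear (t - s) (by linarith)
      calc _ ≤ C₁ / ε * 1 := by simpa using this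
        _ ≤ C₁ / ε * (3 * B |t - s|) := by gcongr
        _ = (3 * C₁ + 0) / ε * B |t - s| := by ring
        _ ≤ _ := by rw [hC]; gcongr
    · have := (h₂ ε hε B hB hpos hneg s hs s hs t ht h (by simp; positivity)).1
      calc _ ≤ (0 + C₂) / ε * B |t - s| := by simpa using this
        _ ≤ _ := by rw [hC]; gcongr; positivity
  refine ⟨fun s hs t ht hst => (size s hs t ht hst).trans ?_,
    fun s₁ hs₁ s₂ hs₂ t ht n₁ n₂ => ?_⟩
  · have b := hBn (t - s)
    gcongr; linarith
  have b1 := hBn (t - s₁)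
  have b2 := hBn (t - s₂)
  have hδ0 : 0 ≤ |s₁ - s₂| / ε := by positivity
  rcases le_or_gt |s₁ - s₂| (ε / 4) with hd | hd
  · have hmin : min 1 (|s₁ - s₂| / ε) = |s₁ - s₂| / ε := by
      rw [min_eq_right]; rw [div_le_one hε]; linarith
    rw [hmin]
    rcases le_or_gt |t - s₁| ε with h | h
    · have := (h₁ ε hε hε1 s₁ s₂ t n₁ n₂ h hd).2
      have hb := hBnear (t - s₁) (by linarith)
      calc _ ≤ C₁ / ε * (|s₁ - s₂| / ε) * 1 := by simpa using this
        _ ≤ C₁ / ε * (|s₁ - s₂| / ε) * (3 * (B |t - s₁| + B |t - s₂|)) := by gcongr; linarith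
        _ = (3 * C₁) / ε * (|s₁ - s₂| / ε) * (B |t - s₁| + B |t - s₂|) := by ring
        _ ≤ _ := by gcongr ?_ / _ * _ * _; linarith
    · have := (h₂ ε hε B hB hpos hneg s₁ hs₁ s₂ hs₂ t ht h hd).2
      refine this.trans ?_
      gcongr; linarith
  · have hmin : 1 / 4 ≤ min 1 (|s₁ - s₂| / ε) := by
      refine le_min (by norm_num) ?_
      rw [div_le_div_iff₀ (by norm_num) hε]; linarith
    calc _ ≤ C / ε * B |t - s₁| + C / ε * B |t - s₂| :=
          (norm_sub_le _ _).trans (add_le_add (size s₁ hs₁ t ht n₁) (size s₂ hs₂ t ht n₂))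
      _ = 4 * C / ε * (1 / 4) * (B |t - s₁| + B |t - s₂|) := by ring
      _ ≤ _ := by gcongr

/-- The difference between the Cauchy kernel of the curve, `v t` divided by the increment of the
curve, and the Hilbert kernel `1 / (t - s)`. -/
def cauchyDiff (v : ℝ → ℂ) (s t : ℝ) : ℂ := (v t / avg v s t - 1) / ((t - s : ℝ) : ℂ)

lemma norm_div_avg_sub_one_le (hc : 0 < c) (hv : LipBdd M v) (hvc : ∀ t, c ≤ (v t).im)
    (s t : ℝ) : ‖v t / avg v s t - 1‖ ≤ M / c * |t - s| := by
  have h1 := le_norm_avg hv hvc s t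
  have h0 : avg v s t ≠ 0 := norm_pos_iff.1 (hc.trans_le h1)
  have h2 := hv.norm_avg_sub_avg_le t t s t
  rw [LipBdd.avg_self, sub_self, abs_zero, add_zero] at h2
  have hM := hv.nonneg
  rw [div_sub_one h0, norm_div, div_mul_eq_mul_div]
  gcongr

lemma norm_cauchyDiff_le (hc : 0 < c) (hv : LipBdd M v) (hvc : ∀ t, c ≤ (v t).im)
    (s t : ℝ) : ‖cauchyDiff v s t‖ ≤ M / c := by
  have hM := hv.nonneg
  by_cases h : t = s
  · rw [cauchyDiff, h, sub_self, Complex.ofReal_zero, div_zero, norm_zero]; positivity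
  have h' : 0 < |t - s| := abs_pos.2 (sub_ne_zero.2 h)
  rw [cauchyDiff, norm_div, Complex.norm_real, Real.norm_eq_abs, div_le_iff₀ h']
  exact norm_div_avg_sub_one_le hc hv hvc s t

lemma norm_cauchyDiff_sub_le (hc : 0 < c) (hv : LipBdd M v) (hvc : ∀ t, c ≤ (v t).im)
    {b : ℝ} (hb : 0 ≤ b) (hb1 : b ≤ 1) {s₁ s₂ t : ℝ} (h₁ : s₁ ≠ t) (h₂ : s₂ ≠ t) :
    ‖cauchyDiff v s₁ t - cauchyDiff v s₂ t‖ ≤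
      (M * M / c ^ 2 + 2 * (M / c)) * (|s₁ - s₂| / |t - s₁|) ^ b := by
  have hM := hv.nonneg
  have p₁ : 0 < |t - s₁| := abs_pos.2 (sub_ne_zero.2 h₁.symm)
  have p₂ : 0 < |t - s₂| := abs_pos.2 (sub_ne_zero.2 h₂.symm)
  set d := |s₁ - s₂| / |t - s₁| with hd
  have hd0 : 0 ≤ d := by positivity
  rcases le_or_gt d 1 with hd1 | hd1
  · have hdb : d ≤ d ^ b := by
      rcases hd0.eq_or_lt with h | h
      · rw [← h]; positivity
      · conv_lhs => rw [← Real.rpow_one d]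
        exact Real.rpow_le_rpow_of_exponent_ge h hd1 hb1
    have n₁ : ((t - s₁ : ℝ) : ℂ) ≠ 0 := Complex.ofReal_ne_zero.2 (sub_ne_zero.2 h₁.symm)
    have n₂ : ((t - s₂ : ℝ) : ℂ) ≠ 0 := Complex.ofReal_ne_zero.2 (sub_ne_zero.2 h₂.symm)
    have e : cauchyDiff v s₁ t - cauchyDiff v s₂ t =
        (v t / avg v s₁ t - v t / avg v s₂ t) / ((t - s₁ : ℝ) : ℂ) +
        (v t / avg v s₂ t - 1) * ((s₁ - s₂ : ℝ) : ℂ) /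
          (((t - s₁ : ℝ) : ℂ) * ((t - s₂ : ℝ) : ℂ)) := by
      rw [cauchyDiff, cauchyDiff]
      field_simp
      push_cast
      ring
    have f1 : ‖v t / avg v s₁ t - v t / avg v s₂ t‖ ≤ M * M / c ^ 2 * |s₁ - s₂| := by
      refine (norm_div_sub_div_le hc (le_norm_avg hv hvc s₁ t) (le_norm_avg hv hvc s₂ t)
        (hv.2 t)).trans ?_
      have f2 := hv.norm_avg_sub_avg_le s₁ t s₂ t
      rw [sub_self, abs_zero, add_zero] at f2
      rw [sub_self, norm_zero, zero_div, zero_add]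
      calc _ ≤ M * (M * |s₁ - s₂|) / c ^ 2 := by gcongr
        _ = _ := by ring
    have f3 := norm_div_avg_sub_one_le hc hv hvc s₂ t
    calc _ ≤ M * M / c ^ 2 * |s₁ - s₂| / |t - s₁| +
          M / c * |t - s₂| * |s₁ - s₂| / (|t - s₁| * |t - s₂|) := by
          rw [e]
          refine (norm_add_le _ _).trans ?_
          simp only [norm_div, norm_mul, Complex.norm_real, Real.norm_eq_abs] at f1 f3 ⊢
          gcongr
      _ = (M * M / c ^ 2 + M / c) * d := by rw [hd]; field_simp
      _ ≤ (M * M / c ^ 2 + 2 * (M / c)) * d ^ b := by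
          have : 0 ≤ M / c := by positivity
          gcongr; linarith
  · have h1 : 1 ≤ d ^ b := Real.one_le_rpow hd1.le hb
    calc _ ≤ M / c + M / c := (norm_sub_le _ _).trans
          (add_le_add (norm_cauchyDiff_le hc hv hvc _ _) (norm_cauchyDiff_le hc hv hvc _ _))
      _ = (0 + 2 * (M / c)) * 1 := by ring
      _ ≤ _ := by gcongr; positivity

end Estimates

/-! ### Integrals of powers -/

lemma intervalIntegrable_abs_sub_rpow {r : ℝ} (hr : -1 < r) (s x y : ℝ) :
    IntervalIntegrable (fun t => |t - s| ^ r) volume x y := by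
  have h0 : ∀ z : ℝ, 0 ≤ z → IntervalIntegrable (fun t => |t| ^ r) volume 0 z := fun z hz => by
    refine (intervalIntegral.intervalIntegrable_rpow' (a := 0) (b := z) hr).congr ?_
    intro t ht
    rw [uIoc_of_le hz] at ht
    simp only [abs_of_pos ht.1]
  have h1 : ∀ z : ℝ, IntervalIntegrable (fun t => |t| ^ r) volume 0 z := fun z => by
    rcases le_total 0 z with hz | hz
    · exact h0 z hz
    · rw [IntervalIntegrable.iff_comp_neg, neg_zero]
      simpa using h0 (-z) (by linarith)
  have h2 : IntervalIntegrable (fun t => |t| ^ r) volume (x - s) (y - s) :=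
    (h1 _).symm.trans (h1 _)
  simpa using h2.comp_sub_right s

lemma integral_abs_sub_rpow_le {r : ℝ} (hr : -1 < r) {s x y l : ℝ} (hxy : x ≤ y)
    (hx : s - l ≤ x) (hy : y ≤ s + l) :
    ∫ t in x..y, |t - s| ^ r ≤ 2 / (r + 1) * l ^ (r + 1) := by
  have hl : 0 ≤ l := by linarith
  have hr1 : 0 < r + 1 := by linarith
  have h1 : ∫ t in x..y, |t - s| ^ r ≤ ∫ t in (s - l)..(s + l), |t - s| ^ r :=
    intervalIntegral.integral_mono_interval hx hxy hy
      (Eventually.of_forall fun t => Real.rpow_nonneg (abs_nonneg _) _)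
      (intervalIntegrable_abs_sub_rpow hr _ _ _)
  have h2 : ∫ t in (s - l)..(s + l), |t - s| ^ r = ∫ t in (-l)..l, |t| ^ r := by
    rw [intervalIntegral.integral_comp_sub_right (fun t => |t| ^ r)]
    congr 1 <;> ring
  have hint : ∀ z w : ℝ, IntervalIntegrable (fun t => |t| ^ r) volume z w := fun z w => by
    simpa using intervalIntegrable_abs_sub_rpow hr 0 z w
  have h3 : ∫ t in (0 : ℝ)..l, |t| ^ r = l ^ (r + 1) / (r + 1) := by
    have : ∫ t in (0 : ℝ)..l, |t| ^ r = ∫ t in (0 : ℝ)..l, t ^ r := by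
      refine intervalIntegral.integral_congr fun t ht => ?_
      rw [uIcc_of_le hl] at ht
      simp only [abs_of_nonneg ht.1]
    rw [this, integral_rpow (Or.inl hr), Real.zero_rpow hr1.ne', sub_zero]
  have h4 : ∫ t in (-l)..0, |t| ^ r = ∫ t in (0 : ℝ)..l, |t| ^ r := by
    have := intervalIntegral.integral_comp_neg (a := 0) (b := l) (fun t : ℝ => |t| ^ r)
    simp only [abs_neg, neg_zero] at this
    exact this.symm
  rw [h2, ← intervalIntegral.integral_add_adjacent_intervals (hint (-l) 0) (hint 0 l), h4, h3] at h1
  refine h1.trans (le_of_eq ?_)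
  ring

lemma norm_sub_div_le {A : ℝ → ℂ} {N b s t : ℝ} (h : ‖A t - A s‖ ≤ N * |t - s| ^ b)
    (hN : 0 ≤ N) :
    ‖(A t - A s) / ((t - s : ℝ) : ℂ)‖ ≤ N * |t - s| ^ (b - 1) := by
  by_cases hts : t = s
  · subst hts
    simp only [sub_self, Complex.ofReal_zero, div_zero, norm_zero]
    positivity
  have hp : 0 < |t - s| := abs_pos.2 (sub_ne_zero.2 hts)
  rw [norm_div, Complex.norm_real, Real.norm_eq_abs, div_le_iff₀ hp, mul_assoc]
  refine h.trans (le_of_eq ?_)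
  rw [← Real.rpow_add_one hp.ne']
  simp

lemma intervalIntegrable_sub_div {A : ℝ → ℂ} {N b p q s : ℝ} (hb : 0 < b) (hN : 0 ≤ N)
    (hA : ContinuousOn A (uIcc p q))
    (h : ∀ t ∈ uIcc p q, ‖A t - A s‖ ≤ N * |t - s| ^ b) :
    IntervalIntegrable (fun t => (A t - A s) / ((t - s : ℝ) : ℂ)) volume p q := by
  have hg : IntervalIntegrable (fun t => N * |t - s| ^ (b - 1)) volume p q :=
    (intervalIntegrable_abs_sub_rpow (by linarith) s p q).const_mul N
  refine hg.mono_fun ?_ ?_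
  · refine AEStronglyMeasurable.div₀ ?_
      (by fun_prop : Continuous fun t : ℝ => ((t - s : ℝ) : ℂ)).aestronglyMeasurable
    exact ((hA.mono uIoc_subset_uIcc).aestronglyMeasurable measurableSet_uIoc).sub
      aestronglyMeasurable_const
  · refine (ae_restrict_iff' measurableSet_uIoc).2 (Eventually.of_forall fun t ht => ?_)
    refine (norm_sub_div_le (h t (uIoc_subset_uIcc ht)) hN).trans (le_abs_self _)

lemma integrableOn_rpow_majorant {b : ℝ} (hb1 : b < 1) :
    IntegrableOn (fun r : ℝ => 2 * |r| ^ (b - 2)) {r | 2 < |r|} := by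
  have h1 : IntegrableOn (fun r : ℝ => 2 * |r| ^ (b - 2)) (Ioi 2) := by
    refine IntegrableOn.congr_fun (f := fun r : ℝ => 2 * r ^ (b - 2))
      ((integrableOn_Ioi_rpow_of_lt (by linarith : b - 2 < -1) two_pos).const_mul 2)
      (fun r hr => ?_) measurableSet_Ioi
    have : (0 : ℝ) < r := two_pos.trans hr
    simp only [abs_of_pos this]
  have h2 : IntegrableOn (fun r : ℝ => 2 * |r| ^ (b - 2)) (Iio (-2)) := by
    have := (Measure.measurePreserving_neg (volume : Measure ℝ)).integrableOn_comp_preimage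
      (Homeomorph.neg ℝ).measurableEmbedding (f := fun r : ℝ => 2 * |r| ^ (b - 2)) (s := Ioi 2)
    rw [← this] at h1
    have hs : (Neg.neg ⁻¹' Ioi (2 : ℝ)) = Iio (-2) := by ext r; simp [lt_neg]
    rw [hs] at h1
    refine h1.congr_fun (fun r _ => ?_) measurableSet_Iio
    simp
  refine (h1.union h2).mono_set fun r hr => ?_
  rcases lt_abs.1 (show 2 < |r| from hr) with h | h
  · exact Or.inl h
  · exact Or.inr (by simp; linarith)

/-- The Hilbert transform of a Hölder continuous function on a segment, compared at the points `0`
and `1`. The bound does not depend on the segment as long as `0` and `1` lie well inside it, at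
comparable distances from both ends. -/
lemma exists_unit_hilbert_bound {b : ℝ} (hb : 0 < b) (hb1 : b < 1) :
    ∃ C : ℝ, 0 ≤ C ∧ ∀ (A : ℝ → ℂ) (N P Q : ℝ), 0 ≤ N → P ≤ -2 → 2 ≤ Q →
      1 ≤ 3 * (Q - 1) / (1 - P) → 3 * (Q - 1) / (1 - P) ≤ 3 →
      ContinuousOn A (Icc P Q) →
      (∀ x ∈ Icc P Q, ∀ y ∈ Icc P Q, ‖A x - A y‖ ≤ N * |x - y| ^ b) →
      ‖(∫ r in P..Q, (A r - A 0) / ((r - 0 : ℝ) : ℂ)) -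
        ∫ r in P..Q, (A r - A 1) / ((r - 1 : ℝ) : ℂ)‖ ≤ C * N := by
  -- Far from `0` and `1` the integrands are combined to gain a power of decay; this costs the
  -- integral of `1 / (r - 1)` over the far part, a logarithm that the comparability of the
  -- distances to the ends keeps bounded.
  set far : Set ℝ := {r | 2 < |r|} with hfar
  have hfarm : MeasurableSet far := measurableSet_lt measurable_const measurable_norm
  set ω : ℝ → ℝ := fun r => (Icc (-2 : ℝ) 2).indicator (fun r => |r - 0| ^ (b - 1)) r +
    (Icc (-2 : ℝ) 4).indicator (fun r => |r - 1| ^ (b - 1)) r +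
    far.indicator (fun r => 2 * |r| ^ (b - 2)) r with hω
  have hωi : Integrable ω := by
    refine Integrable.add (Integrable.add ?_ ?_) ?_
    · rw [integrable_indicator_iff measurableSet_Icc, integrableOn_Icc_iff_integrableOn_Ioc,
        ← intervalIntegrable_iff_integrableOn_Ioc_of_le (by norm_num)]
      exact intervalIntegrable_abs_sub_rpow (by linarith) _ _ _
    · rw [integrable_indicator_iff measurableSet_Icc, integrableOn_Icc_iff_integrableOn_Ioc,
        ← intervalIntegrable_iff_integrableOn_Ioc_of_le (by norm_num)]
      exact intervalIntegrable_abs_sub_rpow (by linarith) _ _ _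
    · rw [integrable_indicator_iff hfarm]
      exact integrableOn_rpow_majorant hb1
  have hω0 : ∀ r, 0 ≤ ω r := fun r => by
    refine add_nonneg (add_nonneg ?_ ?_) ?_ <;> refine indicator_nonneg (fun r _ => ?_) r <;>
      positivity
  refine ⟨(∫ r, ω r) + 2, add_nonneg (integral_nonneg hω0) two_pos.le,
    fun A N P Q hN hP hQ hr1 hr2 hA hH => ?_⟩
  have hPQ : P ≤ Q := by linarith
  have m0 : (0 : ℝ) ∈ Icc P Q := ⟨by linarith, by linarith⟩
  have m1 : (1 : ℝ) ∈ Icc P Q := ⟨by linarith, by linarith⟩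
  have i0 : IntervalIntegrable (fun r => (A r - A 0) / ((r - 0 : ℝ) : ℂ)) volume P Q :=
    intervalIntegrable_sub_div hb hN (by rwa [uIcc_of_le hPQ])
      (fun t ht => hH t (by rwa [uIcc_of_le hPQ] at ht) 0 m0)
  have i1 : IntervalIntegrable (fun r => (A r - A 1) / ((r - 1 : ℝ) : ℂ)) volume P Q :=
    intervalIntegrable_sub_div hb hN (by rwa [uIcc_of_le hPQ])
      (fun t ht => hH t (by rwa [uIcc_of_le hPQ] at ht) 1 m1)
  set e : ℝ → ℝ := far.indicator (fun r => 1 / (r - 1)) with he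
  have j1 : IntervalIntegrable e volume P (-2) := by
    have : IntervalIntegrable (fun r : ℝ => 1 / (r - 1)) volume P (-2) := by
      refine ContinuousOn.intervalIntegrable fun r hr => ?_
      rw [uIcc_of_le hP] at hr
      have : r - 1 ≠ 0 := by linarith [hr.2]
      exact (by fun_prop (disch := assumption) : ContinuousAt _ _).continuousWithinAt
    exact ⟨this.1.indicator hfarm, this.2.indicator hfarm⟩
  have j2 : IntervalIntegrable e volume 2 Q := by
    have : IntervalIntegrable (fun r : ℝ => 1 / (r - 1)) volume 2 Q := by
      refine ContinuousOn.intervalIntegrable fun r hr => ?_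
      rw [uIcc_of_le hQ] at hr
      have : r - 1 ≠ 0 := by linarith [hr.1]
      exact (by fun_prop (disch := assumption) : ContinuousAt _ _).continuousWithinAt
    exact ⟨this.1.indicator hfarm, this.2.indicator hfarm⟩
  have e3 : EqOn e 0 (uIcc (-2) 2) := fun r hr => by
    rw [uIcc_of_le (by norm_num)] at hr
    exact indicator_of_notMem (by simpa [hfar] using abs_le.2 hr) _
  have j3 : IntervalIntegrable e volume (-2) 2 :=
    (IntervalIntegrable.zero : IntervalIntegrable (0 : ℝ → ℝ) volume (-2) 2).congr
      fun r hr => (e3 (uIoc_subset_uIcc hr)).symm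
  have ie : IntervalIntegrable e volume P Q := (j1.trans j3).trans j2
  have ve : ∫ r in P..Q, e r = Real.log (3 * (Q - 1) / (1 - P)) := by
    rw [← intervalIntegral.integral_add_adjacent_intervals (j1.trans j3) j2,
      ← intervalIntegral.integral_add_adjacent_intervals j1 j3]
    have v3 : ∫ r in (-2 : ℝ)..2, e r = 0 := by
      rw [intervalIntegral.integral_congr e3]; simp
    have v1 : ∫ r in P..(-2), e r = Real.log (3 / (1 - P)) := by
      have : ∫ r in P..(-2), e r = ∫ r in P..(-2), 1 / (r - 1) := by
        refine intervalIntegral.integral_congr_ae ?_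
        have : ∀ᵐ r : ℝ, r ≠ -2 := by simp [ae_iff]
        filter_upwards [this] with r hr2 hr
        rw [uIoc_of_le hP] at hr
        refine indicator_of_mem ?_ _
        have : r < -2 := lt_of_le_of_ne hr.2 hr2
        simp only [hfar, mem_ofPred_eq, lt_abs]
        right; linarith
      rw [this, intervalIntegral.integral_comp_sub_right (fun r => 1 / r),
        integral_one_div_of_neg (by linarith) (by norm_num)]
      congr 1
      rw [div_eq_div_iff (by linarith) (by linarith)]; ring
    have v2 : ∫ r in (2 : ℝ)..Q, e r = Real.log (Q - 1) := by
      have : ∫ r in (2 : ℝ)..Q, e r = ∫ r in (2 : ℝ)..Q, 1 / (r - 1) := by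
        refine intervalIntegral.integral_congr_ae (Eventually.of_forall fun r hr => ?_)
        rw [uIoc_of_le hQ] at hr
        refine indicator_of_mem ?_ _
        simp only [hfar, mem_ofPred_eq, lt_abs]
        left; exact hr.1
      rw [this, intervalIntegral.integral_comp_sub_right (fun r => 1 / r),
        integral_one_div_of_pos (by norm_num) (by linarith)]
      norm_num
    rw [v1, v2, v3, add_zero, ← Real.log_mul (by
      have : 0 < 3 / (1 - P) := by apply div_pos <;> linarith
      exact this.ne') (by linarith)]
    congr 1; ring
  have ve2 : |∫ r in P..Q, e r| ≤ 2 := by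
    rw [ve, abs_of_nonneg (Real.log_nonneg hr1)]
    have := Real.log_le_sub_one_of_pos (by linarith : 0 < 3 * (Q - 1) / (1 - P))
    linarith
  have iec : IntervalIntegrable (fun r => (A 1 - A 0) * (e r : ℂ)) volume P Q :=
    IntervalIntegrable.const_mul ⟨ie.1.ofReal, ie.2.ofReal⟩ _
  set D : ℝ → ℂ := fun r => (A r - A 0) / ((r - 0 : ℝ) : ℂ) - (A r - A 1) / ((r - 1 : ℝ) : ℂ) -
    (A 1 - A 0) * (e r : ℂ) with hD
  have hsplit : (∫ r in P..Q, (A r - A 0) / ((r - 0 : ℝ) : ℂ)) -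
        ∫ r in P..Q, (A r - A 1) / ((r - 1 : ℝ) : ℂ) =
      (∫ r in P..Q, D r) + (A 1 - A 0) * ((∫ r in P..Q, e r : ℝ) : ℂ) := by
    rw [hD, intervalIntegral.integral_sub (i0.sub i1) iec, intervalIntegral.integral_sub i0 i1,
      intervalIntegral.integral_const_mul, intervalIntegral.integral_ofReal]
    ring
  have hDb : ∀ r ∈ Icc P Q, ‖D r‖ ≤ N * ω r := by
    intro r hr
    have n1 := indicator_nonneg (s := Icc (-2 : ℝ) 2) (f := fun r : ℝ => |r - 0| ^ (b - 1))
      (fun r _ => by positivity) r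
    have n2 := indicator_nonneg (s := Icc (-2 : ℝ) 4) (f := fun r : ℝ => |r - 1| ^ (b - 1))
      (fun r _ => by positivity) r
    have n3 := indicator_nonneg (s := far) (f := fun r : ℝ => 2 * |r| ^ (b - 2))
      (fun r _ => by positivity) r
    by_cases hrf : r ∈ far
    · have h3 : far.indicator (fun r : ℝ => 2 * |r| ^ (b - 2)) r = 2 * |r| ^ (b - 2) :=
        indicator_of_mem hrf _
      have he1 : e r = 1 / (r - 1) := indicator_of_mem hrf _
      have hr2 : 2 < |r| := hrf
      have r0 : r ≠ 0 := by rintro rfl; simp at hr2; linarith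
      have hr1 : |r| / 2 ≤ |r - 1| := by
        have := abs_sub_abs_le_abs_sub r 1
        rw [abs_one] at this; linarith
      have r1 : r - 1 ≠ 0 := by
        intro h; rw [h, abs_zero] at hr1; linarith
      have e1 : D r = -((A r - A 0) / (((r : ℝ) : ℂ) * ((r - 1 : ℝ) : ℂ))) := by
        rw [hD]
        simp only [he1]
        have r0' : (r : ℂ) ≠ 0 := Complex.ofReal_ne_zero.2 r0
        have r1' : (r : ℂ) - 1 ≠ 0 := by exact_mod_cast r1
        push_cast
        field_simp
        ring
      have e2 : ‖D r‖ ≤ N * (2 * |r| ^ (b - 2)) := by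
        rw [e1, norm_neg, norm_div, norm_mul, Complex.norm_real, Complex.norm_real,
          Real.norm_eq_abs, Real.norm_eq_abs]
        have h5 := hH r hr 0 m0
        rw [sub_zero] at h5
        have hp : 0 < |r| := by linarith
        calc _ ≤ N * |r| ^ b / (|r| * (|r| / 2)) := by gcongr
          _ = N * (2 * (|r| ^ b / |r| ^ (2 : ℝ))) := by
            rw [Real.rpow_two]; field_simp
          _ = _ := by rw [← Real.rpow_sub hp]
      refine e2.trans (mul_le_mul_of_nonneg_left ?_ hN)
      rw [← h3]; simp only [hω]; linarith
    · have hr2 : |r| ≤ 2 := not_lt.1 hrf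
      have hr3 := abs_le.1 hr2
      have he1 : e r = 0 := indicator_of_notMem hrf _
      have k1 : (Icc (-2 : ℝ) 2).indicator (fun r : ℝ => |r - 0| ^ (b - 1)) r = |r - 0| ^ (b - 1) :=
        indicator_of_mem (show r ∈ Icc (-2 : ℝ) 2 from hr3) _
      have k2 : (Icc (-2 : ℝ) 4).indicator (fun r : ℝ => |r - 1| ^ (b - 1)) r = |r - 1| ^ (b - 1) :=
        indicator_of_mem (show r ∈ Icc (-2 : ℝ) 4 from ⟨hr3.1, by linarith [hr3.2]⟩) _
      have e2 : ‖D r‖ ≤ N * (|r - 0| ^ (b - 1) + |r - 1| ^ (b - 1)) := by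
        simp only [hD, he1, Complex.ofReal_zero, mul_zero, sub_zero (_ - _ : ℂ)]
        rw [mul_add]
        exact (norm_sub_le _ _).trans (add_le_add (norm_sub_div_le (hH r hr 0 m0) hN)
          (norm_sub_div_le (hH r hr 1 m1) hN))
      refine e2.trans (mul_le_mul_of_nonneg_left ?_ hN)
      simp only [hω]; linarith
  have hI : ‖∫ r in P..Q, D r‖ ≤ N * ∫ r, ω r := by
    rw [intervalIntegral.integral_of_le hPQ]
    refine (norm_integral_le_of_norm_le (g := fun r => N * ω r) (hωi.const_mul N).integrableOn
      ((ae_restrict_iff' measurableSet_Ioc).2 (Eventually.of_forall fun r hr =>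
        hDb r (Ioc_subset_Icc_self hr)))).trans ?_
    rw [integral_const_mul]
    exact mul_le_mul_of_nonneg_left
      (setIntegral_le_integral hωi (Eventually.of_forall hω0)) hN
  rw [hsplit]
  refine (norm_add_le _ _).trans ?_
  rw [norm_mul, Complex.norm_real, Real.norm_eq_abs]
  have h10 := hH 1 m1 0 m0
  simp only [sub_zero, abs_one, Real.one_rpow, mul_one] at h10
  have : ‖A 1 - A 0‖ * |∫ r in P..Q, e r| ≤ N * 2 :=
    mul_le_mul h10 ve2 (abs_nonneg _) hN
  linarith

/-! ### The weighted Hilbert transform on the half-line -/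

lemma abs_rpow_sub_rpow_le {x y b : ℝ} (hx : 0 ≤ x) (hy : 0 ≤ y) (hb : 0 ≤ b) (hb1 : b ≤ 1) :
    |x ^ b - y ^ b| ≤ |x - y| ^ b := by
  wlog h : y ≤ x generalizing x y
  · rw [abs_sub_comm, abs_sub_comm x y]; exact this hy hx (le_of_not_ge h)
  have h1 := Real.rpow_add_le_add_rpow (sub_nonneg.2 h) hy hb hb1
  rw [sub_add_cancel] at h1
  rw [abs_of_nonneg (sub_nonneg.2 h),
    abs_of_nonneg (sub_nonneg.2 (Real.rpow_le_rpow hy h hb))]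
  linarith

lemma exists_rpow_lipschitz {c M : ℝ} (hc : 0 < c) (e : ℝ) :
    ∃ K : ℝ, 0 ≤ K ∧ ∀ x ∈ Icc c M, ∀ y ∈ Icc c M, |x ^ e - y ^ e| ≤ K * |x - y| := by
  have h : ContDiffOn ℝ 1 (fun x : ℝ => x ^ e) (Icc c M) := fun x hx =>
    (Real.contDiffAt_rpow_const (Or.inl (hc.trans_le hx.1).ne')).contDiffWithinAt
  obtain ⟨K, hK⟩ := h.exists_lipschitzOnWith one_ne_zero (convex_Icc c M) isCompact_Icc
  exact ⟨K, K.2, fun x hx y hy => by simpa [Real.dist_eq] using hK.dist_le_mul x hx y hy⟩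

/-- `F` is bounded by `N` and Hölder continuous with the exponent `b` and the constant `N` on the
open half-line. -/
def HolderHalf (b N : ℝ) (F : ℝ → ℂ) : Prop :=
  (∀ x, 0 < x → ‖F x‖ ≤ N) ∧ ∀ x y, 0 < x → 0 < y → ‖F x - F y‖ ≤ N * |x - y| ^ b

namespace HolderHalf

variable {b N : ℝ} {F : ℝ → ℂ}

lemma nonneg (hF : HolderHalf b N F) : 0 ≤ N := (norm_nonneg _).trans (hF.1 1 one_pos)

lemma continuousOn (hb : 0 < b) (hF : HolderHalf b N F) : ContinuousOn F (Ioi 0) := by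
  intro x hx
  rw [ContinuousWithinAt, tendsto_iff_norm_sub_tendsto_zero]
  have h1 : Tendsto (fun y : ℝ => N * |y - x| ^ b) (𝓝[Ioi 0] x) (𝓝 0) := by
    have : ContinuousAt (fun y : ℝ => N * |y - x| ^ b) x := by
      refine continuousAt_const.mul (ContinuousAt.rpow_const (by fun_prop) (Or.inr hb.le))
    have h := this.tendsto
    simp only [sub_self, abs_zero, Real.zero_rpow hb.ne', mul_zero] at h
    exact h.mono_left nhdsWithin_le_nhds
  refine squeeze_zero' (Eventually.of_forall fun y => norm_nonneg _) ?_ h1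
  filter_upwards [self_mem_nhdsWithin] with y hy
  exact hF.2 y x hy hx

end HolderHalf

/-- The Hilbert transform of `F` at `s`, restricted to the window `[s / 2, 3 s / 2]`. The window is
symmetric about `s`, so that subtracting `F s` does not change the principal value. -/
def windowHilbert (F : ℝ → ℂ) (s : ℝ) : ℂ :=
  ∫ t in (s / 2)..(3 * s / 2), (F t - F s) / ((t - s : ℝ) : ℂ)

section Window

variable {b N : ℝ} {F : ℝ → ℂ}

lemma norm_windowHilbert_le (hb : 0 < b) (hF : HolderHalf b N F) {s : ℝ} (hs : 0 < s) :
    ‖windowHilbert F s‖ ≤ 2 / b * N * s ^ b := by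
  have hN := hF.nonneg
  have h1 : s / 2 ≤ 3 * s / 2 := by linarith
  have h2 := intervalIntegral.norm_integral_le_of_norm_le (μ := volume)
    (f := fun t => (F t - F s) / ((t - s : ℝ) : ℂ)) (g := fun t => N * |t - s| ^ (b - 1)) h1
    (Eventually.of_forall fun t ht =>
      norm_sub_div_le (hF.2 t s (by linarith [ht.1]) hs) hN)
    ((intervalIntegrable_abs_sub_rpow (by linarith) s _ _).const_mul N)
  rw [intervalIntegral.integral_const_mul] at h2
  have h3 := integral_abs_sub_rpow_le (r := b - 1) (s := s) (l := s) (by linarith) h1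
    (by linarith) (by linarith)
  rw [sub_add_cancel] at h3
  refine h2.trans ((mul_le_mul_of_nonneg_left h3 hN).trans (le_of_eq ?_))
  ring

lemma exists_windowHilbert_sub_le (hb : 0 < b) (hb1 : b < 1) :
    ∃ C : ℝ, 0 ≤ C ∧ ∀ N F, HolderHalf b N F → ∀ s₁ s₂ : ℝ, 0 < s₁ → s₁ < s₂ →
      ‖windowHilbert F s₁ - windowHilbert F s₂‖ ≤ C * N * (s₂ - s₁) ^ b := by
  obtain ⟨C₀, hC₀, hC⟩ := exists_unit_hilbert_bound hb hb1
  refine ⟨36 / b + (C₀ + 2), by positivity, fun N F hF s₁ s₂ h₁ h₁₂ => ?_⟩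
  have hN := hF.nonneg
  set d := s₂ - s₁ with hd
  have hd0 : 0 < d := sub_pos.2 h₁₂
  have hdb : 0 ≤ d ^ b := by positivity
  have h₂ : 0 < s₂ := h₁.trans h₁₂
  -- If `d` is comparable to `s₁`, the sizes of the two terms suffice.
  rcases le_or_gt s₁ (8 * d) with hc | hc
  · have e : ∀ s, 0 < s → s ≤ 9 * d → ‖windowHilbert F s‖ ≤ 18 / b * N * d ^ b := by
      intro s hs hs9
      refine (norm_windowHilbert_le hb hF hs).trans ?_
      have : s ^ b ≤ 9 * d ^ b := by
        refine (Real.rpow_le_rpow hs.le hs9 hb.le).trans ?_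
        rw [Real.mul_rpow (by norm_num) hd0.le]
        gcongr
        calc (9 : ℝ) ^ b ≤ 9 ^ (1 : ℝ) := Real.rpow_le_rpow_of_exponent_le (by norm_num) hb1.le
          _ = 9 := Real.rpow_one _
      calc _ ≤ 2 / b * N * (9 * d ^ b) := by gcongr
        _ = _ := by ring
    calc _ ≤ 18 / b * N * d ^ b + 18 / b * N * d ^ b :=
          (norm_sub_le _ _).trans (add_le_add (e s₁ h₁ (by linarith)) (e s₂ h₂ (by linarith)))
      _ = (36 / b + 0) * N * d ^ b := by ring
      _ ≤ _ := by gcongr; positivity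
  set p := s₂ / 2 with hp
  set q := 3 * s₁ / 2 with hq
  have hpq : p ≤ q := by linarith
  have ii : ∀ s x y, 0 < s → 0 < x → 0 < y →
      IntervalIntegrable (fun t => (F t - F s) / ((t - s : ℝ) : ℂ)) volume x y := by
    intro s x y hs hx hy
    have hsub : uIcc x y ⊆ Ioi 0 := fun t ht => (lt_min hx hy).trans_le ht.1
    exact intervalIntegrable_sub_div hb hN ((hF.continuousOn hb).mono hsub)
      fun t ht => hF.2 t s (hsub ht) hs
  have w₁ : windowHilbert F s₁ = (∫ t in (s₁ / 2)..p, (F t - F s₁) / ((t - s₁ : ℝ) : ℂ)) +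
      ∫ t in p..q, (F t - F s₁) / ((t - s₁ : ℝ) : ℂ) := by
    rw [windowHilbert, intervalIntegral.integral_add_adjacent_intervals] <;> apply ii <;> linarith
  have w₂ : windowHilbert F s₂ = (∫ t in p..q, (F t - F s₂) / ((t - s₂ : ℝ) : ℂ)) +
      ∫ t in q..(3 * s₂ / 2), (F t - F s₂) / ((t - s₂ : ℝ) : ℂ) := by
    rw [windowHilbert, intervalIntegral.integral_add_adjacent_intervals] <;> apply ii <;> linarith
  -- Away from the point the integrand is at most `N * d ^ (b - 1)`.
  have small : ∀ s t, 0 < s → 0 < t → d ≤ |t - s| →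
      ‖(F t - F s) / ((t - s : ℝ) : ℂ)‖ ≤ N * d ^ (b - 1) := by
    intro s t hs ht hts
    refine (norm_sub_div_le (hF.2 t s ht hs) hN).trans (mul_le_mul_of_nonneg_left ?_ hN)
    exact Real.rpow_le_rpow_of_nonpos hd0 hts (by linarith)
  have hdd : d ^ (b - 1) * d = d ^ b := by
    rw [← Real.rpow_add_one hd0.ne', sub_add_cancel]
  have r₁ : ‖∫ t in (s₁ / 2)..p, (F t - F s₁) / ((t - s₁ : ℝ) : ℂ)‖ ≤ 1 / 2 * N * d ^ b := by
    have := intervalIntegral.norm_integral_le_of_norm_le_const (a := s₁ / 2) (b := p)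
      (f := fun t => (F t - F s₁) / ((t - s₁ : ℝ) : ℂ)) (C := N * d ^ (b - 1)) fun t ht => by
        rw [uIoc_of_le (by linarith)] at ht
        refine small s₁ t h₁ (by linarith [ht.1]) ?_
        rw [abs_sub_comm]
        exact le_trans (by linarith [ht.2]) (le_abs_self _)
    refine this.trans (le_of_eq ?_)
    have : p - s₁ / 2 = d / 2 := by rw [hp, hd]; ring
    rw [this, abs_of_pos (by positivity), ← hdd]
    ring
  have r₂ : ‖∫ t in q..(3 * s₂ / 2), (F t - F s₂) / ((t - s₂ : ℝ) : ℂ)‖ ≤ 3 / 2 * N * d ^ b := by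
    have := intervalIntegral.norm_integral_le_of_norm_le_const (a := q) (b := 3 * s₂ / 2)
      (f := fun t => (F t - F s₂) / ((t - s₂ : ℝ) : ℂ)) (C := N * d ^ (b - 1)) fun t ht => by
        rw [uIoc_of_le (by linarith)] at ht
        refine small s₂ t h₂ (by linarith [ht.1]) ?_
        exact le_trans (by linarith [ht.1]) (le_abs_self _)
    refine this.trans (le_of_eq ?_)
    have : 3 * s₂ / 2 - q = 3 / 2 * d := by rw [hq, hd]; ring
    rw [this, abs_of_pos (by positivity), ← hdd]
    ring
  -- The common window `[p, q]`, rescaled so that `s₁` and `s₂` become `0` and `1`.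
  set A : ℝ → ℂ := fun r => F (s₁ + d * r) with hA
  have scale : ∀ σ : ℝ, ∫ t in p..q, (F t - F (s₁ + d * σ)) / ((t - (s₁ + d * σ) : ℝ) : ℂ) =
      ∫ r in ((p - s₁) / d)..((q - s₁) / d), (A r - A σ) / ((r - σ : ℝ) : ℂ) := by
    intro σ
    have := intervalIntegral.smul_integral_comp_add_mul (a := (p - s₁) / d) (b := (q - s₁) / d)
      (fun t => (F t - F (s₁ + d * σ)) / ((t - (s₁ + d * σ) : ℝ) : ℂ)) d s₁
    have ep : s₁ + d * ((p - s₁) / d) = p := by field_simp; ring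
    have eq : s₁ + d * ((q - s₁) / d) = q := by field_simp; ring
    rw [ep, eq] at this
    rw [← this, ← intervalIntegral.integral_smul]
    refine intervalIntegral.integral_congr fun r _ => ?_
    simp only [hA, Complex.real_smul]
    have e1 : ((s₁ + d * r - (s₁ + d * σ) : ℝ) : ℂ) = (d : ℂ) * ((r - σ : ℝ) : ℂ) := by
      push_cast; ring
    have hdc : (d : ℂ) ≠ 0 := Complex.ofReal_ne_zero.2 hd0.ne'
    rw [e1, ← mul_div_assoc, mul_div_mul_left _ _ hdc]
  have s0 := scale 0
  have s1 := scale 1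
  rw [mul_zero, add_zero] at s0
  have e2 : s₁ + d * 1 = s₂ := by rw [hd]; ring
  rw [e2] at s1
  have hPpos : ∀ x ∈ Icc ((p - s₁) / d) ((q - s₁) / d), 0 < s₁ + d * x := by
    intro x hx
    have := hx.1
    rw [div_le_iff₀ hd0] at this
    nlinarith
  have key := hC A (N * d ^ b) ((p - s₁) / d) ((q - s₁) / d) (by positivity)
    (by rw [div_le_iff₀ hd0]; linarith) (by rw [le_div_iff₀ hd0]; linarith)
    (by
      have e : 3 * ((q - s₁) / d - 1) / (1 - (p - s₁) / d) = 3 * (q - s₂) / (s₂ - p) := by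
        have h3 : s₂ - p ≠ 0 := by linarith
        have h4 : 1 - (p - s₁) / d = (s₂ - p) / d := by field_simp; rw [hd]; ring
        have h5 : (q - s₁) / d - 1 = (q - s₂) / d := by field_simp; rw [hd]; ring
        rw [h4, h5]; field_simp
      rw [e, le_div_iff₀ (by linarith)]; linarith)
    (by
      have e : 3 * ((q - s₁) / d - 1) / (1 - (p - s₁) / d) = 3 * (q - s₂) / (s₂ - p) := by
        have h3 : s₂ - p ≠ 0 := by linarith
        have h4 : 1 - (p - s₁) / d = (s₂ - p) / d := by field_simp; rw [hd]; ring
        have h5 : (q - s₁) / d - 1 = (q - s₂) / d := by field_simp; rw [hd]; ring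
        rw [h4, h5]; field_simp
      rw [e, div_le_iff₀ (by linarith)]; linarith)
    ((hF.continuousOn hb).comp (by fun_prop) fun x hx => hPpos x hx)
    (fun x hx y hy => by
      refine (hF.2 _ _ (hPpos x hx) (hPpos y hy)).trans (le_of_eq ?_)
      have : s₁ + d * x - (s₁ + d * y) = d * (x - y) := by ring
      rw [this, abs_mul, abs_of_pos hd0, Real.mul_rpow hd0.le (abs_nonneg _), mul_assoc])
  rw [← s0, ← s1] at key
  rw [w₁, w₂]
  have tri : ∀ α β γ δ : ℂ, α + β - (γ + δ) = (β - γ) + (α - δ) := fun _ _ _ _ => by ring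
  rw [tri]
  calc _ ≤ C₀ * (N * d ^ b) + (1 / 2 * N * d ^ b + 3 / 2 * N * d ^ b) :=
        (norm_add_le _ _).trans (add_le_add key ((norm_sub_le _ _).trans (add_le_add r₁ r₂)))
    _ = (0 + (C₀ + 2)) * N * d ^ b := by ring
    _ ≤ _ := by gcongr; positivity

end Window

/-- The indicator function of the window `[1 / 2, 3 / 2]`. -/
def window (u : ℝ) : ℝ := (Icc (1 / 2 : ℝ) (3 / 2)).indicator 1 u

/-- The principal value of `∫ u ^ (-a) F (s u) / (u - 1) du` over the positive half-line, that is,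
`s ^ a` times the Hilbert transform of `t ^ (-a) F t`. The singularity is removed by subtracting
`F s` in a window symmetric about `u = 1`. -/
def halfHilbert (a : ℝ) (F : ℝ → ℂ) (s : ℝ) : ℂ :=
  ∫ u in Ioi (0 : ℝ), (((u ^ (-a) : ℝ) : ℂ) * F (s * u) - (window u : ℂ) * F s) /
    ((u - 1 : ℝ) : ℂ)

/-- The kernel outside the window, against `1` (for sizes) and `u ^ b` (for Hölder quotients). At
infinity this needs `b < a`, at zero it needs `a < 1`. -/
lemma integrableOn_kernel_weight {a b : ℝ} (hb : 0 < b) (hba : b < a) (ha : a < 1) :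
    IntegrableOn (fun u : ℝ => |(u ^ (-a) - window u) / (u - 1)| * (1 + u ^ b)) (Ioi 0) := by
  have hmeas : Measurable fun u : ℝ => |(u ^ (-a) - window u) / (u - 1)| * (1 + u ^ b) := by
    have : Measurable window := measurable_one.indicator measurableSet_Icc
    fun_prop
  have hun : Ioi (0 : ℝ) ⊆ Ioc 0 (1 / 2) ∪ (Icc (1 / 2) (3 / 2) ∪ Ioi (3 / 2)) := fun u hu => by
    have hu : 0 < u := hu
    by_cases h1 : u ≤ 1 / 2
    · exact Or.inl ⟨hu, h1⟩
    · by_cases h2 : u ≤ 3 / 2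
      · exact Or.inr (Or.inl ⟨by linarith, h2⟩)
      · exact Or.inr (Or.inr (by simpa using h2))
  refine IntegrableOn.mono_set ?_ hun
  obtain ⟨K, hK0, hK⟩ := exists_rpow_lipschitz (M := 3 / 2) (by norm_num : (0 : ℝ) < 1 / 2) (-a)
  refine IntegrableOn.union ?_ (IntegrableOn.union ?_ ?_)
  · have hg : IntegrableOn (fun u : ℝ => (4 + 4) * u ^ (-a)) (Ioc 0 (1 / 2)) := by
      have := intervalIntegral.intervalIntegrable_rpow' (a := 0) (b := 1 / 2)
        (by linarith : -1 < -a)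
      rw [intervalIntegrable_iff_integrableOn_Ioc_of_le (by norm_num)] at this
      exact this.const_mul _
    refine hg.mono' hmeas.aestronglyMeasurable
      ((ae_restrict_iff' measurableSet_Ioc).2 (Eventually.of_forall fun u hu => ?_))
    have hu0 : 0 < u := hu.1
    have hup : 1 ≤ u ^ (-a) :=
      Real.one_le_rpow_of_pos_of_le_one_of_nonpos hu0 (by linarith [hu.2]) (by linarith)
    have hub : u ^ b ≤ 1 := Real.rpow_le_one hu0.le (by linarith [hu.2]) hb.le
    have hub0 : 0 ≤ u ^ b := by positivity
    have hw : 0 ≤ window u ∧ window u ≤ 1 := by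
      unfold window
      by_cases h : u ∈ Icc (1 / 2 : ℝ) (3 / 2)
      · rw [indicator_of_mem h]; simp
      · rw [indicator_of_notMem h]; simp
    have h3 : 1 / 2 ≤ |u - 1| := by
      rw [abs_sub_comm]; exact le_trans (by linarith [hu.2]) (le_abs_self _)
    rw [Real.norm_of_nonneg (by positivity), abs_div]
    calc _ ≤ (u ^ (-a) / (1 / 2)) * (1 + 1) := by
          gcongr
          rw [abs_of_nonneg (by linarith)]; linarith
      _ = 4 * u ^ (-a) := by ring
      _ ≤ _ := by linarith
  · have hg : IntegrableOn (fun _ : ℝ => K * (1 + (3 / 2) ^ b)) (Icc (1 / 2 : ℝ) (3 / 2)) := by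
      refine integrableOn_const (by simp)
    refine hg.mono' hmeas.aestronglyMeasurable
      ((ae_restrict_iff' measurableSet_Icc).2 (Eventually.of_forall fun u hu => ?_))
    have hu0 : 0 < u := lt_of_lt_of_le (by norm_num) hu.1
    have hw : window u = 1 := indicator_of_mem hu _
    have h1 := hK u hu 1 ⟨by norm_num, by norm_num⟩
    rw [Real.one_rpow] at h1
    rw [Real.norm_of_nonneg (by positivity), hw, abs_div]
    have h2 : |u ^ (-a) - 1| / |u - 1| ≤ K := div_le_of_le_mul₀ (abs_nonneg _) hK0 h1
    gcongr
    exact hu.2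
  · have hg : IntegrableOn (fun u : ℝ => 6 * u ^ (b - a - 1)) (Ioi (3 / 2)) :=
      (integrableOn_Ioi_rpow_of_lt (by linarith) (by norm_num)).const_mul _
    refine hg.mono' hmeas.aestronglyMeasurable
      ((ae_restrict_iff' measurableSet_Ioi).2 (Eventually.of_forall fun u hu => ?_))
    have hu' : 3 / 2 < u := hu
    have hu0 : 0 < u := by linarith
    have hw : window u = 0 := indicator_of_notMem (fun h => by linarith [h.2]) _
    have hub : 1 ≤ u ^ b := Real.one_le_rpow (by linarith) hb.le
    rw [Real.norm_of_nonneg (by positivity), hw, sub_zero,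
      abs_of_nonneg (div_nonneg (by positivity) (by linarith))]
    calc _ ≤ u ^ (-a) / (u / 3) * (u ^ b + u ^ b) := by
          gcongr; linarith
      _ = 6 * (u ^ b * u ^ (-a) / u) := by field_simp; ring
      _ = _ := by
          rw [← Real.rpow_add hu0, ← Real.rpow_sub_one hu0.ne']
          congr 2

section HalfLine

variable {a b N : ℝ} {F : ℝ → ℂ}

lemma integrableOn_kernel_mul (hb : 0 < b) (hba : b < a) (ha : a < 1) (hF : HolderHalf b N F)
    {s : ℝ} (hs : 0 < s) :
    IntegrableOn (fun u : ℝ => (((u ^ (-a) - window u) / (u - 1) : ℝ) : ℂ) * F (s * u))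
      (Ioi 0) := by
  have hw := integrableOn_kernel_weight hb hba ha
  refine Integrable.mono' (hw.const_mul N) ?_
    ((ae_restrict_iff' measurableSet_Ioi).2 (Eventually.of_forall fun u hu => ?_))
  · refine AEStronglyMeasurable.mul ?_ ?_
    · have : Measurable window := measurable_one.indicator measurableSet_Icc
      have h2 : Measurable fun u : ℝ => (((u ^ (-a) - window u) / (u - 1) : ℝ) : ℂ) := by fun_prop
      exact h2.aestronglyMeasurable
    · refine ContinuousOn.aestronglyMeasurable ?_ measurableSet_Ioi
      exact (hF.continuousOn hb).comp (by fun_prop) fun u hu => mul_pos hs hu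
  · have hu : 0 < u := hu
    rw [norm_mul, Complex.norm_real, Real.norm_eq_abs]
    have h1 := hF.1 (s * u) (mul_pos hs hu)
    have h2 : 0 ≤ u ^ b := by positivity
    have hN := hF.nonneg
    calc _ ≤ |(u ^ (-a) - window u) / (u - 1)| * N := by gcongr
      _ = N * (|(u ^ (-a) - window u) / (u - 1)| * (1 + 0)) := by ring
      _ ≤ _ := by gcongr

lemma window_part_eq (F : ℝ → ℂ) {s : ℝ} (hs : 0 < s) :
    ∫ u in (1 / 2 : ℝ)..(3 / 2), (F (s * u) - F s) / ((u - 1 : ℝ) : ℂ) = windowHilbert F s := by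
  have := intervalIntegral.smul_integral_comp_mul_left (a := 1 / 2) (b := 3 / 2)
    (fun t => (F t - F s) / ((t - s : ℝ) : ℂ)) s
  have e1 : s * (1 / 2) = s / 2 := by ring
  have e2 : s * (3 / 2) = 3 * s / 2 := by ring
  rw [e1, e2] at this
  rw [windowHilbert, ← this, ← intervalIntegral.integral_smul]
  refine intervalIntegral.integral_congr fun u _ => ?_
  have hsc : (s : ℂ) ≠ 0 := Complex.ofReal_ne_zero.2 hs.ne'
  have e1 : ((s * u - s : ℝ) : ℂ) = (s : ℂ) * ((u - 1 : ℝ) : ℂ) := by push_cast; ring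
  simp only [Complex.real_smul]
  rw [e1, ← mul_div_assoc, mul_div_mul_left _ _ hsc]

lemma integrableOn_window_part (hb : 0 < b) (hF : HolderHalf b N F) {s : ℝ} (hs : 0 < s) :
    IntegrableOn (fun u : ℝ => (F (s * u) - F s) / ((u - 1 : ℝ) : ℂ)) (Icc (1 / 2) (3 / 2)) := by
  have hG : IntervalIntegrable (fun u : ℝ => (F (s * u) - F (s * 1)) / ((u - 1 : ℝ) : ℂ))
      volume (1 / 2) (3 / 2) := by
    refine intervalIntegrable_sub_div (A := fun u => F (s * u)) (N := N * s ^ b) hb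
      (mul_nonneg hF.nonneg (by positivity)) ?_ fun t ht => ?_
    · refine (hF.continuousOn hb).comp (by fun_prop) fun u hu => ?_
      rw [uIcc_of_le (by norm_num)] at hu
      exact mul_pos hs (by linarith [hu.1])
    · rw [uIcc_of_le (by norm_num)] at ht
      refine (hF.2 _ _ (mul_pos hs (by linarith [ht.1])) (by simpa using hs)).trans (le_of_eq ?_)
      rw [← mul_sub, abs_mul, abs_of_pos hs, Real.mul_rpow hs.le (abs_nonneg _), mul_assoc]
  rw [mul_one] at hG
  rwa [intervalIntegrable_iff_integrableOn_Icc_of_le (by norm_num)] at hG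

lemma halfHilbert_integrand_eq (a : ℝ) (F : ℝ → ℂ) (s u : ℝ) :
    (((u ^ (-a) : ℝ) : ℂ) * F (s * u) - (window u : ℂ) * F s) / ((u - 1 : ℝ) : ℂ) =
    (((u ^ (-a) - window u) / (u - 1) : ℝ) : ℂ) * F (s * u) +
      (Icc (1 / 2 : ℝ) (3 / 2)).indicator (fun u => (F (s * u) - F s) / ((u - 1 : ℝ) : ℂ)) u := by
  by_cases h : u ∈ Icc (1 / 2 : ℝ) (3 / 2)
  · have hw : window u = 1 := indicator_of_mem h _
    rw [indicator_of_mem h, hw]; push_cast; ring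
  · have hw : window u = 0 := indicator_of_notMem h _
    rw [indicator_of_notMem h, hw]; push_cast; ring

lemma integrableOn_halfHilbert (hb : 0 < b) (hba : b < a) (ha : a < 1) (hF : HolderHalf b N F)
    {s : ℝ} (hs : 0 < s) :
    IntegrableOn (fun u : ℝ => (((u ^ (-a) : ℝ) : ℂ) * F (s * u) - (window u : ℂ) * F s) /
    ((u - 1 : ℝ) : ℂ)) (Ioi 0) := by
  simp only [halfHilbert_integrand_eq]
  refine (integrableOn_kernel_mul hb hba ha hF hs).add ?_
  exact ((integrable_indicator_iff measurableSet_Icc).2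
    (integrableOn_window_part hb hF hs)).integrableOn

lemma halfHilbert_eq (hb : 0 < b) (hba : b < a) (ha : a < 1) (hF : HolderHalf b N F)
    {s : ℝ} (hs : 0 < s) :
    halfHilbert a F s =
      (∫ u in Ioi (0 : ℝ), (((u ^ (-a) - window u) / (u - 1) : ℝ) : ℂ) * F (s * u)) +
        windowHilbert F s := by
  have h2 := integrableOn_window_part hb hF hs
  rw [halfHilbert]
  simp only [halfHilbert_integrand_eq]
  rw [integral_add (integrableOn_kernel_mul hb hba ha hF hs)
    ((integrable_indicator_iff measurableSet_Icc).2 h2).integrableOn,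
    setIntegral_indicator measurableSet_Icc, inter_eq_self_of_subset_right, ← window_part_eq F hs,
    intervalIntegral.integral_of_le (by norm_num), integral_Icc_eq_integral_Ioc]
  intro u hu
  exact lt_of_lt_of_le (by norm_num) hu.1

/-- The weight `t ^ a` times the Hilbert transform of `t ^ (-a) F t` is bounded and Hölder
continuous up to `t = 0`. -/
lemma exists_halfHilbert_bound (hb : 0 < b) (hba : b < a) (ha : a < 1) :
    ∃ C : ℝ, 0 ≤ C ∧ ∀ N F, HolderHalf b N F →
      (∀ s, 0 < s → s ≤ 1 → ‖halfHilbert a F s‖ ≤ C * N) ∧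
      ∀ s₁ s₂, 0 < s₁ → 0 < s₂ →
        ‖halfHilbert a F s₁ - halfHilbert a F s₂‖ ≤ C * N * |s₁ - s₂| ^ b := by
  obtain ⟨C₁, hC₁, h₁⟩ := exists_windowHilbert_sub_le hb (hba.trans ha)
  have hw := integrableOn_kernel_weight hb hba ha
  set I := ∫ u in Ioi (0 : ℝ), |(u ^ (-a) - window u) / (u - 1)| * (1 + u ^ b) with hI
  have hI0 : 0 ≤ I := setIntegral_nonneg measurableSet_Ioi fun u hu => by
    have hu : 0 < u := hu
    positivity
  refine ⟨I + (2 / b + C₁), by positivity, fun N F hF => ⟨fun s hs hs1 => ?_, ?_⟩⟩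
  · have hN := hF.nonneg
    rw [halfHilbert_eq hb hba ha hF hs]
    have e1 : ‖∫ u in Ioi (0 : ℝ), (((u ^ (-a) - window u) / (u - 1) : ℝ) : ℂ) * F (s * u)‖ ≤
        N * I := by
      rw [hI, ← integral_const_mul]
      refine norm_integral_le_of_norm_le (hw.const_mul N)
        ((ae_restrict_iff' measurableSet_Ioi).2 (Eventually.of_forall fun u hu => ?_))
      have hu : 0 < u := hu
      rw [norm_mul, Complex.norm_real, Real.norm_eq_abs]
      have h1 := hF.1 (s * u) (mul_pos hs hu)
      have h2 : 0 ≤ u ^ b := by positivity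
      calc _ ≤ |(u ^ (-a) - window u) / (u - 1)| * N := by gcongr
        _ = N * (|(u ^ (-a) - window u) / (u - 1)| * (1 + 0)) := by ring
        _ ≤ _ := by gcongr
    have e2 := norm_windowHilbert_le hb hF hs
    have e3 : s ^ b ≤ 1 := Real.rpow_le_one hs.le hs1 hb.le
    calc _ ≤ N * I + 2 / b * N * 1 := (norm_add_le _ _).trans
          (add_le_add e1 (e2.trans (by gcongr)))
      _ = (I + (2 / b + 0)) * N := by ring
      _ ≤ _ := by gcongr
  · have hN := hF.nonneg
    intro s₁ s₂ hs₁ hs₂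
    wlog h : s₁ ≤ s₂ generalizing s₁ s₂
    · rw [norm_sub_rev, abs_sub_comm]; exact this s₂ s₁ hs₂ hs₁ (le_of_not_ge h)
    rcases h.eq_or_lt with h | h
    · rw [h]; simp; positivity
    have ed : |s₁ - s₂| = s₂ - s₁ := by rw [abs_sub_comm, abs_of_pos (sub_pos.2 h)]
    rw [halfHilbert_eq hb hba ha hF hs₁, halfHilbert_eq hb hba ha hF hs₂, add_sub_add_comm,
      ← integral_sub (integrableOn_kernel_mul hb hba ha hF hs₁)
        (integrableOn_kernel_mul hb hba ha hF hs₂)]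
    have e1 : ‖∫ u in Ioi (0 : ℝ), ((((u ^ (-a) - window u) / (u - 1) : ℝ) : ℂ) * F (s₁ * u) -
        (((u ^ (-a) - window u) / (u - 1) : ℝ) : ℂ) * F (s₂ * u))‖ ≤
        N * |s₁ - s₂| ^ b * I := by
      rw [hI, ← integral_const_mul]
      refine norm_integral_le_of_norm_le (hw.const_mul _)
        ((ae_restrict_iff' measurableSet_Ioi).2 (Eventually.of_forall fun u hu => ?_))
      have hu : 0 < u := hu
      rw [← mul_sub, norm_mul, Complex.norm_real, Real.norm_eq_abs]
      have h1 := hF.2 (s₁ * u) (s₂ * u) (mul_pos hs₁ hu) (mul_pos hs₂ hu)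
      rw [← sub_mul, abs_mul, abs_of_pos hu, Real.mul_rpow (abs_nonneg _) hu.le] at h1
      calc _ ≤ |(u ^ (-a) - window u) / (u - 1)| * (N * (|s₁ - s₂| ^ b * u ^ b)) := by gcongr
        _ = N * |s₁ - s₂| ^ b * (|(u ^ (-a) - window u) / (u - 1)| * (0 + u ^ b)) := by ring
        _ ≤ _ := by gcongr; exact zero_le_one
    have e2 := h₁ N F hF s₁ s₂ hs₁ h
    rw [← ed] at e2
    calc _ ≤ N * |s₁ - s₂| ^ b * I + C₁ * N * |s₁ - s₂| ^ b :=
          (norm_add_le _ _).trans (add_le_add e1 e2)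
      _ = (I + (0 + C₁)) * N * |s₁ - s₂| ^ b := by ring
      _ ≤ _ := by gcongr; positivity

end HalfLine

/-! ### The weighted Hölder space of the unit interval -/

/-- The weight `t ^ a (1 - t) ^ a` of the unit interval. -/
def wt (a t : ℝ) : ℝ := t ^ a * (1 - t) ^ a

/-- `F`, on the open unit interval, has a norm at most `N` in the weighted Hölder space: `wt a * F`
is bounded by `N` and Hölder continuous with the exponent `b` and the constant `N`. -/
def HolderUnit (a b N : ℝ) (F : ℝ → ℂ) : Prop :=
  (∀ t ∈ Ioo (0 : ℝ) 1, ‖(wt a t : ℂ) * F t‖ ≤ N) ∧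
    ∀ s ∈ Ioo (0 : ℝ) 1, ∀ t ∈ Ioo (0 : ℝ) 1,
      ‖(wt a s : ℂ) * F s - (wt a t : ℂ) * F t‖ ≤ N * |s - t| ^ b

lemma wt_pos (a : ℝ) {t : ℝ} (ht : t ∈ Ioo (0 : ℝ) 1) : 0 < wt a t :=
  mul_pos (Real.rpow_pos_of_pos ht.1 a) (Real.rpow_pos_of_pos (sub_pos.2 ht.2) a)

lemma wt_symm (a t : ℝ) : wt a (1 - t) = wt a t := by
  rw [wt, wt, sub_sub_cancel, mul_comm]

lemma wt_le_one {a t : ℝ} (ha : 0 ≤ a) (ht : t ∈ Icc (0 : ℝ) 1) : wt a t ≤ 1 := by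
  have h1 : t ^ a ≤ 1 := Real.rpow_le_one ht.1 ht.2 ha
  have h2 : (1 - t) ^ a ≤ 1 := Real.rpow_le_one (by linarith [ht.2]) (by linarith [ht.1]) ha
  exact mul_le_one₀ h1 (Real.rpow_nonneg (by linarith [ht.2]) _) h2

lemma abs_wt_sub_le {a s t : ℝ} (ha : 0 ≤ a) (ha1 : a ≤ 1) (hs : s ∈ Icc (0 : ℝ) 1)
    (ht : t ∈ Icc (0 : ℝ) 1) : |wt a s - wt a t| ≤ 2 * |s - t| ^ a := by
  have e : wt a s - wt a t = (s ^ a - t ^ a) * (1 - s) ^ a + t ^ a * ((1 - s) ^ a - (1 - t) ^ a) := by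
    rw [wt, wt]; ring
  have h1 := abs_rpow_sub_rpow_le hs.1 ht.1 ha ha1
  have h2 := abs_rpow_sub_rpow_le (sub_nonneg.2 hs.2) (sub_nonneg.2 ht.2) ha ha1
  have h3 : 1 - s - (1 - t) = -(s - t) := by ring
  rw [h3, abs_neg] at h2
  have h4 : t ^ a ≤ 1 := Real.rpow_le_one ht.1 ht.2 ha
  have h4' : 0 ≤ t ^ a := Real.rpow_nonneg ht.1 _
  have h5 : (1 - s) ^ a ≤ 1 := Real.rpow_le_one (by linarith [hs.2]) (by linarith [hs.1]) ha
  have h5' : 0 ≤ (1 - s) ^ a := Real.rpow_nonneg (by linarith [hs.2]) _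
  have h6 : 0 ≤ |s - t| ^ a := by positivity
  rw [e]
  refine (abs_add_le _ _).trans ?_
  rw [abs_mul, abs_mul, abs_of_nonneg h4', abs_of_nonneg h5']
  calc _ ≤ |s - t| ^ a * 1 + 1 * |s - t| ^ a := by gcongr
    _ = _ := by ring

lemma inv_wt_le {a t : ℝ} (ha : 0 ≤ a) (ha1 : a ≤ 1) (ht : t ∈ Ioo (0 : ℝ) 1) :
    (wt a t)⁻¹ ≤ 2 * (t ^ (-a) + (1 - t) ^ (-a)) := by
  have h0 : 0 < t := ht.1
  have h1 : 0 < 1 - t := sub_pos.2 ht.2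
  have e : (wt a t)⁻¹ = t ^ (-a) * (1 - t) ^ (-a) := by
    rw [wt, mul_inv, Real.rpow_neg h0.le, Real.rpow_neg h1.le]
  have half : ∀ x : ℝ, 1 / 2 ≤ x → x ^ (-a) ≤ 2 := fun x hx => by
    calc x ^ (-a) ≤ (1 / 2 : ℝ) ^ (-a) :=
          Real.rpow_le_rpow_of_nonpos (by norm_num) hx (by linarith)
      _ = 2 ^ a := by rw [Real.rpow_neg (by norm_num), ← Real.inv_rpow (by norm_num)]; norm_num
      _ ≤ 2 ^ (1 : ℝ) := Real.rpow_le_rpow_of_exponent_le (by norm_num) ha1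
      _ = 2 := Real.rpow_one 2
  have p0 : 0 < t ^ (-a) := by positivity
  have p1 : 0 < (1 - t) ^ (-a) := by positivity
  rw [e]
  rcases le_total t (1 / 2) with h | h
  · have := half (1 - t) (by linarith)
    nlinarith
  · have := half t h
    nlinarith

lemma integrableOn_rpow_neg {a : ℝ} (ha : a < 1) :
    IntegrableOn (fun t : ℝ => t ^ (-a)) (Ioo 0 1) ∧
      IntegrableOn (fun t : ℝ => (1 - t) ^ (-a)) (Ioo 0 1) := by
  have h : IntervalIntegrable (fun t : ℝ => t ^ (-a)) volume 0 1 :=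
    intervalIntegral.intervalIntegrable_rpow' (by linarith)
  refine ⟨(intervalIntegrable_iff_integrableOn_Ioo_of_le zero_le_one).1 h,
    (intervalIntegrable_iff_integrableOn_Ioo_of_le zero_le_one).1 ?_⟩
  have := h.comp_sub_left 1
  simp only [sub_zero, sub_self] at this
  exact this.symm

lemma continuousOn_wt (a : ℝ) : ContinuousOn (wt a) (Ioo 0 1) := by
  intro t ht
  have h0 : t ≠ 0 := ht.1.ne'
  have h1 : 1 - t ≠ 0 := (sub_pos.2 ht.2).ne'
  refine ContinuousAt.continuousWithinAt ?_
  unfold wt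
  exact (continuousAt_id.rpow_const (Or.inl h0)).mul
    ((continuousAt_const.sub continuousAt_id).rpow_const (Or.inl h1))

lemma integrableOn_inv_wt {a : ℝ} (ha : 0 ≤ a) (ha1 : a < 1) :
    IntegrableOn (fun t => (wt a t)⁻¹) (Ioo 0 1) := by
  obtain ⟨h1, h2⟩ := integrableOn_rpow_neg ha1
  refine Integrable.mono' ((h1.add h2).const_mul 2) ?_
    ((ae_restrict_iff' measurableSet_Ioo).2 (Eventually.of_forall fun t ht => ?_))
  · exact ((continuousOn_wt a).inv₀ fun t ht => (wt_pos a ht).ne').aestronglyMeasurable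
      measurableSet_Ioo
  · rw [Real.norm_of_nonneg (inv_nonneg.2 (wt_pos a ht).le)]
    exact inv_wt_le ha ha1.le ht

namespace HolderUnit

variable {a b N : ℝ} {F : ℝ → ℂ}

lemma nonneg (hF : HolderUnit a b N F) : 0 ≤ N :=
  (norm_nonneg _).trans (hF.1 (1 / 2) ⟨by norm_num, by norm_num⟩)

lemma norm_le (hF : HolderUnit a b N F) {t : ℝ} (ht : t ∈ Ioo (0 : ℝ) 1) :
    ‖F t‖ ≤ N * (wt a t)⁻¹ := by
  have h := hF.1 t ht
  have hw := wt_pos a ht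
  rw [norm_mul, Complex.norm_real, Real.norm_of_nonneg hw.le] at h
  rw [← div_eq_mul_inv, le_div_iff₀ hw, mul_comm]
  exact h

lemma mono {N' : ℝ} (hF : HolderUnit a b N F) (h : N ≤ N') : HolderUnit a b N' F :=
  ⟨fun t ht => (hF.1 t ht).trans h, fun s hs t ht => (hF.2 s hs t ht).trans (by gcongr)⟩

lemma add {N' : ℝ} {G : ℝ → ℂ} (hF : HolderUnit a b N F) (hG : HolderUnit a b N' G) :
    HolderUnit a b (N + N') (fun t => F t + G t) := by
  refine ⟨fun t ht => ?_, fun s hs t ht => ?_⟩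
  · rw [mul_add]; exact (norm_add_le _ _).trans (add_le_add (hF.1 t ht) (hG.1 t ht))
  · rw [mul_add, mul_add, add_sub_add_comm, add_mul]
    exact (norm_add_le _ _).trans (add_le_add (hF.2 s hs t ht) (hG.2 s hs t ht))

lemma const_mul (hF : HolderUnit a b N F) (k : ℂ) :
    HolderUnit a b (‖k‖ * N) (fun t => k * F t) := by
  refine ⟨fun t ht => ?_, fun s hs t ht => ?_⟩
  · rw [mul_left_comm, norm_mul]; gcongr; exact hF.1 t ht
  · rw [mul_left_comm, mul_left_comm _ k, ← mul_sub, norm_mul, mul_assoc]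
    gcongr; exact hF.2 s hs t ht

lemma reflect (hF : HolderUnit a b N F) : HolderUnit a b N (fun t => F (1 - t)) := by
  have hm : ∀ t ∈ Ioo (0 : ℝ) 1, 1 - t ∈ Ioo (0 : ℝ) 1 := fun t ht =>
    ⟨by linarith [ht.2], by linarith [ht.1]⟩
  refine ⟨fun t ht => ?_, fun s hs t ht => ?_⟩
  · rw [← wt_symm]; exact hF.1 _ (hm t ht)
  · rw [← wt_symm a s, ← wt_symm a t]
    refine (hF.2 _ (hm s hs) _ (hm t ht)).trans (le_of_eq ?_)
    rw [sub_sub_sub_cancel_left, abs_sub_comm]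

lemma continuousOn (hb : 0 < b) (hF : HolderUnit a b N F) : ContinuousOn F (Ioo 0 1) := by
  have h1 : ContinuousOn (fun t => (wt a t : ℂ) * F t) (Ioo 0 1) := by
    intro x hx
    rw [ContinuousWithinAt, tendsto_iff_norm_sub_tendsto_zero]
    have h1 : Tendsto (fun y : ℝ => N * |y - x| ^ b) (𝓝[Ioo 0 1] x) (𝓝 0) := by
      have : ContinuousAt (fun y : ℝ => N * |y - x| ^ b) x := by
        refine continuousAt_const.mul (ContinuousAt.rpow_const (by fun_prop) (Or.inr hb.le))
      have h := this.tendsto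
      simp only [sub_self, abs_zero, Real.zero_rpow hb.ne', mul_zero] at h
      exact h.mono_left nhdsWithin_le_nhds
    refine squeeze_zero' (Eventually.of_forall fun y => norm_nonneg _) ?_ h1
    filter_upwards [self_mem_nhdsWithin] with y hy
    exact hF.2 y hy x hx
  have h2 : ContinuousOn (fun t => ((wt a t : ℝ) : ℂ)) (Ioo 0 1) :=
    Complex.continuous_ofReal.comp_continuousOn (continuousOn_wt a)
  refine (h1.div h2 fun t ht => Complex.ofReal_ne_zero.2 (wt_pos a ht).ne').congr fun t ht => ?_
  have := Complex.ofReal_ne_zero.2 (wt_pos a ht).ne'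
  simp only [Pi.div_apply]
  field_simp

lemma integrableOn (hb : 0 < b) (ha : 0 ≤ a) (ha1 : a < 1) (hF : HolderUnit a b N F) :
    IntegrableOn F (Ioo 0 1) :=
  Integrable.mono' ((integrableOn_inv_wt ha ha1).const_mul N)
    ((hF.continuousOn hb).aestronglyMeasurable measurableSet_Ioo)
    ((ae_restrict_iff' measurableSet_Ioo).2 (Eventually.of_forall fun _ ht => hF.norm_le ht))

/-- Products with Hölder continuous factors. -/
lemma mul_left {L : ℝ} {m : ℝ → ℝ} (hF : HolderUnit a b N F)
    (hm : ∀ t ∈ Ioo (0 : ℝ) 1, |m t| ≤ L)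
    (hm' : ∀ s ∈ Ioo (0 : ℝ) 1, ∀ t ∈ Ioo (0 : ℝ) 1, |m s - m t| ≤ L * |s - t| ^ b) :
    HolderUnit a b (2 * L * N) (fun t => (m t : ℂ) * F t) := by
  have hN := hF.nonneg
  have hL : 0 ≤ L := (abs_nonneg _).trans (hm (1 / 2) ⟨by norm_num, by norm_num⟩)
  refine ⟨fun t ht => ?_, fun s hs t ht => ?_⟩
  · rw [mul_left_comm, norm_mul, Complex.norm_real, Real.norm_eq_abs]
    have h0 : 0 ≤ L * N := by positivity
    calc _ ≤ L * N := mul_le_mul (hm t ht) (hF.1 t ht) (norm_nonneg _) hL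
      _ ≤ _ := by linarith
  · have e : (wt a s : ℂ) * ((m s : ℂ) * F s) - (wt a t : ℂ) * ((m t : ℂ) * F t) =
      (m s : ℂ) * ((wt a s : ℂ) * F s - (wt a t : ℂ) * F t) +
        ((m s - m t : ℝ) : ℂ) * ((wt a t : ℂ) * F t) := by push_cast; ring
    rw [e]
    refine (norm_add_le _ _).trans ?_
    rw [norm_mul, norm_mul, Complex.norm_real, Complex.norm_real, Real.norm_eq_abs,
      Real.norm_eq_abs]
    calc _ ≤ L * (N * |s - t| ^ b) + L * |s - t| ^ b * N :=
          add_le_add (mul_le_mul (hm s hs) (hF.2 s hs t ht) (norm_nonneg _) hL)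
            (mul_le_mul (hm' s hs t ht) (hF.1 t ht) (norm_nonneg _) (by positivity))
      _ = _ := by ring

end HolderUnit

/-- The restriction of `F` to the left end of the unit interval by means of a polynomial cutoff,
extended by zero to the half-line. The cutoff `(1 - t) ^ 2 (1 + 2 t)` and its reflection add up to
`1`, and its double zero at `1` absorbs the singularity of `F` there. -/
def leftPart (F : ℝ → ℂ) (t : ℝ) : ℂ :=
  if t < 1 then (((1 - t) ^ 2 * (1 + 2 * t) : ℝ) : ℂ) * F t else 0

lemma leftPart_add (F : ℝ → ℂ) {t : ℝ} (ht : t ∈ Ioo (0 : ℝ) 1) :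
    leftPart F t + leftPart (fun u => F (1 - u)) (1 - t) = F t := by
  have h2 : 1 - t < 1 := by linarith [ht.1]
  rw [leftPart, leftPart, if_pos ht.2, if_pos h2]
  push_cast
  simp only [sub_sub_cancel]
  ring

lemma abs_rpow_sub_rpow_le_mul {p x y : ℝ} (hp : 1 ≤ p) (hx : x ∈ Icc (0 : ℝ) 1)
    (hy : y ∈ Icc (0 : ℝ) 1) : |x ^ p - y ^ p| ≤ p * |x - y| := by
  have := Convex.norm_image_sub_le_of_norm_hasDerivWithin_le (s := Icc (0 : ℝ) 1)
    (f := fun x : ℝ => x ^ p) (f' := fun x => p * x ^ (p - 1)) (C := p)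
    (fun z _ => (Real.hasDerivAt_rpow_const (Or.inr hp)).hasDerivWithinAt) (fun z hz => ?_)
    (convex_Icc 0 1) hy hx
  · simpa using this
  · have h1 : z ^ (p - 1) ≤ 1 := Real.rpow_le_one hz.1 hz.2 (by linarith)
    have h2 : 0 ≤ z ^ (p - 1) := Real.rpow_nonneg hz.1 _
    rw [Real.norm_of_nonneg (by positivity)]
    nlinarith

lemma le_rpow_of_le_one {x b : ℝ} (hx : 0 ≤ x) (hx1 : x ≤ 1) (hb1 : b ≤ 1) : x ≤ x ^ b := by
  rcases hx.eq_or_lt with h | h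
  · rw [← h]; positivity
  · conv_lhs => rw [← Real.rpow_one x]
    exact Real.rpow_le_rpow_of_exponent_ge h hx1 hb1

lemma HolderUnit.holderHalf_leftPart {a b N : ℝ} {F : ℝ → ℂ} (hb : 0 < b) (hba : b < a)
    (ha : a < 1) (hF : HolderUnit a b N F) :
    HolderHalf b (12 * N) (fun t => ((t ^ a : ℝ) : ℂ) * leftPart F t) := by
  have hN := hF.nonneg
  set m : ℝ → ℝ := fun t => (1 - t) ^ (2 - a) * (1 + 2 * t) with hm
  have e : ∀ t ∈ Ioo (0 : ℝ) 1, ((t ^ a : ℝ) : ℂ) * leftPart F t =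
      (m t : ℂ) * ((wt a t : ℂ) * F t) := by
    intro t ht
    have h1 : 0 < 1 - t := sub_pos.2 ht.2
    have : (1 - t) ^ 2 = (1 - t) ^ (2 - a) * (1 - t) ^ a := by
      rw [← Real.rpow_add h1, sub_add_cancel, Real.rpow_two]
    rw [leftPart, if_pos ht.2, hm, wt, this]
    push_cast
    ring
  have hpow : ∀ t ∈ Ioo (0 : ℝ) 1, (1 - t) ^ (2 - a) ≤ 1 - t := fun t ht => by
    calc (1 - t) ^ (2 - a) ≤ (1 - t) ^ (1 : ℝ) :=
          Real.rpow_le_rpow_of_exponent_ge (sub_pos.2 ht.2) (by linarith [ht.1]) (by linarith)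
      _ = 1 - t := Real.rpow_one _
  have hm0 : ∀ t ∈ Ioo (0 : ℝ) 1, |m t| ≤ 3 * (1 - t) := fun t ht => by
    have h1 := hpow t ht
    have h2 : 0 ≤ (1 - t) ^ (2 - a) := Real.rpow_nonneg (by linarith [ht.2]) _
    rw [abs_of_nonneg (mul_nonneg h2 (by linarith [ht.1]))]
    calc m t ≤ (1 - t) * 3 :=
          mul_le_mul h1 (by linarith [ht.2]) (by linarith [ht.1]) (by linarith [ht.2])
      _ = _ := by ring
  have hm1 : ∀ s ∈ Ioo (0 : ℝ) 1, ∀ t ∈ Ioo (0 : ℝ) 1, |m s - m t| ≤ 8 * |s - t| ^ b := by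
    intro s hs t ht
    have h1 := abs_rpow_sub_rpow_le_mul (p := 2 - a) (x := 1 - s) (y := 1 - t) (by linarith)
      ⟨by linarith [hs.2], by linarith [hs.1]⟩ ⟨by linarith [ht.2], by linarith [ht.1]⟩
    rw [sub_sub_sub_cancel_left, abs_sub_comm t s] at h1
    have e1 : m s - m t = ((1 - s) ^ (2 - a) - (1 - t) ^ (2 - a)) * (1 + 2 * s) +
      (1 - t) ^ (2 - a) * (2 * (s - t)) := by rw [hm]; ring
    have h2 := hpow t ht
    have h2' : 0 ≤ (1 - t) ^ (2 - a) := Real.rpow_nonneg (by linarith [ht.2]) _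
    have h3 : |s - t| ≤ |s - t| ^ b := le_rpow_of_le_one (abs_nonneg _)
      (abs_le.2 ⟨by linarith [hs.1, ht.2], by linarith [hs.2, ht.1]⟩) (hba.trans ha).le
    rw [e1]
    refine (abs_add_le _ _).trans ?_
    rw [abs_mul, abs_mul, abs_mul, abs_two, abs_of_nonneg h2',
      abs_of_nonneg (by linarith [hs.1] : 0 ≤ 1 + 2 * s)]
    calc _ ≤ (2 * |s - t|) * 3 + 1 * (2 * |s - t|) := by
          refine add_le_add (mul_le_mul (h1.trans ?_) (by linarith [hs.2]) (by linarith [hs.1])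
            (by positivity)) (mul_le_mul_of_nonneg_right (by linarith [ht.1]) (by positivity))
          gcongr; linarith
      _ = 8 * |s - t| := by ring
      _ ≤ _ := by gcongr
  have hout : ∀ t, 1 ≤ t → leftPart F t = 0 := fun t ht => by
    rw [leftPart, if_neg (not_lt.2 ht)]
  refine ⟨fun t ht => ?_, ?_⟩ <;> beta_reduce
  · rcases lt_or_ge t 1 with h | h
    · rw [e t ⟨ht, h⟩, norm_mul, Complex.norm_real, Real.norm_eq_abs]
      calc _ ≤ (3 * (1 - t)) * N := mul_le_mul (hm0 t ⟨ht, h⟩) (hF.1 t ⟨ht, h⟩) (norm_nonneg _)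
            (by linarith)
        _ ≤ _ := by nlinarith
    · rw [hout t h, mul_zero, norm_zero]; positivity
  · intro x y hx hy
    wlog hxy : x ≤ y generalizing x y
    · rw [norm_sub_rev, abs_sub_comm]; exact this y x hy hx (le_of_not_ge hxy)
    rcases lt_or_ge x 1 with h | h
    swap
    · rw [hout x h, hout y (h.trans hxy)]; simp; positivity
    rcases lt_or_ge y 1 with h' | h'
    · have hx' : x ∈ Ioo (0 : ℝ) 1 := ⟨hx, h⟩
      have hy' : y ∈ Ioo (0 : ℝ) 1 := ⟨hy, h'⟩
      rw [e x hx', e y hy']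
      have e2 : (m x : ℂ) * ((wt a x : ℂ) * F x) - (m y : ℂ) * ((wt a y : ℂ) * F y) =
          (m x : ℂ) * ((wt a x : ℂ) * F x - (wt a y : ℂ) * F y) +
          ((m x - m y : ℝ) : ℂ) * ((wt a y : ℂ) * F y) := by push_cast; ring
      rw [e2]
      refine (norm_add_le _ _).trans ?_
      rw [norm_mul, norm_mul, Complex.norm_real, Complex.norm_real, Real.norm_eq_abs,
        Real.norm_eq_abs]
      have hm3 : |m x| ≤ 3 := (hm0 x hx').trans (by linarith)
      have hn : 0 ≤ N * |x - y| ^ b := by positivity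
      calc _ ≤ 3 * (N * |x - y| ^ b) + 8 * |x - y| ^ b * N :=
            add_le_add (mul_le_mul hm3 (hF.2 x hx' y hy') (norm_nonneg _) (by norm_num))
              (mul_le_mul (hm1 x hx' y hy') (hF.1 y hy') (norm_nonneg _) (by positivity))
        _ ≤ 12 * N * |x - y| ^ b := by linarith
    · rw [hout y h', mul_zero, sub_zero, e x ⟨hx, h⟩, norm_mul, Complex.norm_real, Real.norm_eq_abs]
      have h3 : 1 - x ≤ |x - y| ^ b := by
        calc 1 - x ≤ (1 - x) ^ b := le_rpow_of_le_one (by linarith) (by linarith) (hba.trans ha).le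
          _ ≤ _ := Real.rpow_le_rpow (by linarith) (by
            rw [abs_sub_comm]; exact le_trans (by linarith) (le_abs_self _)) hb.le
      calc _ ≤ (3 * (1 - x)) * N := mul_le_mul (hm0 x ⟨hx, h⟩) (hF.1 x ⟨hx, h⟩) (norm_nonneg _)
            (by linarith)
        _ ≤ 12 * (1 - x) * N := by gcongr; linarith
        _ ≤ 12 * |x - y| ^ b * N := by gcongr
        _ = _ := by ring

/-- The Hilbert transform (principal value of `∫ F t / (t - s) dt`) on the unit interval, as the sum
of the contributions of the two ends; `a` only enters the representation, since the weights cancel.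
The reflection `t ↦ 1 - t` changes the sign of the kernel. -/
def unitHilbert (a : ℝ) (F : ℝ → ℂ) (s : ℝ) : ℂ :=
  ((s ^ (-a) : ℝ) : ℂ) * halfHilbert a (fun t => ((t ^ a : ℝ) : ℂ) * leftPart F t) s -
    (((1 - s) ^ (-a) : ℝ) : ℂ) *
      halfHilbert a (fun t => ((t ^ a : ℝ) : ℂ) * leftPart (fun u => F (1 - u)) t) (1 - s)

/-- The Hilbert transform is bounded on the weighted Hölder space of the unit interval. -/
lemma exists_unitHilbert_bound {a b : ℝ} (hb : 0 < b) (hba : b < a) (ha : a < 1) :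
    ∃ C : ℝ, 0 ≤ C ∧ ∀ N F, HolderUnit a b N F → HolderUnit a b (C * N) (unitHilbert a F) := by
  obtain ⟨C, hC, h⟩ := exists_halfHilbert_bound hb hba ha
  have ha0 : 0 ≤ a := (hb.trans hba).le
  -- The contribution of one end; the weight of the other end is a Hölder continuous factor.
  have one : ∀ (G : ℝ → ℂ) (N : ℝ), HolderHalf b N G →
      HolderUnit a b (2 * C * N) (fun s => ((s ^ (-a) : ℝ) : ℂ) * halfHilbert a G s) := by
    intro G N hG
    have hN := hG.nonneg
    obtain ⟨h1, h2⟩ := h N G hG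
    have e : ∀ s ∈ Ioo (0 : ℝ) 1, (wt a s : ℂ) * (((s ^ (-a) : ℝ) : ℂ) * halfHilbert a G s) =
        (((1 - s) ^ a : ℝ) : ℂ) * halfHilbert a G s := by
      intro s hs
      have : s ^ a * s ^ (-a) = 1 := by rw [← Real.rpow_add hs.1]; simp
      rw [← mul_assoc, ← Complex.ofReal_mul]
      congr 2
      rw [wt]
      linear_combination (1 - s) ^ a * this
    have hp : ∀ s ∈ Ioo (0 : ℝ) 1, ‖(((1 - s) ^ a : ℝ) : ℂ)‖ ≤ 1 := fun s hs => by
      have := sub_pos.2 hs.2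
      rw [Complex.norm_real, Real.norm_of_nonneg (by positivity)]
      exact Real.rpow_le_one this.le (by linarith [hs.1]) ha0
    refine ⟨fun s hs => ?_, fun s hs t ht => ?_⟩
    · rw [e s hs, norm_mul]
      have hCN : 0 ≤ C * N := by positivity
      calc _ ≤ 1 * (C * N) := mul_le_mul (hp s hs) (h1 s hs.1 hs.2.le) (norm_nonneg _) zero_le_one
        _ ≤ _ := by linarith
    · rw [e s hs, e t ht]
      have e2 : (((1 - s) ^ a : ℝ) : ℂ) * halfHilbert a G s -
          (((1 - t) ^ a : ℝ) : ℂ) * halfHilbert a G t =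
          (((1 - s) ^ a : ℝ) : ℂ) * (halfHilbert a G s - halfHilbert a G t) +
          (((1 - s) ^ a - (1 - t) ^ a : ℝ) : ℂ) * halfHilbert a G t := by push_cast; ring
      rw [e2]
      refine (norm_add_le _ _).trans ?_
      rw [norm_mul, norm_mul]
      have h3 : ‖(((1 - s) ^ a - (1 - t) ^ a : ℝ) : ℂ)‖ ≤ |s - t| ^ b := by
        rw [Complex.norm_real, Real.norm_eq_abs]
        refine (abs_rpow_sub_rpow_le (sub_nonneg.2 hs.2.le) (sub_nonneg.2 ht.2.le) ha0
          ha.le).trans ?_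
        rw [sub_sub_sub_cancel_left, abs_sub_comm]
        exact Real.rpow_le_rpow_of_exponent_ge_of_imp (abs_nonneg _)
          (abs_le.2 ⟨by linarith [hs.1, ht.2], by linarith [hs.2, ht.1]⟩) hba.le
          (fun _ h0 => absurd h0 (hb.trans hba).ne')
      calc _ ≤ 1 * (C * N * |s - t| ^ b) + |s - t| ^ b * (C * N) :=
            add_le_add (mul_le_mul (hp s hs) (h2 s t hs.1 ht.1) (norm_nonneg _) zero_le_one)
              (mul_le_mul h3 (h1 t ht.1 ht.2.le) (norm_nonneg _) (by positivity))
        _ = _ := by ring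
  refine ⟨48 * C, by positivity, fun N F hF => ?_⟩
  have hN := hF.nonneg
  have l := one _ _ (hF.holderHalf_leftPart hb hba ha)
  have r := ((one _ _ (hF.reflect.holderHalf_leftPart hb hba ha)).reflect.const_mul (-1))
  rw [norm_neg, norm_one, one_mul] at r
  have hh := l.add r
  have e : 2 * C * (12 * N) + 2 * C * (12 * N) = 48 * C * N := by ring
  rw [e] at hh
  convert hh using 2 with s
  simp [unitHilbert, sub_eq_add_neg]

/-! ### Boundary values of the Cauchy integral -/

/-- The Cauchy kernel `β / (β x - h)` of the line with the slope `β`, displaced by `h`. -/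
def displacedKernel (β : ℂ) (h x : ℝ) : ℂ := β / (β * (x : ℂ) - (h : ℂ))

lemma abs_im_mul_le_norm_displaced (β : ℂ) (h x : ℝ) :
    |β.im| * |x| ≤ ‖β * (x : ℂ) - (h : ℂ)‖ := by
  have := Complex.abs_im_le_norm (β * (x : ℂ) - (h : ℂ))
  simpa [abs_mul] using this

lemma displaced_ne_zero {β : ℂ} (hβ : β.im ≠ 0) {h : ℝ} (hh : 0 < h) (x : ℝ) :
    β * (x : ℂ) - (h : ℂ) ≠ 0 := by
  intro h0
  by_cases hx : x = 0
  · rw [hx] at h0; simp at h0; exact hh.ne' h0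
  · have := abs_im_mul_le_norm_displaced β h x
    rw [h0, norm_zero] at this
    have : 0 < |β.im| * |x| := by positivity
    linarith

lemma continuous_displacedKernel {β : ℂ} (hβ : β.im ≠ 0) {h : ℝ} (hh : 0 < h) :
    Continuous (displacedKernel β h) := by
  unfold displacedKernel
  exact continuous_const.div (by fun_prop) fun x => displaced_ne_zero hβ hh x

lemma norm_displacedKernel_le {β : ℂ} (hβ : β.im ≠ 0) (h : ℝ) {x : ℝ} (hx : x ≠ 0) :
    ‖displacedKernel β h x‖ ≤ ‖β‖ / |β.im| * |x|⁻¹ := by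
  rw [displacedKernel, norm_div, ← div_eq_mul_inv, div_div]
  have : 0 < |β.im| * |x| := by positivity
  gcongr
  exact abs_im_mul_le_norm_displaced β h x

lemma tendsto_displacedKernel {β : ℂ} (hβ : β.im ≠ 0) {x : ℝ} (hx : x ≠ 0) :
    Tendsto (fun h => displacedKernel β h x) (𝓝[>] 0) (𝓝 (1 / (x : ℂ))) := by
  have hβ0 : β ≠ 0 := by rintro rfl; simp at hβ
  have hx0 : (x : ℂ) ≠ 0 := Complex.ofReal_ne_zero.2 hx
  have : ContinuousAt (fun h : ℝ => displacedKernel β h x) 0 := by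
    unfold displacedKernel
    refine continuousAt_const.div (by fun_prop) ?_
    simpa using ⟨hβ0, hx⟩
  have h := this.tendsto.mono_left (nhdsWithin_le_nhds (s := Ioi 0))
  have e : displacedKernel β 0 x = 1 / (x : ℂ) := by
    rw [displacedKernel, Complex.ofReal_zero, sub_zero]; field_simp
  rwa [e] at h

lemma displaced_mem_slitPlane {β : ℂ} (hβ : β.im ≠ 0) {h : ℝ} (hh : 0 < h) (x : ℝ) :
    (h : ℂ) - β * (x : ℂ) ∈ Complex.slitPlane := by
  rw [Complex.mem_slitPlane_iff]
  by_cases hx : x = 0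
  · left; rw [hx]; simpa using hh
  · right; simpa using ⟨hβ, hx⟩

/-- The primitive is a logarithm: for `h > 0` the line `h - β x` avoids the cut. -/
lemma integral_displacedKernel {β : ℂ} (hβ : β.im ≠ 0) {h : ℝ} (hh : 0 < h) (x y : ℝ) :
    ∫ u in x..y, displacedKernel β h u =
      Complex.log ((h : ℂ) - β * (y : ℂ)) - Complex.log ((h : ℂ) - β * (x : ℂ)) := by
  refine intervalIntegral.integral_eq_sub_of_hasDerivAt
    (f := fun u : ℝ => Complex.log ((h : ℂ) - β * (u : ℂ))) (fun u _ => ?_)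
    ((continuous_displacedKernel hβ hh).intervalIntegrable _ _)
  have h1 : HasDerivAt (fun u : ℝ => (h : ℂ) - β * (u : ℂ)) (-β) u := by
    simpa using ((Complex.ofRealCLM.hasDerivAt (x := u)).const_mul β).const_sub (h : ℂ)
  have h2 := h1.clog_real (displaced_mem_slitPlane hβ hh u)
  have h3 : displacedKernel β h u = -β / ((h : ℂ) - β * (u : ℂ)) := by
    simp only [displacedKernel]
    rw [← neg_sub (h : ℂ), div_neg, neg_div]
  rw [h3]
  exact h2

lemma tendsto_integral_displacedKernel {β : ℂ} (hβ : β.im ≠ 0) {l : ℝ} (hl : 0 < l) :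
    Tendsto (fun h : ℝ => ∫ u in (-l)..l, displacedKernel β h u) (𝓝[>] 0)
      (𝓝 (Complex.log (-β) - Complex.log β)) := by
  have hβ0 : β ≠ 0 := by rintro rfl; simp at hβ
  have s : ∀ y : ℝ, y ≠ 0 → Tendsto (fun h : ℝ => Complex.log ((h : ℂ) - β * (y : ℂ))) (𝓝[>] 0)
      (𝓝 (Complex.log (-(β * (y : ℂ))))) := by
    intro y hy
    have : ContinuousAt (fun h : ℝ => Complex.log ((h : ℂ) - β * (y : ℂ))) 0 := by
      refine ContinuousAt.clog (by fun_prop) ?_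
      rw [Complex.mem_slitPlane_iff]
      right; simpa using ⟨hβ, hy⟩
    have h := this.tendsto.mono_left (nhdsWithin_le_nhds (s := Ioi 0))
    simpa using h
  have h := (s l hl.ne').sub (s (-l) (neg_ne_zero.2 hl.ne'))
  have e : Complex.log (-(β * (l : ℂ))) - Complex.log (-(β * ((-l : ℝ) : ℂ))) =
      Complex.log (-β) - Complex.log β := by
    have e1 : -(β * (l : ℂ)) = (l : ℂ) * (-β) := by ring
    have e2 : -(β * ((-l : ℝ) : ℂ)) = (l : ℂ) * β := by push_cast; ring
    rw [e1, e2, Complex.log_ofReal_mul hl (neg_ne_zero.2 hβ0), Complex.log_ofReal_mul hl hβ0]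
    ring
  rw [e] at h
  refine h.congr' ?_
  filter_upwards [self_mem_nhdsWithin] with x hx
  exact (integral_displacedKernel hβ hx _ _).symm

lemma log_neg_sub_log {β : ℂ} (hβ : 0 < β.im) :
    Complex.log (-β) - Complex.log β = -(Real.pi * Complex.I) := by
  rw [Complex.log, Complex.log, norm_neg, Complex.arg_neg_eq_arg_sub_pi_of_im_pos hβ]
  push_cast
  ring

/-- Boundary values of the Cauchy integral, at the point `1` of the half-line. Subtracting the value
`k` in the window leaves an absolutely convergent integral, and the constant is integrated by means
of the logarithm. -/
lemma tendsto_integral_Ioi_displacedKernel {β : ℂ} (hβ : β.im ≠ 0) {f : ℝ → ℂ} {k : ℂ}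
    (hf : IntegrableOn (fun u : ℝ => (f u - (window u : ℂ) * k) / ((u - 1 : ℝ) : ℂ)) (Ioi 0)) :
    Tendsto (fun h : ℝ => ∫ u in Ioi (0 : ℝ), displacedKernel β h (u - 1) * f u) (𝓝[>] 0)
      (𝓝 ((∫ u in Ioi (0 : ℝ), (f u - (window u : ℂ) * k) / ((u - 1 : ℝ) : ℂ)) +
        (Complex.log (-β) - Complex.log β) * k)) := by
  set g : ℝ → ℂ := fun u => (f u - (window u : ℂ) * k) / ((u - 1 : ℝ) : ℂ) with hg
  have hne : ∀ᵐ u : ℝ ∂(volume.restrict (Ioi 0)), u ≠ 1 := by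
    refine ae_restrict_of_ae ?_
    simp [ae_iff]
  -- The regular part of the integrand is a factor, bounded uniformly in `h`, times `g`.
  set m : ℝ → ℝ → ℂ := fun h u => displacedKernel β h (u - 1) * ((u - 1 : ℝ) : ℂ) with hm
  have hmb : ∀ h u, ‖m h u‖ ≤ ‖β‖ / |β.im| := by
    intro h u
    by_cases hu : u - 1 = 0
    · simp only [hm, hu, Complex.ofReal_zero, mul_zero, norm_zero]; positivity
    · have h1 := norm_displacedKernel_le hβ h hu
      have h2 : 0 < |u - 1| := abs_pos.2 hu
      simp only [hm]
      rw [norm_mul, Complex.norm_real, Real.norm_eq_abs]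
      calc _ ≤ ‖β‖ / |β.im| * |u - 1|⁻¹ * |u - 1| := by gcongr
        _ = _ := by field_simp
  have hmc : ∀ h, 0 < h → Continuous (m h) := fun h hh => by
    simp only [hm]
    exact ((continuous_displacedKernel hβ hh).comp (by fun_prop)).mul (by fun_prop)
  have hint : ∀ h, 0 < h → IntegrableOn (fun u => m h u * g u) (Ioi 0) := fun h hh =>
    hf.bdd_mul (hmc h hh).aestronglyMeasurable (Eventually.of_forall (hmb h))
  have lim1 : Tendsto (fun h : ℝ => ∫ u in Ioi (0 : ℝ), m h u * g u) (𝓝[>] 0)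
      (𝓝 (∫ u in Ioi (0 : ℝ), g u)) := by
    refine tendsto_integral_filter_of_dominated_convergence (fun u => ‖β‖ / |β.im| * ‖g u‖)
      ?_ ?_ (hf.norm.const_mul _) ?_
    · filter_upwards [self_mem_nhdsWithin] with h hh
      exact (hint h hh).aestronglyMeasurable
    · refine Eventually.of_forall fun h => Eventually.of_forall fun u => ?_
      rw [norm_mul]
      gcongr
      exact hmb h u
    · filter_upwards [hne] with u hu
      have hu' : u - 1 ≠ 0 := sub_ne_zero.2 hu
      have := ((tendsto_displacedKernel hβ hu').mul_const (((u - 1 : ℝ) : ℂ))).mul_const (g u)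
      have e : 1 / ((u - 1 : ℝ) : ℂ) * ((u - 1 : ℝ) : ℂ) * g u = g u := by
        rw [one_div, inv_mul_cancel₀ (Complex.ofReal_ne_zero.2 hu'), one_mul]
      rwa [e] at this
  have lim2 := (tendsto_integral_displacedKernel hβ (by norm_num : (0 : ℝ) < 1 / 2)).mul_const k
  refine (lim1.add lim2).congr' ?_
  filter_upwards [self_mem_nhdsWithin] with h hh
  have hh : 0 < h := hh
  have hc := (continuous_displacedKernel hβ hh)
  have i2 : Integrable ((Icc (1 / 2 : ℝ) (3 / 2)).indicator
      fun u => displacedKernel β h (u - 1)) := by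
    rw [integrable_indicator_iff measurableSet_Icc]
    exact (hc.comp (by fun_prop : Continuous fun u : ℝ => u - 1)).integrableOn_Icc
  have e2 : ∫ u in (-(1 / 2) : ℝ)..(1 / 2), displacedKernel β h u =
      ∫ u in Ioi (0 : ℝ), (Icc (1 / 2 : ℝ) (3 / 2)).indicator
        (fun u => displacedKernel β h (u - 1)) u := by
    rw [setIntegral_indicator measurableSet_Icc, inter_eq_self_of_subset_right,
      integral_Icc_eq_integral_Ioc, ← intervalIntegral.integral_of_le (by norm_num),
      intervalIntegral.integral_comp_sub_right (displacedKernel β h)]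
    · norm_num
    · intro u hu
      exact lt_of_lt_of_le (by norm_num) hu.1
  rw [e2, ← integral_mul_const, ← integral_add (hint h hh) (i2.integrableOn.mul_const k)]
  refine integral_congr_ae ?_
  filter_upwards [hne] with u hu
  have hu' : ((u - 1 : ℝ) : ℂ) ≠ 0 := Complex.ofReal_ne_zero.2 (sub_ne_zero.2 hu)
  have e3 : (Icc (1 / 2 : ℝ) (3 / 2)).indicator (fun u => displacedKernel β h (u - 1)) u =
      displacedKernel β h (u - 1) * (window u : ℂ) := by
    unfold window
    by_cases hw : u ∈ Icc (1 / 2 : ℝ) (3 / 2)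
    · rw [indicator_of_mem hw, indicator_of_mem hw]; simp
    · rw [indicator_of_notMem hw, indicator_of_notMem hw]; simp
  rw [e3]
  simp only [hm, hg]
  field_simp
  ring

/-- Boundary values of the Cauchy integral of a function with a power singularity at `0`; the point
`s` is moved to `1` by scaling, which multiplies `β` by `s`. -/
lemma tendsto_integral_leftPart {a b N : ℝ} {F : ℝ → ℂ} (hb : 0 < b) (hba : b < a)
    (ha : a < 1) (hF : HolderUnit a b N F) {β : ℂ} (hβ : β.im ≠ 0) {s : ℝ}
    (hs : s ∈ Ioo (0 : ℝ) 1) :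
    Tendsto (fun h : ℝ => ∫ t in (0 : ℝ)..1, displacedKernel β h (t - s) * leftPart F t) (𝓝[>] 0)
      (𝓝 (((s ^ (-a) : ℝ) : ℂ) *
        halfHilbert a (fun t => ((t ^ a : ℝ) : ℂ) * leftPart F t) s +
        (Complex.log (-β) - Complex.log β) * leftPart F s)) := by
  have hs0 : 0 < s := hs.1
  set G : ℝ → ℂ := fun t => ((t ^ a : ℝ) : ℂ) * leftPart F t with hG
  have hGH : HolderHalf b (12 * N) G := hF.holderHalf_leftPart hb hba ha
  have hβ0 : β ≠ 0 := by rintro rfl; simp at hβ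
  have hsc : (s : ℂ) ≠ 0 := Complex.ofReal_ne_zero.2 hs0.ne'
  have key := tendsto_integral_Ioi_displacedKernel (β := β * s) (by simpa using ⟨hβ, hs0.ne'⟩)
    (integrableOn_halfHilbert hb hba ha hGH hs0)
  have elog : Complex.log (-(β * s)) - Complex.log (β * s) = Complex.log (-β) - Complex.log β := by
    have e1 : -(β * (s : ℂ)) = (s : ℂ) * (-β) := by ring
    rw [e1, mul_comm β, Complex.log_ofReal_mul hs0 (neg_ne_zero.2 hβ0),
      Complex.log_ofReal_mul hs0 hβ0]
    ring
  rw [elog] at key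
  have key2 := key.const_mul ((s ^ (-a) : ℝ) : ℂ)
  have pw : ∀ x : ℝ, 0 < x → ((x ^ (-a) : ℝ) : ℂ) * ((x ^ a : ℝ) : ℂ) = 1 := fun x hx => by
    rw [← Complex.ofReal_mul, ← Real.rpow_add hx]; simp
  have elim : ((s ^ (-a) : ℝ) : ℂ) * ((∫ u in Ioi (0 : ℝ),
      (((u ^ (-a) : ℝ) : ℂ) * G (s * u) - (window u : ℂ) * G s) / ((u - 1 : ℝ) : ℂ)) +
      (Complex.log (-β) - Complex.log β) * G s) =
      ((s ^ (-a) : ℝ) : ℂ) * halfHilbert a G s +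
        (Complex.log (-β) - Complex.log β) * leftPart F s := by
    rw [halfHilbert, mul_add]
    congr 1
    simp only [hG]
    linear_combination ((Complex.log (-β) - Complex.log β) * leftPart F s) * pw s hs0
  rw [elim] at key2
  refine key2.congr' ?_
  filter_upwards [self_mem_nhdsWithin] with h hh
  have e1 : ∫ t in (0 : ℝ)..1, displacedKernel β h (t - s) * leftPart F t =
      ∫ t in Ioi (0 : ℝ), displacedKernel β h (t - s) * leftPart F t := by
    rw [intervalIntegral.integral_of_le zero_le_one]
    refine (setIntegral_eq_of_subset_of_forall_sdiff_eq_zero measurableSet_Ioi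
      (fun x hx => hx.1) fun x hx => ?_).symm
    have : ¬ x < 1 := fun h1 => hx.2 ⟨hx.1, h1.le⟩
    rw [leftPart, if_neg this, mul_zero]
  have e2 := integral_comp_mul_left_Ioi' (fun t => displacedKernel β h (t - s) * leftPart F t) 0 hs0
  rw [mul_zero] at e2
  rw [e1, ← e2, ← integral_const_mul, ← integral_smul]
  refine setIntegral_congr_fun measurableSet_Ioi fun u hu => ?_
  have hu : 0 < u := hu
  have e3 : displacedKernel (β * s) h (u - 1) = s * displacedKernel β h (s * u - s) := by
    rw [displacedKernel, displacedKernel]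
    push_cast
    rw [← mul_div_assoc]
    congr 1 <;> ring
  simp only [hG, Complex.real_smul]
  rw [e3, Real.mul_rpow hs0.le hu.le]
  push_cast
  linear_combination (s * displacedKernel β h (s * u - s) * leftPart F (s * u)) *
    (((s ^ (-a) : ℝ) : ℂ) * ((s ^ a : ℝ) : ℂ) * pw u hu + pw s hs0)

/-- Sokhotski's formula on the unit interval. The term `-π i F s` is half a residue, with the sign
given by `Im β > 0`. -/
lemma tendsto_integral_displacedKernel_mul {a b N : ℝ} {F : ℝ → ℂ} (hb : 0 < b) (hba : b < a)
    (ha : a < 1) (hF : HolderUnit a b N F) {β : ℂ} (hβ : 0 < β.im) {s : ℝ}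
    (hs : s ∈ Ioo (0 : ℝ) 1) :
    Tendsto (fun h : ℝ => ∫ t in (0 : ℝ)..1, displacedKernel β h (t - s) * F t) (𝓝[>] 0)
      (𝓝 (unitHilbert a F s - Real.pi * Complex.I * F s)) := by
  have ha0 : 0 ≤ a := (hb.trans hba).le
  have hs' : 1 - s ∈ Ioo (0 : ℝ) 1 := ⟨by linarith [hs.2], by linarith [hs.1]⟩
  have l := tendsto_integral_leftPart hb hba ha hF hβ.ne' hs
  have r := tendsto_integral_leftPart hb hba ha hF.reflect (β := -β) (by simpa using hβ.ne') hs'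
  have lr := l.sub r
  rw [neg_neg] at lr
  have elim : ((s ^ (-a) : ℝ) : ℂ) * halfHilbert a (fun t => ((t ^ a : ℝ) : ℂ) * leftPart F t) s +
      (Complex.log (-β) - Complex.log β) * leftPart F s -
      ((((1 - s) ^ (-a) : ℝ) : ℂ) * halfHilbert a
        (fun t => ((t ^ a : ℝ) : ℂ) * leftPart (fun t => F (1 - t)) t) (1 - s) +
      (Complex.log β - Complex.log (-β)) * leftPart (fun t => F (1 - t)) (1 - s)) =
      unitHilbert a F s - Real.pi * Complex.I * F s := by
    rw [unitHilbert]
    linear_combination (leftPart F s + leftPart (fun t => F (1 - t)) (1 - s)) * log_neg_sub_log hβ -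
      (Real.pi * Complex.I) * leftPart_add F hs
  rw [elim] at lr
  refine lr.congr' ?_
  filter_upwards [self_mem_nhdsWithin] with h hh
  have e1 : ∫ t in (0 : ℝ)..1, displacedKernel (-β) h (t - (1 - s)) * leftPart (fun t => F (1 - t)) t
      = -∫ t in (0 : ℝ)..1, displacedKernel β h (t - s) * leftPart (fun t => F (1 - t)) (1 - t) := by
    have := intervalIntegral.integral_comp_sub_left (a := 0) (b := 1)
      (fun t => displacedKernel (-β) h (t - (1 - s)) * leftPart (fun t => F (1 - t)) t) 1
    rw [sub_self, sub_zero] at this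
    rw [← this, ← intervalIntegral.integral_neg]
    refine intervalIntegral.integral_congr fun t _ => ?_
    simp only [displacedKernel]
    have : -β * ((1 - t - (1 - s) : ℝ) : ℂ) - h = β * ((t - s : ℝ) : ℂ) - h := by push_cast; ring
    rw [this]
    ring
  have hK : Continuous fun t => displacedKernel β h (t - s) :=
    (continuous_displacedKernel hβ.ne' hh).comp (by fun_prop)
  have cut : ∀ G : ℝ → ℂ, IntegrableOn G (Ioo 0 1) →
      IntervalIntegrable (fun t => displacedKernel β h (t - s) * G t) volume 0 1 := by
    intro G hG
    rw [← intervalIntegrable_iff_integrableOn_Ioo_of_le zero_le_one] at hG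
    exact hG.continuousOn_mul hK.continuousOn
  have hFi := hF.integrableOn hb ha0 ha
  have il : IntegrableOn (leftPart F) (Ioo 0 1) := by
    have : IntervalIntegrable (fun t => (((1 - t) ^ 2 * (1 + 2 * t) : ℝ) : ℂ) * F t)
        volume 0 1 := by
      refine ((intervalIntegrable_iff_integrableOn_Ioo_of_le zero_le_one).2
        hFi).continuousOn_mul ?_
      fun_prop
    refine ((intervalIntegrable_iff_integrableOn_Ioo_of_le zero_le_one).1 this).congr_fun
      (fun t ht => ?_) measurableSet_Ioo
    simp only [leftPart, if_pos ht.2]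
  have ir : IntegrableOn (fun t => leftPart (fun t => F (1 - t)) (1 - t)) (Ioo 0 1) := by
    refine (hFi.sub il).congr_fun (fun t ht => ?_) measurableSet_Ioo
    simp only [Pi.sub_apply]
    rw [← leftPart_add F ht]; ring
  rw [e1, sub_neg_eq_add, ← intervalIntegral.integral_add (cut _ il) (cut _ ir)]
  refine intervalIntegral.integral_congr_Ioo_of_le zero_le_one fun t ht => ?_
  rw [← mul_add, leftPart_add F ht]

/-! ### The displaced kernel and its limit -/

/-- The kernel of `K₊` in the parameters of the curve, with `φ' - φ` displaced by `h`. -/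
def curveKernel (ε : ℝ) (v p : ℝ → ℂ) (s h t : ℝ) : ℂ :=
  1 / ε * (Complex.exp (expY ε p s t) /
    (Complex.exp (expX ε v s t - 2 * Real.pi * Complex.I * h / ε) - 1)) * v t

/-- The kernel of `K₊` in the parameters of the curve, minus the Hilbert kernel
`1 / (2 π i (t - s))`. -/
def smoothKernel (ε : ℝ) (v p : ℝ → ℂ) (s t : ℝ) : ℂ :=
  remKernel ε v p s t * v t + 1 / (2 * Real.pi * Complex.I) * cauchyDiff v s t

lemma continuous_avg {M : ℝ} {g : ℝ → ℂ} (hg : LipBdd M g) (s : ℝ) :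
    Continuous fun t => avg g s t := by
  have : LipschitzWith ⟨M, hg.nonneg⟩ fun t => avg g s t :=
    LipschitzWith.of_dist_le_mul fun t t' => by
      rw [dist_eq_norm, Real.dist_eq]
      have h := hg.norm_avg_sub_avg_le s t s t'
      rw [sub_self, abs_zero, zero_add] at h
      exact h
  exact this.continuous

section

variable {c M ε : ℝ} {v p : ℝ → ℂ}

lemma continuous_expX (hv : LipBdd M v) (ε s : ℝ) : Continuous fun t => expX ε v s t := by
  have := continuous_avg hv s
  unfold expX
  fun_prop

lemma continuous_expY (hp : LipBdd M p) (ε s : ℝ) : Continuous fun t => expY ε p s t := by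
  have := continuous_avg hp s
  unfold expY
  fun_prop

lemma displaced_expX_eq (ε : ℝ) (v : ℝ → ℂ) (s t h : ℝ) :
    expX ε v s t - 2 * Real.pi * Complex.I * h / ε =
      2 * Real.pi * Complex.I / ε * (((t - s : ℝ) : ℂ) * avg v s t - h) := by
  rw [expX]; ring

/-- A displacement by `0 < h < ε` avoids all zeros of the denominator: off the diagonal `exp X` does
not have modulus `1`, and on the diagonal `h / ε` is not an integer. -/
lemma exp_displaced_sub_one_ne_zero (hc : 0 < c) (hv : LipBdd M v) (hvc : ∀ t, c ≤ (v t).im)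
    (hε : 0 < ε) (s t : ℝ) {h : ℝ} (hh : 0 < h) (hhε : h < ε) :
    Complex.exp (expX ε v s t - 2 * Real.pi * Complex.I * h / ε) - 1 ≠ 0 := by
  by_cases hst : s = t
  · subst hst
    intro h0
    have h1 := sub_eq_zero.1 h0
    rw [Complex.exp_eq_one_iff] at h1
    obtain ⟨n, hn⟩ := h1
    have hεc : (ε : ℂ) ≠ 0 := Complex.ofReal_ne_zero.2 hε.ne'
    have hpi : (Real.pi : ℂ) ≠ 0 := by simp [Real.pi_ne_zero]
    have h2 : (h : ℂ) = -(n * ε) := by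
      rw [expX] at hn
      simp only [sub_self, Complex.ofReal_zero, zero_mul, mul_zero, zero_sub] at hn
      field_simp at hn
      have hI := Complex.I_ne_zero
      have h3 : (2 * Real.pi * Complex.I) * (h + n * ε) = 0 := by
        linear_combination (norm := ring_nf) -(2 * Real.pi * Complex.I) * hn
      rcases mul_eq_zero.1 h3 with h4 | h4
      · exact absurd h4 (by simp [Real.pi_ne_zero])
      · linear_combination h4
    have h3 : h = -(n * ε) := by exact_mod_cast h2
    have h4 : (n : ℝ) < 0 := by nlinarith
    have h5 : (-1 : ℝ) < n := by nlinarith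
    have h6 : n < 0 := by exact_mod_cast h4
    have h7 : -1 < n := by exact_mod_cast h5
    omega
  · have := exp_expX_sub_one_ne_zero hc hv hvc hε hst (y := -(2 * Real.pi * h / ε))
    convert this using 3
    push_cast; ring

lemma continuous_curveKernel (hc : 0 < c) (hv : LipBdd M v) (hvc : ∀ t, c ≤ (v t).im)
    (hp : LipBdd M p) (hε : 0 < ε) (s : ℝ) {h : ℝ} (hh : 0 < h) (hhε : h < ε) :
    Continuous (curveKernel ε v p s h) := by
  have h1 := continuous_expX hv ε s
  have h2 := continuous_expY hp ε s
  have h3 := hv.continuous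
  unfold curveKernel
  refine (continuous_const.mul (Continuous.div (by fun_prop) (by fun_prop) fun t => ?_)).mul h3
  exact exp_displaced_sub_one_ne_zero hc hv hvc hε s t hh hhε

lemma tendsto_curveKernel (hc : 0 < c) (hv : LipBdd M v) (hvc : ∀ t, c ≤ (v t).im)
    (hε : 0 < ε) {s t : ℝ} (hst : s ≠ t) :
    Tendsto (fun h => curveKernel ε v p s h t -
      1 / (2 * Real.pi * Complex.I) * displacedKernel (v s) h (t - s)) (𝓝[>] 0)
      (𝓝 (smoothKernel ε v p s t)) := by
  have hne := exp_expX_sub_one_ne_zero hc hv hvc hε hst (y := 0)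
  simp only [Complex.ofReal_zero, zero_mul, add_zero] at hne
  have h1 : ContinuousAt (fun h : ℝ => curveKernel ε v p s h t) 0 := by
    unfold curveKernel
    refine (continuousAt_const.mul (ContinuousAt.div (by fun_prop) (by fun_prop) ?_)).mul
      continuousAt_const
    simpa using hne
  have h2 := h1.tendsto.mono_left (nhdsWithin_le_nhds (s := Ioi 0))
  have h3 := (tendsto_displacedKernel (β := v s) (hc.trans_le (hvc s)).ne'
    (sub_ne_zero.2 hst.symm)).const_mul (1 / (2 * Real.pi * Complex.I))
  have h4 := h2.sub h3
  have e : curveKernel ε v p s 0 t - 1 / (2 * Real.pi * Complex.I) * (1 / ((t - s : ℝ) : ℂ)) =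
      smoothKernel ε v p s t := by
    have ht : ((t - s : ℝ) : ℂ) ≠ 0 := Complex.ofReal_ne_zero.2 (sub_ne_zero.2 hst.symm)
    have hεc : (ε : ℂ) ≠ 0 := Complex.ofReal_ne_zero.2 hε.ne'
    have hpi : (Real.pi : ℂ) ≠ 0 := by simp [Real.pi_ne_zero]
    have ha : avg v s t ≠ 0 := norm_pos_iff.1 (hc.trans_le (le_norm_avg hv hvc s t))
    have hX : 1 / ε * (1 / expX ε v s t) =
        1 / (2 * Real.pi * Complex.I) * (1 / (((t - s : ℝ) : ℂ) * avg v s t)) := by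
      rw [expX]; field_simp
    have hQ : cauchyDiff v s t = 1 / (((t - s : ℝ) : ℂ) * avg v s t) * v t -
        1 / ((t - s : ℝ) : ℂ) := by
      rw [cauchyDiff]; field_simp
    rw [curveKernel, smoothKernel, remKernel, hQ]
    simp only [Complex.ofReal_zero, mul_zero, zero_div, sub_zero]
    linear_combination (v t) * hX
  rwa [e] at h4

/-- Uniform lower bound for the denominator, by compactness; the constant depends on `ε`. -/
lemma exists_le_norm_phi1_displaced (hc : 0 < c) (hv : LipBdd M v) (hvc : ∀ t, c ≤ (v t).im)
    (hε : 0 < ε) (s : ℝ) : ∃ m : ℝ, 0 < m ∧ ∀ t ∈ Icc (0 : ℝ) 1, ∀ h ∈ Icc (0 : ℝ) (ε / 2),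
      m ≤ ‖phi1 (expX ε v s t - 2 * Real.pi * Complex.I * h / ε)‖ := by
  have hX := continuous_expX hv ε s
  have hcont : Continuous fun q : ℝ × ℝ =>
      ‖phi1 (expX ε v s q.1 - 2 * Real.pi * Complex.I * q.2 / ε)‖ := by
    refine (differentiable_phi1.continuous.comp ?_).norm
    have : Continuous fun q : ℝ × ℝ => expX ε v s q.1 := hX.comp continuous_fst
    fun_prop
  have hK : IsCompact (Icc (0 : ℝ) 1 ×ˢ Icc (0 : ℝ) (ε / 2)) := isCompact_Icc.prod isCompact_Icc
  obtain ⟨q, hq, hmin⟩ := hK.exists_isMinOn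
    ⟨(0, 0), ⟨le_rfl, zero_le_one⟩, ⟨le_rfl, by positivity⟩⟩ hcont.continuousOn
  refine ⟨‖phi1 (expX ε v s q.1 - 2 * Real.pi * Complex.I * q.2 / ε)‖, ?_, fun t ht h hh =>
    isMinOn_iff.1 hmin (t, h) ⟨ht, hh⟩⟩
  rw [norm_pos_iff]
  intro h0
  have h1 := mul_phi1 (expX ε v s q.1 - 2 * Real.pi * Complex.I * q.2 / ε)
  rw [h0, mul_zero] at h1
  have hq2 : 0 ≤ q.2 ∧ q.2 ≤ ε / 2 := hq.2
  rcases hq2.1.eq_or_lt with h2 | h2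
  · by_cases hs : s = q.1
    · rw [← h2, ← hs, expX] at h0
      simp [phi1_zero] at h0
    · have := exp_expX_sub_one_ne_zero hc hv hvc hε hs (y := 0)
      rw [← h2] at h1
      simp only [Complex.ofReal_zero, zero_mul, add_zero, mul_zero, zero_div, sub_zero] at this h1
      exact this h1.symm
  · exact exp_displaced_sub_one_ne_zero hc hv hvc hε s q.1 h2 (by linarith) h1.symm

/-- The difference of the displaced kernels stays bounded when the displacement tends to zero, which
allows dominated convergence. The constant depends on `ε`; only the limit is used for norms. -/
lemma exists_curveKernel_sub_bound (hc : 0 < c) (hv : LipBdd M v) (hvc : ∀ t, c ≤ (v t).im)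
    (hp : LipBdd M p) (hε : 0 < ε) {s : ℝ} (hs : s ∈ Icc (0 : ℝ) 1) :
    ∃ C : ℝ, ∀ t ∈ Icc (0 : ℝ) 1, s ≠ t → ∀ h ∈ Ioc (0 : ℝ) (ε / 2),
      ‖curveKernel ε v p s h t -
        1 / (2 * Real.pi * Complex.I) * displacedKernel (v s) h (t - s)‖ ≤ C := by
  obtain ⟨m, hm, hphi⟩ := exists_le_norm_phi1_displaced hc hv hvc hε s
  have hM : 0 ≤ M := hv.nonneg
  set r : ℝ := 2 * Real.pi * M / ε + 2 * Real.pi + 2 * M / ε with hr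
  obtain ⟨C1, hC1, h1b, -⟩ := exists_bound_lipschitz_closedBall differentiable_phi1 r
  obtain ⟨C2, hC2, h2b, -⟩ := exists_bound_lipschitz_closedBall differentiable_phi2 r
  set A : ℝ := 2 * M / ε / c * C1 + 2 * Real.pi / ε * C2 with hA
  refine ⟨1 * (M * A / m + (M * M / c ^ 2 + (1 + M / c) * M / c)), fun t ht hst h hh => ?_⟩
  have hτ1 : |s - t| ≤ 1 := abs_le.2 ⟨by linarith [hs.1, ht.2], by linarith [hs.2, ht.1]⟩
  set τ : ℝ := t - s with hτ
  have hτ0 : τ ≠ 0 := sub_ne_zero.2 hst.symm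
  have hτp : 0 < |τ| := abs_pos.2 hτ0
  set w : ℂ := (τ : ℂ) * avg v s t - h with hw
  set x : ℂ := expX ε v s t - 2 * Real.pi * Complex.I * h / ε with hx
  have hxw : x = 2 * Real.pi * Complex.I / ε * w := by rw [hx, displaced_expX_eq]
  have hwτ : c * |τ| ≤ ‖w‖ := by
    have h1 := abs_im_mul_le_norm_displaced (avg v s t) h τ
    rw [mul_comm (avg v s t)] at h1
    have h2 := hv.le_im_avg hvc s t
    have h3 : c ≤ |(avg v s t).im| := h2.trans (le_abs_self _)
    exact (mul_le_mul_of_nonneg_right h3 (abs_nonneg _)).trans h1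
  have hwp : 0 < ‖w‖ := lt_of_lt_of_le (by positivity) hwτ
  have hw0 : w ≠ 0 := norm_pos_iff.1 hwp
  have hhw : h ≤ (1 + M / c) * ‖w‖ := by
    have e1 : (h : ℂ) = (τ : ℂ) * avg v s t - w := by rw [hw]; ring
    have e2 : h = ‖(h : ℂ)‖ := by rw [Complex.norm_real, Real.norm_of_nonneg hh.1.le]
    have e3 : ‖(τ : ℂ) * avg v s t‖ ≤ M / c * ‖w‖ := by
      rw [norm_mul, Complex.norm_real, Real.norm_eq_abs]
      calc |τ| * ‖avg v s t‖ ≤ |τ| * M := by gcongr; exact hv.norm_avg_le s t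
        _ = M / c * (c * |τ|) := by field_simp
        _ ≤ _ := by gcongr
    rw [e2, e1]
    calc _ ≤ M / c * ‖w‖ + ‖w‖ := (norm_sub_le _ _).trans (by linarith)
      _ = _ := by ring
  set β := v s with hβ
  have hβτ : c * |τ| ≤ ‖β * (τ : ℂ) - h‖ := by
    refine le_trans (mul_le_mul_of_nonneg_right ?_ (abs_nonneg _))
      (abs_im_mul_le_norm_displaced β h τ)
    exact (hvc s).trans (le_abs_self _)
  have hβp : 0 < ‖β * (τ : ℂ) - h‖ := lt_of_lt_of_le (by positivity) hβτ
  have hβ0 : β * (τ : ℂ) - h ≠ 0 := norm_pos_iff.1 hβp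
  have hphi' := hphi t ht h ⟨hh.1.le, hh.2⟩
  have hphi0 : phi1 x ≠ 0 := norm_pos_iff.1 (hm.trans_le hphi')
  have hεc : (ε : ℂ) ≠ 0 := Complex.ofReal_ne_zero.2 hε.ne'
  have hpi : (Real.pi : ℂ) ≠ 0 := by simp [Real.pi_ne_zero]
  set y := expY ε p s t with hy
  -- The two poles cancel: what is left has numerators that vanish with `w` and `τ`.
  have key : curveKernel ε v p s h t - 1 / (2 * Real.pi * Complex.I) * displacedKernel β h τ =
      1 / (2 * Real.pi * Complex.I) * (v t * (y * phi1 y - x * phi2 x) / (w * phi1 x) +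
        (β * τ * (v t - avg v s t) - h * (v t - β)) / (w * (β * τ - h))) := by
    have f1 : Complex.exp x - 1 = 2 * Real.pi * Complex.I / ε * w * phi1 x := by
      rw [← mul_phi1, hxw]
    have f2 : y * phi1 y - x * phi2 x = Complex.exp y - phi1 x := by
      rw [mul_phi1, mul_phi2]; ring
    have f3 : β * τ * (v t - avg v s t) - h * (v t - β) = v t * (β * τ - h) - β * w := by
      rw [hw]; ring
    rw [f2, f3, curveKernel, displacedKernel, ← hx, f1]
    field_simp
    ring
  have hxr : ‖x‖ ≤ r := by
    rw [hx]
    have g1 : ‖expX ε v s t‖ ≤ 2 * Real.pi * M / ε := by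
      refine (norm_expX_le hv hε s t).trans ?_
      rw [mul_div_assoc (2 * Real.pi), mul_assoc, ← mul_div_assoc M]
      gcongr
      nlinarith
    have g2 : ‖2 * Real.pi * Complex.I * h / (ε : ℂ)‖ ≤ 2 * Real.pi := by
      rw [norm_div, norm_mul, norm_mul, norm_mul]
      simp only [Complex.norm_ofNat, Complex.norm_real, Complex.norm_I, mul_one,
        Real.norm_of_nonneg Real.pi_pos.le, Real.norm_of_nonneg hh.1.le, Real.norm_of_nonneg hε.le]
      rw [div_le_iff₀ hε]
      have := hh.2
      gcongr
      linarith
    have g3 : 0 ≤ 2 * M / ε := by positivity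
    exact (norm_sub_le _ _).trans (by rw [hr]; linarith)
  have hyn : ‖y‖ ≤ 2 * M / ε * |τ| := by
    refine (norm_expY_le hp hε s t).trans (le_of_eq ?_)
    rw [abs_sub_comm]; ring
  have hyr : ‖y‖ ≤ r := by
    have g3 : 0 ≤ 2 * Real.pi * M / ε + 2 * Real.pi := by positivity
    rw [abs_sub_comm] at hτ1
    calc ‖y‖ ≤ 2 * M / ε * |τ| := hyn
      _ ≤ 2 * M / ε * 1 := by gcongr
      _ ≤ r := by rw [hr]; linarith
  have hnum : ‖y * phi1 y - x * phi2 x‖ ≤ A * ‖w‖ := by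
    have g1 : ‖x‖ = 2 * Real.pi / ε * ‖w‖ := by
      rw [hxw, norm_mul, norm_div]
      simp [abs_of_pos hε, abs_of_pos Real.pi_pos]
    refine (norm_sub_le _ _).trans ?_
    rw [norm_mul, norm_mul]
    calc _ ≤ (2 * M / ε * |τ|) * C1 + (2 * Real.pi / ε * ‖w‖) * C2 :=
          add_le_add (mul_le_mul hyn (h1b y hyr) (norm_nonneg _) (by positivity))
            (mul_le_mul g1.le (h2b x hxr) (norm_nonneg _) (by positivity))
      _ = 2 * M / ε / c * C1 * (c * |τ|) + 2 * Real.pi / ε * C2 * ‖w‖ := by field_simp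
      _ ≤ 2 * M / ε / c * C1 * ‖w‖ + 2 * Real.pi / ε * C2 * ‖w‖ := by gcongr
      _ = _ := by rw [hA]; ring
  have hA0 : 0 ≤ A := by positivity
  rw [key, norm_mul]
  refine mul_le_mul ?_ ((norm_add_le _ _).trans (add_le_add ?_ ?_)) (norm_nonneg _) zero_le_one
  · rw [norm_div, norm_mul, norm_mul]
    simp only [norm_one, Complex.norm_ofNat, Complex.norm_real, Complex.norm_I, mul_one,
      Real.norm_of_nonneg Real.pi_pos.le]
    rw [div_le_one (by positivity)]
    linarith [Real.pi_gt_three]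
  · rw [norm_div, norm_mul, norm_mul]
    calc _ ≤ M * (A * ‖w‖) / (‖w‖ * m) := by gcongr; exact hv.2 t
      _ = M * A / m := by field_simp
  · have k1 : ‖v t - avg v s t‖ ≤ M * |τ| := by
      have := hv.norm_avg_sub_avg_le t t s t
      rw [LipBdd.avg_self, sub_self, abs_zero, add_zero] at this
      exact this
    have k2 : ‖v t - β‖ ≤ M * |τ| := hv.1 t s
    rw [norm_div, norm_mul]
    have k3 : ‖β * τ * (v t - avg v s t) - h * (v t - β)‖ ≤
        M * |τ| * (M * |τ|) + h * (M * |τ|) := by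
      refine (norm_sub_le _ _).trans ?_
      rw [norm_mul, norm_mul, norm_mul, Complex.norm_real, Complex.norm_real, Real.norm_eq_abs,
        Real.norm_of_nonneg hh.1.le]
      have := hv.2 s
      have := hh.1.le
      gcongr
    rw [div_le_iff₀ (by positivity)]
    have k4 : M * |τ| * (M * |τ|) ≤ M * M / c ^ 2 * (‖w‖ * ‖β * (τ : ℂ) - h‖) := by
      calc M * |τ| * (M * |τ|) = M * M / c ^ 2 * ((c * |τ|) * (c * |τ|)) := by field_simp
        _ ≤ _ := by gcongr
    have k5 : h * (M * |τ|) ≤ (1 + M / c) * M / c * (‖w‖ * ‖β * (τ : ℂ) - h‖) := by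
      calc h * (M * |τ|) ≤ (1 + M / c) * ‖w‖ * (M * |τ|) := by gcongr
        _ = (1 + M / c) * M / c * (‖w‖ * (c * |τ|)) := by field_simp
        _ ≤ _ := by gcongr
    linarith

/-- The value of `K₊ F` in the parameters of the curve: the integral with the remainder of the
kernel, and the boundary value of the Hilbert part. For `p = 0` it is the value of `L₊ F`. -/
def curveOperator (a ε : ℝ) (v p F : ℝ → ℂ) (s : ℝ) : ℂ :=
  (∫ t in (0 : ℝ)..1, smoothKernel ε v p s t * F t) +
    1 / (2 * Real.pi * Complex.I) * (unitHilbert a F s - Real.pi * Complex.I * F s)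

lemma tendsto_integral_curveKernel {a b N : ℝ} {F : ℝ → ℂ} (hb : 0 < b) (hba : b < a)
    (ha : a < 1) (hF : HolderUnit a b N F) (hc : 0 < c) (hv : LipBdd M v)
    (hvc : ∀ t, c ≤ (v t).im) (hp : LipBdd M p) (hε : 0 < ε) {s : ℝ} (hs : s ∈ Ioo (0 : ℝ) 1) :
    (∀ᶠ h in 𝓝[>] (0 : ℝ),
      IntervalIntegrable (fun t => curveKernel ε v p s h t * F t) volume 0 1) ∧
    Tendsto (fun h => ∫ t in (0 : ℝ)..1, curveKernel ε v p s h t * F t) (𝓝[>] 0)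
      (𝓝 (curveOperator a ε v p F s)) := by
  have ha0 : 0 ≤ a := (hb.trans hba).le
  have hFi : IntervalIntegrable F volume 0 1 :=
    (intervalIntegrable_iff_integrableOn_Ioo_of_le zero_le_one).2 (hF.integrableOn hb ha0 ha)
  have hβ : (v s).im ≠ 0 := (hc.trans_le (hvc s)).ne'
  have small : ∀ᶠ h in 𝓝[>] (0 : ℝ), h ∈ Ioc 0 (ε / 2) := Ioc_mem_nhdsGT (by positivity)
  have i1 : ∀ h ∈ Ioc 0 (ε / 2),
      IntervalIntegrable (fun t => curveKernel ε v p s h t * F t) volume 0 1 := fun h hh =>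
    hFi.continuousOn_mul
      (continuous_curveKernel hc hv hvc hp hε s hh.1 (by linarith [hh.2])).continuousOn
  have i2 : ∀ h ∈ Ioc 0 (ε / 2), IntervalIntegrable
      (fun t => displacedKernel (v s) h (t - s) * F t) volume 0 1 := fun h hh =>
    hFi.continuousOn_mul
      ((continuous_displacedKernel hβ hh.1).comp (by fun_prop)).continuousOn
  refine ⟨small.mono i1, ?_⟩
  obtain ⟨C, hC⟩ := exists_curveKernel_sub_bound hc hv hvc hp hε ⟨hs.1.le, hs.2.le⟩
  have hne : ∀ᵐ t : ℝ, s ≠ t := by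
    have : ∀ᵐ t : ℝ, t ≠ s := by simp [ae_iff]
    filter_upwards [this] with t ht using ht.symm
  have lim1 : Tendsto (fun h => ∫ t in (0 : ℝ)..1, (curveKernel ε v p s h t -
      1 / (2 * Real.pi * Complex.I) * displacedKernel (v s) h (t - s)) * F t) (𝓝[>] 0)
      (𝓝 (∫ t in (0 : ℝ)..1, smoothKernel ε v p s t * F t)) := by
    refine intervalIntegral.tendsto_integral_filter_of_dominated_convergence
      (fun t => C * ‖F t‖) ?_ ?_ (hFi.norm.const_mul C) ?_
    · filter_upwards [small] with h hh
      have := (i1 h hh).sub ((i2 h hh).const_mul (1 / (2 * Real.pi * Complex.I)))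
      refine AEStronglyMeasurable.congr this.aestronglyMeasurable_restrict_uIoc ?_
      exact Eventually.of_forall fun t => by ring
    · filter_upwards [small] with h hh
      filter_upwards [hne] with t hst ht
      rw [uIoc_of_le zero_le_one] at ht
      rw [norm_mul]
      gcongr
      exact hC t ⟨ht.1.le, ht.2⟩ hst h hh
    · filter_upwards [hne] with t hst _
      exact (tendsto_curveKernel hc hv hvc hε hst).mul_const (F t)
  have lim2 := (tendsto_integral_displacedKernel_mul hb hba ha hF (hc.trans_le (hvc s))
    hs).const_mul (1 / (2 * Real.pi * Complex.I))
  refine (lim1.add lim2).congr' ?_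
  filter_upwards [small] with h hh
  rw [← intervalIntegral.integral_const_mul, ← intervalIntegral.integral_add]
  · refine intervalIntegral.integral_congr fun t _ => ?_
    ring
  · have := (i1 h hh).sub ((i2 h hh).const_mul (1 / (2 * Real.pi * Complex.I)))
    refine this.congr fun t _ => ?_
    ring
  · exact (i2 h hh).const_mul _

end

/-! ### Weighted integrals of the kernel majorants -/

lemma integrableOn_rpow_div_one_add {a : ℝ} (ha0 : 0 < a) (ha : a < 1) :
    IntegrableOn (fun u : ℝ => u ^ (-a) / (1 + u)) (Ioi 0) := by
  have hmeas : Measurable fun u : ℝ => u ^ (-a) / (1 + u) := by fun_prop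
  rw [← Ioc_union_Ioi_eq_Ioi zero_le_one]
  refine IntegrableOn.union ?_ ?_
  · have h := intervalIntegral.intervalIntegrable_rpow' (a := 0) (b := 1) (by linarith : -1 < -a)
    rw [intervalIntegrable_iff_integrableOn_Ioc_of_le zero_le_one] at h
    refine h.mono' hmeas.aestronglyMeasurable
      ((ae_restrict_iff' measurableSet_Ioc).2 (Eventually.of_forall fun u hu => ?_))
    have hu0 : 0 < u := hu.1
    rw [Real.norm_of_nonneg (by positivity)]
    exact div_le_self (by positivity) (by linarith)
  · refine (integrableOn_Ioi_rpow_of_lt (by linarith : -a - 1 < -1) one_pos).mono'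
      hmeas.aestronglyMeasurable
      ((ae_restrict_iff' measurableSet_Ioi).2 (Eventually.of_forall fun u hu => ?_))
    have hu1 : 1 < u := hu
    have hu0 : 0 < u := by linarith
    rw [Real.norm_of_nonneg (by positivity), Real.rpow_sub_one hu0.ne']
    gcongr
    linarith

lemma exists_integral_rpow_div_add_eq {a : ℝ} (ha0 : 0 < a) (ha : a < 1) :
    ∃ C : ℝ, 0 ≤ C ∧ ∀ ε : ℝ, 0 < ε → IntegrableOn (fun t : ℝ => t ^ (-a) / (ε + t)) (Ioi 0) ∧
      ∫ t in Ioi (0 : ℝ), t ^ (-a) / (ε + t) = C * ε ^ (-a) := by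
  refine ⟨∫ u in Ioi (0 : ℝ), u ^ (-a) / (1 + u),
    setIntegral_nonneg measurableSet_Ioi fun u hu => ?_, fun ε hε => ?_⟩
  · have hu0 : 0 < u := hu
    positivity
  have e : ∀ u ∈ Ioi (0 : ℝ), (ε * u) ^ (-a) / (ε + ε * u) =
      ε ^ (-a) * ε⁻¹ * (u ^ (-a) / (1 + u)) := by
    intro u hu
    have hu0 : 0 < u := hu
    rw [Real.mul_rpow hε.le hu0.le]
    field_simp
  constructor
  · have h := (integrableOn_rpow_div_one_add ha0 ha).const_mul (ε ^ (-a) * ε⁻¹)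
    have h2 := (integrableOn_Ioi_comp_mul_left_iff (fun t : ℝ => t ^ (-a) / (ε + t)) 0 hε).1
      (IntegrableOn.congr_fun h (fun u hu => (e u hu).symm) measurableSet_Ioi)
    rwa [mul_zero] at h2
  · have h := integral_comp_mul_left_Ioi' (fun t : ℝ => t ^ (-a) / (ε + t)) 0 hε
    rw [mul_zero] at h
    rw [← h, setIntegral_congr_fun measurableSet_Ioi e, integral_const_mul, smul_eq_mul]
    field_simp

lemma exists_integral_add_abs_rpow_eq {a : ℝ} (ha0 : 0 < a) :
    ∃ C : ℝ, 0 ≤ C ∧ ∀ ε : ℝ, 0 < ε → Integrable (fun x : ℝ => (ε + |x|) ^ (-1 - a)) ∧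
      ∫ x : ℝ, (ε + |x|) ^ (-1 - a) = C * ε ^ (-a) := by
  refine ⟨∫ x : ℝ, (1 + |x|) ^ (-1 - a), integral_nonneg fun x => by positivity, fun ε hε => ?_⟩
  have h1 : Integrable fun x : ℝ => (1 + |x|) ^ (-1 - a) := by
    have := integrable_one_add_norm (E := ℝ) (μ := volume) (r := 1 + a) (by simpa using ha0)
    simpa [sub_eq_add_neg, add_comm] using this
  have e : ∀ x : ℝ, (ε + |ε * x|) ^ (-1 - a) = ε ^ (-a) * ε⁻¹ * (1 + |x|) ^ (-1 - a) := by
    intro x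
    have : ε + |ε * x| = ε * (1 + |x|) := by rw [abs_mul, abs_of_pos hε]; ring
    rw [this, Real.mul_rpow hε.le (by positivity)]
    congr 1
    rw [show -1 - a = -a - 1 by ring, Real.rpow_sub_one hε.ne', div_eq_mul_inv]
  constructor
  · have h := h1.const_mul (ε ^ (-a) * ε⁻¹)
    refine (integrable_comp_mul_left_iff (fun x : ℝ => (ε + |x|) ^ (-1 - a)) hε.ne').1 ?_
    refine h.congr (Eventually.of_forall fun x => (e x).symm)
  · have h := Measure.integral_comp_mul_left (fun x : ℝ => (ε + |x|) ^ (-1 - a)) ε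
    simp only [e] at h
    rw [integral_const_mul, abs_of_pos (inv_pos.2 hε), smul_eq_mul] at h
    field_simp at h
    linarith

/-- The power and the pole are separated: either `t ≤ |t - s|`, or `t ≤ ε`, or `t` is at least half of
`ε + |t - s|`. -/
lemma rpow_neg_div_add_le {a ε s t : ℝ} (ha0 : 0 < a) (ha : a < 1) (hε : 0 < ε) (ht : 0 < t) :
    t ^ (-a) / (ε + |t - s|) ≤ 2 * (t ^ (-a) / (ε + t) + (ε + |t - s|) ^ (-1 - a)) := by
  have p1 : 0 < t ^ (-a) := by positivity
  have p2 : 0 < ε + |t - s| := by positivity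
  have p3 : 0 ≤ (ε + |t - s|) ^ (-1 - a) := by positivity
  have p4 : 0 ≤ t ^ (-a) / (ε + t) := by positivity
  rcases le_or_gt t |t - s| with h | h
  · have : t ^ (-a) / (ε + |t - s|) ≤ t ^ (-a) / (ε + t) := by gcongr
    linarith
  rcases le_or_gt t ε with h' | h'
  · have : t ^ (-a) / (ε + |t - s|) ≤ 2 * (t ^ (-a) / (ε + t)) := by
      rw [← mul_div_assoc, div_le_div_iff₀ p2 (by positivity)]
      nlinarith [abs_nonneg (t - s)]
    linarith
  · have h1 : t ^ (-a) ≤ 2 * (ε + |t - s|) ^ (-a) := by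
      calc t ^ (-a) ≤ ((ε + |t - s|) / 2) ^ (-a) :=
            Real.rpow_le_rpow_of_nonpos (by positivity) (by linarith) (by linarith)
        _ = 2 ^ a * (ε + |t - s|) ^ (-a) := by
            rw [Real.div_rpow p2.le two_pos.le, Real.rpow_neg two_pos.le, div_inv_eq_mul, mul_comm]
        _ ≤ 2 ^ (1 : ℝ) * (ε + |t - s|) ^ (-a) := by
            gcongr
            norm_num
        _ = _ := by rw [Real.rpow_one]
    have h2 : (ε + |t - s|) ^ (-1 - a) = (ε + |t - s|) ^ (-a) / (ε + |t - s|) := by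
      rw [← Real.rpow_sub_one p2.ne']; congr 1; ring
    have : t ^ (-a) / (ε + |t - s|) ≤ 2 * (ε + |t - s|) ^ (-1 - a) := by
      rw [h2, ← mul_div_assoc]; gcongr
    linarith

/-- The integral of `1 / (ε + |t - s|)` against the inverse weight costs the factor `ε ^ (-a)`,
uniformly in `s`: both terms of the pointwise bound scale like `ε ^ (-a)`. -/
lemma exists_integral_inv_add_mul_inv_wt_le {a : ℝ} (ha0 : 0 < a) (ha : a < 1) :
    ∃ C : ℝ, 0 ≤ C ∧ ∀ ε : ℝ, 0 < ε → ∀ s : ℝ,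
      IntegrableOn (fun t => 1 / (ε + |t - s|) * (wt a t)⁻¹) (Ioo 0 1) ∧
      ∫ t in Ioo (0 : ℝ) 1, 1 / (ε + |t - s|) * (wt a t)⁻¹ ≤ C * ε ^ (-a) := by
  obtain ⟨C₁, hC₁, h₁⟩ := exists_integral_rpow_div_add_eq ha0 ha
  obtain ⟨C₂, hC₂, h₂⟩ := exists_integral_add_abs_rpow_eq ha0
  refine ⟨4 * (2 * C₁ + 2 * C₂), by positivity, fun ε hε s => ?_⟩
  obtain ⟨i₁, v₁⟩ := h₁ ε hε
  obtain ⟨i₂, v₂⟩ := h₂ ε hε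
  set m : ℝ → ℝ := fun t => t ^ (-a) / (ε + t) with hm
  set n : ℝ → ℝ := fun x => (ε + |x|) ^ (-1 - a) with hn
  have im : IntegrableOn m (Ioo 0 1) := i₁.mono_set fun t ht => ht.1
  have vm : ∫ t in Ioo (0 : ℝ) 1, m t ≤ C₁ * ε ^ (-a) := by
    rw [← v₁]
    refine setIntegral_mono_set i₁ ?_ (Eventually.of_forall fun t ht => ht.1)
    refine (ae_restrict_iff' measurableSet_Ioi).2 (Eventually.of_forall fun t ht => ?_)
    have : 0 < t := ht
    simp only [hm, Pi.zero_apply]; positivity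
  have im' : IntegrableOn (fun t => m (1 - t)) (Ioo 0 1) := by
    have h := ((intervalIntegrable_iff_integrableOn_Ioo_of_le zero_le_one).2 im).comp_sub_left 1
    simp only [sub_zero, sub_self] at h
    exact (intervalIntegrable_iff_integrableOn_Ioo_of_le zero_le_one).1 h.symm
  have vm' : ∫ t in Ioo (0 : ℝ) 1, m (1 - t) = ∫ t in Ioo (0 : ℝ) 1, m t := by
    rw [← integral_Ioc_eq_integral_Ioo, ← integral_Ioc_eq_integral_Ioo,
      ← intervalIntegral.integral_of_le zero_le_one, ← intervalIntegral.integral_of_le zero_le_one,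
      intervalIntegral.integral_comp_sub_left m]
    simp
  have in' : IntegrableOn (fun t => n (t - s)) (Ioo 0 1) := (i₂.comp_sub_right s).integrableOn
  have vn : ∫ t in Ioo (0 : ℝ) 1, n (t - s) ≤ C₂ * ε ^ (-a) := by
    rw [← v₂, ← integral_sub_right_eq_self n s]
    refine setIntegral_le_integral (i₂.comp_sub_right s) (Eventually.of_forall fun t => ?_)
    simp only [hn, Pi.zero_apply]; positivity
  set g : ℝ → ℝ := fun t => 4 * ((m t + m (1 - t)) + 2 * n (t - s)) with hg
  have ig : IntegrableOn g (Ioo 0 1) := ((im.add im').add (in'.const_mul 2)).const_mul 4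
  have hle : ∀ t ∈ Ioo (0 : ℝ) 1, 1 / (ε + |t - s|) * (wt a t)⁻¹ ≤ g t := by
    intro t ht
    have h1 := inv_wt_le ha0.le ha.le ht
    have h2 := rpow_neg_div_add_le (s := s) ha0 ha hε ht.1
    have h3 := rpow_neg_div_add_le (s := 1 - s) ha0 ha hε (sub_pos.2 ht.2)
    rw [sub_sub_sub_cancel_left, abs_sub_comm s t] at h3
    calc 1 / (ε + |t - s|) * (wt a t)⁻¹
        ≤ 1 / (ε + |t - s|) * (2 * (t ^ (-a) + (1 - t) ^ (-a))) := by gcongr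
      _ = 2 * (t ^ (-a) / (ε + |t - s|) + (1 - t) ^ (-a) / (ε + |t - s|)) := by ring
      _ ≤ g t := by simp only [hg, hm, hn]; linarith
  have hnn : ∀ t ∈ Ioo (0 : ℝ) 1, 0 ≤ 1 / (ε + |t - s|) * (wt a t)⁻¹ := fun t ht => by
    have := wt_pos a ht
    positivity
  have ii : IntegrableOn (fun t => 1 / (ε + |t - s|) * (wt a t)⁻¹) (Ioo 0 1) := by
    refine ig.mono' ?_ ((ae_restrict_iff' measurableSet_Ioo).2 (Eventually.of_forall fun t ht => ?_))
    · have : Continuous fun t : ℝ => 1 / (ε + |t - s|) :=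
        continuous_const.div (by fun_prop) fun t => by positivity
      exact (this.continuousOn.mul ((continuousOn_wt a).inv₀
        fun t ht => (wt_pos a ht).ne')).aestronglyMeasurable measurableSet_Ioo
    · rw [Real.norm_of_nonneg (hnn t ht)]; exact hle t ht
  refine ⟨ii, (setIntegral_mono_on ii ig measurableSet_Ioo hle).trans ?_⟩
  have : ∫ t in Ioo (0 : ℝ) 1, g t = 4 * (((∫ t in Ioo (0 : ℝ) 1, m t) +
      ∫ t in Ioo (0 : ℝ) 1, m (1 - t)) + 2 * ∫ t in Ioo (0 : ℝ) 1, n (t - s)) := by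
    have ims : IntegrableOn (fun t => m t + m (1 - t)) (Ioo 0 1) := im.add im'
    simp only [hg]
    rw [integral_const_mul, integral_add ims (in'.const_mul 2), integral_add im im',
      integral_const_mul]
  rw [this, vm']
  nlinarith

/-- The singularity at `s` is integrable against the inverse weight, after multiplication by the weight
at `s`: `wt a s ≤ wt a t + 2 |t - s| ^ a` and `b < a`. -/
lemma exists_wt_mul_integral_le {a b : ℝ} (hb : 0 < b) (hba : b < a) (ha : a < 1) :
    ∃ C : ℝ, 0 ≤ C ∧ ∀ s ∈ Ioo (0 : ℝ) 1,
      IntegrableOn (fun t => |t - s| ^ (-b) * (wt a t)⁻¹) (Ioo 0 1) ∧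
      wt a s * ∫ t in Ioo (0 : ℝ) 1, |t - s| ^ (-b) * (wt a t)⁻¹ ≤ C := by
  have ha0 : 0 ≤ a := (hb.trans hba).le
  have iw := integrableOn_inv_wt ha0 ha
  have hw0 : 0 ≤ ∫ t in Ioo (0 : ℝ) 1, (wt a t)⁻¹ := setIntegral_nonneg measurableSet_Ioo
    fun t ht => (inv_nonneg.2 (wt_pos a ht).le)
  have hb1 : 0 < -b + 1 := by linarith
  refine ⟨2 / (-b + 1) + 2 * ∫ t in Ioo (0 : ℝ) 1, (wt a t)⁻¹, by positivity, fun s hs => ?_⟩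
  have hws := wt_pos a hs
  have hp : IntervalIntegrable (fun t => |t - s| ^ (-b)) volume 0 1 :=
    intervalIntegrable_abs_sub_rpow (by linarith) s 0 1
  have ip : IntegrableOn (fun t => |t - s| ^ (-b)) (Ioo 0 1) :=
    (intervalIntegrable_iff_integrableOn_Ioo_of_le zero_le_one).1 hp
  have vp : ∫ t in Ioo (0 : ℝ) 1, |t - s| ^ (-b) ≤ 2 / (-b + 1) := by
    rw [← integral_Ioc_eq_integral_Ioo, ← intervalIntegral.integral_of_le zero_le_one]
    have := integral_abs_sub_rpow_le (r := -b) (s := s) (x := 0) (y := 1) (l := 1) (by linarith)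
      zero_le_one (by linarith [hs.2]) (by linarith [hs.1])
    simpa using this
  have ig := ip.add (iw.const_mul 2)
  have hle : ∀ t ∈ Ioo (0 : ℝ) 1, wt a s * (|t - s| ^ (-b) * (wt a t)⁻¹) ≤
      |t - s| ^ (-b) + 2 * (wt a t)⁻¹ := by
    intro t ht
    have hwt := wt_pos a ht
    by_cases hts : t = s
    · rw [hts, sub_self, abs_zero, Real.zero_rpow (by linarith)]
      simp only [zero_mul, mul_zero, zero_add]
      positivity
    have hd : 0 < |t - s| := abs_pos.2 (sub_ne_zero.2 hts)
    have h1 := (abs_le.1 (abs_wt_sub_le ha0 ha.le ⟨hs.1.le, hs.2.le⟩ ⟨ht.1.le, ht.2.le⟩)).2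
    rw [abs_sub_comm s t] at h1
    have h2 : |t - s| ^ a * |t - s| ^ (-b) ≤ 1 := by
      rw [← Real.rpow_add hd]
      exact Real.rpow_le_one hd.le (abs_le.2 ⟨by linarith [hs.2, ht.1], by linarith [hs.1, ht.2]⟩)
        (by linarith)
    calc wt a s * (|t - s| ^ (-b) * (wt a t)⁻¹)
        ≤ (wt a t + 2 * |t - s| ^ a) * (|t - s| ^ (-b) * (wt a t)⁻¹) := by
          gcongr; linarith
      _ = |t - s| ^ (-b) + 2 * (|t - s| ^ a * |t - s| ^ (-b)) * (wt a t)⁻¹ := by field_simp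
      _ ≤ |t - s| ^ (-b) + 2 * 1 * (wt a t)⁻¹ := by gcongr
      _ = _ := by ring
  have ii : IntegrableOn (fun t => wt a s * (|t - s| ^ (-b) * (wt a t)⁻¹)) (Ioo 0 1) := by
    refine ig.mono' ?_ ((ae_restrict_iff' measurableSet_Ioo).2 (Eventually.of_forall fun t ht => ?_))
    · have : Measurable fun t : ℝ => |t - s| ^ (-b) := by fun_prop
      exact aestronglyMeasurable_const.mul (this.aestronglyMeasurable.mul
        (((continuousOn_wt a).inv₀ fun t ht => (wt_pos a ht).ne').aestronglyMeasurable
          measurableSet_Ioo))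
    · have hwt := wt_pos a ht
      rw [Real.norm_of_nonneg (by positivity)]; exact hle t ht
  constructor
  · have := ii.const_mul (wt a s)⁻¹
    refine this.congr (Eventually.of_forall fun t => ?_)
    field_simp
  · rw [← integral_const_mul]
    refine (setIntegral_mono_on ii ig measurableSet_Ioo hle).trans ?_
    have : ∫ t in Ioo (0 : ℝ) 1, (|t - s| ^ (-b) + 2 * (wt a t)⁻¹) =
        (∫ t in Ioo (0 : ℝ) 1, |t - s| ^ (-b)) + 2 * ∫ t in Ioo (0 : ℝ) 1, (wt a t)⁻¹ := by
      rw [integral_add ip (iw.const_mul 2), integral_const_mul]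
    simp only [Pi.add_apply] at this ⊢
    rw [this]
    linarith

/-! ### The bound in the parameters of the curve -/

/-- An integral operator maps the weighted Hölder space to itself if its kernel and the increments of
its kernel have integrable majorants, of the sizes `A` and `A |s₁ - s₂| ^ b`. -/
lemma holderUnit_integral {a b N A : ℝ} {F : ℝ → ℂ} (hb : 0 < b) (hba : b < a) (ha : a < 1)
    (hF : HolderUnit a b N F) {R : ℝ → ℝ → ℂ}
    (hR : ∀ s ∈ Ioo (0 : ℝ) 1, AEStronglyMeasurable (R s) (volume.restrict (Ioo 0 1)))
    (h₁ : ∀ s ∈ Ioo (0 : ℝ) 1, ∃ k : ℝ → ℝ,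
      IntegrableOn (fun t => k t * (wt a t)⁻¹) (Ioo 0 1) ∧
      (∀ t ∈ Ioo (0 : ℝ) 1, s ≠ t → ‖R s t‖ ≤ k t) ∧
      ∫ t in Ioo (0 : ℝ) 1, k t * (wt a t)⁻¹ ≤ A)
    (h₂ : ∀ s₁ ∈ Ioo (0 : ℝ) 1, ∀ s₂ ∈ Ioo (0 : ℝ) 1, ∃ k : ℝ → ℝ,
      IntegrableOn (fun t => k t * (wt a t)⁻¹) (Ioo 0 1) ∧
      (∀ t ∈ Ioo (0 : ℝ) 1, s₁ ≠ t → s₂ ≠ t → ‖R s₁ t - R s₂ t‖ ≤ k t) ∧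
      wt a s₁ * ∫ t in Ioo (0 : ℝ) 1, k t * (wt a t)⁻¹ ≤ A * |s₁ - s₂| ^ b) :
    HolderUnit a b (3 * A * N) (fun s => ∫ t in (0 : ℝ)..1, R s t * F t) := by
  have ha0 : 0 ≤ a := (hb.trans hba).le
  have hN := hF.nonneg
  have hFi := hF.integrableOn hb ha0 ha
  have hne : ∀ s : ℝ, ∀ᵐ t ∂(volume.restrict (Ioo (0 : ℝ) 1)), s ≠ t := fun s => by
    have : ∀ᵐ t : ℝ, t ≠ s := by simp [ae_iff]
    refine ae_restrict_of_ae ?_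
    filter_upwards [this] with t ht using ht.symm
  have hmem : ∀ᵐ t ∂(volume.restrict (Ioo (0 : ℝ) 1)), t ∈ Ioo (0 : ℝ) 1 :=
    ae_restrict_mem measurableSet_Ioo
  have hI : ∀ G : ℝ → ℂ, ∫ t in (0 : ℝ)..1, G t = ∫ t in Ioo (0 : ℝ) 1, G t := fun G => by
    rw [intervalIntegral.integral_of_le zero_le_one, integral_Ioc_eq_integral_Ioo]
  have bound : ∀ (S : ℝ → ℂ) (k : ℝ → ℝ), IntegrableOn (fun t => k t * (wt a t)⁻¹) (Ioo 0 1) →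
      (∀ᵐ t ∂(volume.restrict (Ioo (0 : ℝ) 1)), ‖S t‖ ≤ k t) →
      (∀ᵐ t ∂(volume.restrict (Ioo (0 : ℝ) 1)), ‖S t * F t‖ ≤ N * (k t * (wt a t)⁻¹)) := by
    intro S k _ hS
    filter_upwards [hS, hmem] with t h1 h2
    rw [norm_mul]
    have h3 := hF.norm_le h2
    calc ‖S t‖ * ‖F t‖ ≤ k t * (N * (wt a t)⁻¹) :=
          mul_le_mul h1 h3 (norm_nonneg _) ((norm_nonneg _).trans h1)
      _ = _ := by ring
  have size : ∀ s ∈ Ioo (0 : ℝ) 1, IntegrableOn (fun t => R s t * F t) (Ioo 0 1) ∧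
      ‖∫ t in Ioo (0 : ℝ) 1, R s t * F t‖ ≤ A * N := by
    intro s hs
    obtain ⟨k, ik, hk, vk⟩ := h₁ s hs
    have hb := bound (R s) k ik (by
      filter_upwards [hne s, hmem] with t h1 h2 using hk t h2 h1)
    refine ⟨(ik.const_mul N).mono' ((hR s hs).mul hFi.aestronglyMeasurable) hb, ?_⟩
    refine (norm_integral_le_of_norm_le (ik.const_mul N) hb).trans ?_
    rw [integral_const_mul, mul_comm A]
    gcongr
  have hA : 0 ≤ A * N := (norm_nonneg _).trans (size (1 / 2) ⟨by norm_num, by norm_num⟩).2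
  have hwle : ∀ s ∈ Ioo (0 : ℝ) 1, ‖(wt a s : ℂ)‖ ≤ 1 := fun s hs => by
    rw [Complex.norm_real, Real.norm_of_nonneg (wt_pos a hs).le]
    exact wt_le_one ha0 ⟨hs.1.le, hs.2.le⟩
  refine ⟨fun s hs => ?_, fun s₁ hs₁ s₂ hs₂ => ?_⟩
  · beta_reduce
    rw [hI, norm_mul]
    calc _ ≤ 1 * (A * N) := mul_le_mul (hwle s hs) (size s hs).2 (norm_nonneg _) zero_le_one
      _ ≤ _ := by linarith
  · beta_reduce
    rw [hI, hI]
    obtain ⟨k, ik, hk, vk⟩ := h₂ s₁ hs₁ s₂ hs₂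
    have e : (wt a s₁ : ℂ) * (∫ t in Ioo (0 : ℝ) 1, R s₁ t * F t) -
        (wt a s₂ : ℂ) * (∫ t in Ioo (0 : ℝ) 1, R s₂ t * F t) =
        (wt a s₁ : ℂ) * (∫ t in Ioo (0 : ℝ) 1, (R s₁ t - R s₂ t) * F t) +
        ((wt a s₁ - wt a s₂ : ℝ) : ℂ) * (∫ t in Ioo (0 : ℝ) 1, R s₂ t * F t) := by
      have : ∫ t in Ioo (0 : ℝ) 1, (R s₁ t - R s₂ t) * F t =
          (∫ t in Ioo (0 : ℝ) 1, R s₁ t * F t) - ∫ t in Ioo (0 : ℝ) 1, R s₂ t * F t := by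
        rw [← integral_sub (size s₁ hs₁).1 (size s₂ hs₂).1]
        simp only [sub_mul]
      rw [this]; push_cast; ring
    have hd : ‖∫ t in Ioo (0 : ℝ) 1, (R s₁ t - R s₂ t) * F t‖ ≤
        N * ∫ t in Ioo (0 : ℝ) 1, k t * (wt a t)⁻¹ := by
      rw [← integral_const_mul]
      refine norm_integral_le_of_norm_le (ik.const_mul N) (bound (fun t => R s₁ t - R s₂ t) k ik ?_)
      filter_upwards [hne s₁, hne s₂, hmem] with t h1 h2 h3 using hk t h3 h1 h2
    have hwd : |wt a s₁ - wt a s₂| ≤ 2 * |s₁ - s₂| ^ b := by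
      refine (abs_wt_sub_le ha0 ha.le ⟨hs₁.1.le, hs₁.2.le⟩ ⟨hs₂.1.le, hs₂.2.le⟩).trans ?_
      gcongr 2 * ?_
      exact Real.rpow_le_rpow_of_exponent_ge_of_imp (abs_nonneg _)
        (abs_le.2 ⟨by linarith [hs₁.1, hs₂.2], by linarith [hs₁.2, hs₂.1]⟩) hba.le
        (fun _ h0 => absurd h0 (hb.trans hba).ne')
    rw [e]
    refine (norm_add_le _ _).trans ?_
    rw [norm_mul, norm_mul, Complex.norm_real, Complex.norm_real,
      Real.norm_of_nonneg (wt_pos a hs₁).le, Real.norm_eq_abs]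
    have w1 := (wt_pos a hs₁).le
    calc _ ≤ wt a s₁ * (N * ∫ t in Ioo (0 : ℝ) 1, k t * (wt a t)⁻¹) +
          2 * |s₁ - s₂| ^ b * (A * N) :=
          add_le_add (mul_le_mul_of_nonneg_left hd w1)
            (mul_le_mul hwd (size s₂ hs₂).2 (norm_nonneg _) (by positivity))
      _ = N * (wt a s₁ * ∫ t in Ioo (0 : ℝ) 1, k t * (wt a t)⁻¹) +
          2 * |s₁ - s₂| ^ b * (A * N) := by ring
      _ ≤ N * (A * |s₁ - s₂| ^ b) + 2 * |s₁ - s₂| ^ b * (A * N) := by gcongr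
      _ = _ := by ring

lemma measurable_smoothKernel {M : ℝ} {v p : ℝ → ℂ} (hv : LipBdd M v) (hp : LipBdd M p)
    (ε s : ℝ) : Measurable (smoothKernel ε v p s) := by
  have h1 := (continuous_expX hv ε s).measurable
  have h2 := (continuous_expY hp ε s).measurable
  have h3 := hv.continuous.measurable
  have h4 := (continuous_avg hv s).measurable
  unfold smoothKernel remKernel cauchyDiff
  have h5 : Measurable fun t : ℝ => ((t - s : ℝ) : ℂ) := by fun_prop
  have h6 := h2.cexp
  have h7 := h1.cexp
  fun_prop

/-- The operator with the kernel of `K₊` is bounded on the weighted Hölder space of the unit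
interval; the dependence on `ε` comes from the majorant `B` of the exponential factor and from its
integral `A` against the inverse weight. -/
lemma exists_curveOperator_bound {a b c M : ℝ} {v p : ℝ → ℂ} (hb : 0 < b) (hba : b < a)
    (ha : a < 1) (hc : 0 < c) (hv : LipBdd M v) (hvc : ∀ t, c ≤ (v t).im) (hp : LipBdd M p)
    {C₀ : ℝ} (hC₀ : 0 ≤ C₀) :
    ∃ C : ℝ, 0 ≤ C ∧ ∀ ε : ℝ, 0 < ε → ε ≤ 1 → ∀ (B : ℝ → ℝ) (A : ℝ),
      (∀ τ, 0 ≤ τ → ε / (ε + τ) ≤ B τ) →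
      (∀ s ∈ Icc (0 : ℝ) 1, ∀ t ∈ Icc (0 : ℝ) 1, s < t →
        ‖Complex.exp (expY ε p s t)‖ ≤ C₀ * B |t - s|) →
      (∀ s ∈ Icc (0 : ℝ) 1, ∀ t ∈ Icc (0 : ℝ) 1, t < s →
        ‖Complex.exp (expY ε p s t - expX ε v s t)‖ ≤ C₀ * B |t - s|) →
      (∀ s ∈ Ioo (0 : ℝ) 1, IntegrableOn (fun t => 1 / ε * B |t - s| * (wt a t)⁻¹) (Ioo 0 1) ∧
        ∫ t in Ioo (0 : ℝ) 1, 1 / ε * B |t - s| * (wt a t)⁻¹ ≤ A) →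
      ∀ N F, HolderUnit a b N F →
        HolderUnit a b (C * (1 + A * ε ^ (-b)) * N) (curveOperator a ε v p F) := by
  have ha0 : 0 ≤ a := (hb.trans hba).le
  have hM : 0 ≤ M := hv.nonneg
  obtain ⟨C₁, hC₁, h₁⟩ := exists_remKernel_bound hc hv hvc hp hC₀
  obtain ⟨C₂, hC₂, h₂⟩ := exists_wt_mul_integral_le hb hba ha
  obtain ⟨C₃, hC₃, h₃⟩ := exists_unitHilbert_bound hb hba ha
  have iw := integrableOn_inv_wt ha0 ha
  set W := ∫ t in Ioo (0 : ℝ) 1, (wt a t)⁻¹ with hW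
  have hW0 : 0 ≤ W := setIntegral_nonneg measurableSet_Ioo
    fun t ht => (inv_nonneg.2 (wt_pos a ht).le)
  set Q := M * M / c ^ 2 + 2 * (M / c) with hQ
  have hQ0 : 0 ≤ Q := by positivity
  have hhalf : ‖(1 / (2 * Real.pi * Complex.I) : ℂ)‖ ≤ 1 := by
    rw [norm_div, norm_mul, norm_mul]
    simp only [norm_one, Complex.norm_ofNat, Complex.norm_real, Complex.norm_I, mul_one,
      Real.norm_of_nonneg Real.pi_pos.le]
    rw [div_le_one (by positivity)]
    linarith [Real.pi_gt_three]
  set C₄ := C₁ * M * 2 + M / c * W + Q * C₂ with hC₄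
  have hC₄0 : 0 ≤ C₄ := by positivity
  refine ⟨3 * C₄ + (C₃ + Real.pi), by positivity,
    fun ε hε hε1 B A hB hpos hneg hA N F hF => ?_⟩
  have hN := hF.nonneg
  obtain ⟨k₁, k₂⟩ := h₁ ε hε hε1 B hB hpos hneg
  have hBn : ∀ τ, 0 ≤ B |τ| := fun τ => le_trans (by positivity) (hB |τ| (abs_nonneg _))
  have hA0 : 0 ≤ A := by
    refine le_trans (setIntegral_nonneg measurableSet_Ioo fun t ht => ?_)
      (hA (1 / 2) ⟨by norm_num, by norm_num⟩).2
    have := wt_pos a ht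
    have := hBn (t - 1 / 2)
    positivity
  have hεb : 1 ≤ ε ^ (-b) := Real.one_le_rpow_of_pos_of_le_one_of_nonpos hε hε1 (by linarith)
  set S := 1 + A * ε ^ (-b) with hS
  have hS1 : 1 ≤ S := by rw [hS]; have : 0 ≤ A * ε ^ (-b) := by positivity
                         linarith
  have hSA : A ≤ S := by rw [hS]; nlinarith
  have rem : HolderUnit a b (3 * (C₄ * S) * N)
      (fun s => ∫ t in (0 : ℝ)..1, smoothKernel ε v p s t * F t) := by
    refine holderUnit_integral hb hba ha hF
      (fun s _ => (measurable_smoothKernel hv hp ε s).aestronglyMeasurable)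
      (fun s hs => ?_) (fun s₁ hs₁ s₂ hs₂ => ?_)
    · obtain ⟨ib, vb⟩ := hA s hs
      have i1 := (ib.const_mul (C₁ * M)).add (iw.const_mul (M / c))
      have e : ∀ t, C₁ * M * (1 / ε * B |t - s| * (wt a t)⁻¹) + M / c * (wt a t)⁻¹ =
          (C₁ * M * (1 / ε * B |t - s|) + M / c) * (wt a t)⁻¹ := fun t => by ring
      refine ⟨fun t => C₁ * M * (1 / ε * B |t - s|) + M / c, ?_, fun t ht hst => ?_, ?_⟩
      · exact i1.congr (Eventually.of_forall e)
      · rw [smoothKernel]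
        refine (norm_add_le _ _).trans ?_
        rw [norm_mul, norm_mul]
        have r1 := k₁ s ⟨hs.1.le, hs.2.le⟩ t ⟨ht.1.le, ht.2.le⟩ hst
        have b0 := hBn (t - s)
        calc _ ≤ C₁ / ε * B |t - s| * M + 1 * (M / c) :=
              add_le_add (mul_le_mul r1 (hv.2 t) (norm_nonneg _) (by positivity))
                (mul_le_mul hhalf (norm_cauchyDiff_le hc hv hvc s t) (norm_nonneg _) zero_le_one)
          _ = _ := by ring
      · simp only [← e]
        rw [integral_add (ib.const_mul _) (iw.const_mul _), integral_const_mul, integral_const_mul,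
          ← hW]
        calc _ ≤ C₁ * M * A + M / c * W := by gcongr
          _ ≤ C₁ * M * S + M / c * W * S := by
              exact add_le_add (by gcongr) (le_mul_of_one_le_right (by positivity) hS1)
          _ ≤ C₁ * M * S + M / c * W * S + (C₁ * M * S + Q * C₂ * S) := by
              have : 0 ≤ C₁ * M * S + Q * C₂ * S := by positivity
              linarith
          _ = C₄ * S := by rw [hC₄]; ring
    · obtain ⟨ib₁, vb₁⟩ := hA s₁ hs₁
      obtain ⟨ib₂, vb₂⟩ := hA s₂ hs₂
      obtain ⟨iq, vq⟩ := h₂ s₁ hs₁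
      set D := |s₁ - s₂| ^ b with hD
      have hD0 : 0 ≤ D := by positivity
      set δ := ε ^ (-b) * D with hδ
      have hδ0 : 0 ≤ δ := by positivity
      have ibs : IntegrableOn (fun t => 1 / ε * B |t - s₁| * (wt a t)⁻¹ +
          1 / ε * B |t - s₂| * (wt a t)⁻¹) (Ioo 0 1) := ib₁.add ib₂
      have i1 := (ibs.const_mul (C₁ * M * δ)).add (iq.const_mul (Q * D))
      have e : ∀ t, C₁ * M * δ * (1 / ε * B |t - s₁| * (wt a t)⁻¹ +
          1 / ε * B |t - s₂| * (wt a t)⁻¹) + Q * D * (|t - s₁| ^ (-b) * (wt a t)⁻¹) =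
          (C₁ * M * δ * (1 / ε * B |t - s₁| + 1 / ε * B |t - s₂|) + Q * D * |t - s₁| ^ (-b)) *
            (wt a t)⁻¹ := fun t => by ring
      refine ⟨fun t => C₁ * M * δ * (1 / ε * B |t - s₁| + 1 / ε * B |t - s₂|) +
        Q * D * |t - s₁| ^ (-b), ?_, fun t ht n₁ n₂ => ?_, ?_⟩
      · exact i1.congr (Eventually.of_forall e)
      · have e2 : smoothKernel ε v p s₁ t - smoothKernel ε v p s₂ t =
            (remKernel ε v p s₁ t - remKernel ε v p s₂ t) * v t +
            1 / (2 * Real.pi * Complex.I) * (cauchyDiff v s₁ t - cauchyDiff v s₂ t) := by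
          rw [smoothKernel, smoothKernel]; ring
        rw [e2]
        refine (norm_add_le _ _).trans ?_
        rw [norm_mul, norm_mul]
        have r1 := k₂ s₁ ⟨hs₁.1.le, hs₁.2.le⟩ s₂ ⟨hs₂.1.le, hs₂.2.le⟩ t ⟨ht.1.le, ht.2.le⟩ n₁ n₂
        have r2 := norm_cauchyDiff_sub_le hc hv hvc hb.le (hba.trans ha).le n₁ n₂
        have b1 := hBn (t - s₁)
        have b2 := hBn (t - s₂)
        -- Interpolation between the size and the Lipschitz bound; here `ε ^ (-b)` appears.
        have r3 : min 1 (|s₁ - s₂| / ε) ≤ δ := by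
          have hx : 0 ≤ |s₁ - s₂| / ε := by positivity
          have : δ = (|s₁ - s₂| / ε) ^ b := by
            rw [hδ, hD, Real.div_rpow (abs_nonneg _) hε.le, Real.rpow_neg hε.le]; ring
          rw [this]
          rcases le_total (|s₁ - s₂| / ε) 1 with h | h
          · exact (min_le_right _ _).trans (le_rpow_of_le_one hx h (hba.trans ha).le)
          · exact (min_le_left _ _).trans (Real.one_le_rpow h hb.le)
        have r4 : (|s₁ - s₂| / |t - s₁|) ^ b = D * |t - s₁| ^ (-b) := by
          rw [Real.div_rpow (abs_nonneg _) (abs_nonneg _), Real.rpow_neg (abs_nonneg _),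
            div_eq_mul_inv]
        rw [r4, ← mul_assoc] at r2
        have r5 : C₁ / ε * min 1 (|s₁ - s₂| / ε) * (B |t - s₁| + B |t - s₂|) ≤
            C₁ / ε * δ * (B |t - s₁| + B |t - s₂|) := by gcongr
        calc _ ≤ C₁ / ε * δ * (B |t - s₁| + B |t - s₂|) * M + 1 * (Q * D * |t - s₁| ^ (-b)) :=
              add_le_add (mul_le_mul (r1.trans r5) (hv.2 t) (norm_nonneg _) (by positivity))
                (mul_le_mul hhalf r2 (norm_nonneg _) zero_le_one)
          _ = _ := by ring
      · simp only [← e]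
        rw [integral_add (ibs.const_mul _) (iq.const_mul _), integral_const_mul,
          integral_const_mul, integral_add ib₁ ib₂]
        have hw0 := (wt_pos a hs₁).le
        have hw1 : wt a s₁ ≤ 1 := wt_le_one ha0 ⟨hs₁.1.le, hs₁.2.le⟩
        calc _ ≤ wt a s₁ * (C₁ * M * δ * (A + A)) + wt a s₁ * (Q * D *
              ∫ t in Ioo (0 : ℝ) 1, |t - s₁| ^ (-b) * (wt a t)⁻¹) := by
              rw [mul_add]; gcongr
          _ ≤ 1 * (C₁ * M * δ * (A + A)) + Q * D * (wt a s₁ *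
              ∫ t in Ioo (0 : ℝ) 1, |t - s₁| ^ (-b) * (wt a t)⁻¹) := by
              refine add_le_add (by gcongr) (le_of_eq (by ring))
          _ ≤ 1 * (C₁ * M * δ * (A + A)) + Q * D * C₂ := by gcongr
          _ = (C₁ * M * 2 * (A * ε ^ (-b)) + Q * C₂ * 1) * D := by rw [hδ]; ring
          _ ≤ (C₁ * M * 2 * S + Q * C₂ * S) * D := by
              gcongr; rw [hS]; linarith
          _ ≤ (C₁ * M * 2 * S + Q * C₂ * S + M / c * W * S) * D := by
              refine mul_le_mul_of_nonneg_right ?_ hD0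
              have : 0 ≤ M / c * W * S := by positivity
              linarith
          _ = C₄ * S * D := by rw [hC₄]; ring
  have hil := ((h₃ N F hF).add (hF.const_mul (-(Real.pi * Complex.I)))).const_mul
    (1 / (2 * Real.pi * Complex.I))
  have tot := rem.add hil
  have hfun : (fun t => (∫ u in (0 : ℝ)..1, smoothKernel ε v p t u * F u) +
      1 / (2 * Real.pi * Complex.I) * (unitHilbert a F t + -(Real.pi * Complex.I) * F t)) =
      curveOperator a ε v p F := by
    funext s
    rw [curveOperator]; ring
  rw [hfun] at tot
  refine tot.mono ?_
  have hn2 : ‖-(Real.pi * Complex.I)‖ = Real.pi := by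
    rw [norm_neg, norm_mul, Complex.norm_I, mul_one, Complex.norm_real,
      Real.norm_of_nonneg Real.pi_pos.le]
  rw [hn2]
  have hpi := Real.pi_pos
  calc _ ≤ 3 * (C₄ * S) * N + 1 * (C₃ * N + Real.pi * N) := by gcongr
    _ = 3 * (C₄ * S) * N + (C₃ + Real.pi) * 1 * N := by ring
    _ ≤ 3 * (C₄ * S) * N + (C₃ + Real.pi) * S * N := by gcongr
    _ = _ := by ring

/-! ### The curve in the unit parametrization -/

/-- The extension of a function from `[0, 1]` to the real line that is constant on each side. -/
def unitExt (g : ℝ → ℂ) (t : ℝ) : ℂ := g (projIcc 0 1 zero_le_one t)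

lemma unitExt_of_mem (g : ℝ → ℂ) {t : ℝ} (ht : t ∈ Icc (0 : ℝ) 1) : unitExt g t = g t := by
  rw [unitExt, projIcc_of_mem zero_le_one ht]

lemma exists_lipBdd_unitExt {g : ℝ → ℂ} (hg : ContDiffOn ℝ 1 g (Icc 0 1)) :
    ∃ M, LipBdd M (unitExt g) := by
  obtain ⟨K, hK⟩ := hg.exists_lipschitzOnWith one_ne_zero (convex_Icc 0 1) isCompact_Icc
  obtain ⟨B, hB⟩ := isCompact_Icc.exists_bound_of_continuousOn hg.continuousOn
  refine ⟨max K B, fun s t => ?_, fun t => ?_⟩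
  · have h1 := hK.dist_le_mul _ (projIcc (0 : ℝ) 1 zero_le_one s).2 _
      (projIcc (0 : ℝ) 1 zero_le_one t).2
    have h2 := (LipschitzWith.projIcc (zero_le_one (α := ℝ))).dist_le_mul s t
    rw [Subtype.dist_eq] at h2
    rw [dist_eq_norm] at h1
    rw [NNReal.coe_one, one_mul, Real.dist_eq s t] at h2
    calc _ ≤ _ := h1
      _ ≤ K * |s - t| := by gcongr
      _ ≤ _ := by gcongr; exact le_max_left _ _
  · exact (hB _ (projIcc (0 : ℝ) 1 zero_le_one t).2).trans (le_max_right _ _)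

lemma LipBdd.mono {M M' : ℝ} {g : ℝ → ℂ} (hg : LipBdd M g) (h : M ≤ M') : LipBdd M' g :=
  ⟨fun s t => (hg.1 s t).trans (by gcongr), fun t => (hg.2 t).trans h⟩

lemma contDiffOn_curveVelocity {γ : ℝ → ℂ} (hγ : ContDiffOn ℝ 2 γ (Icc 0 1)) :
    ContDiffOn ℝ 1 (curveVelocity γ) (Icc 0 1) :=
  hγ.derivWithin (uniqueDiffOn_Icc zero_lt_one) (by norm_num)

/-- The velocity of a strictly vertical curve has an imaginary part bounded away from zero. -/
lemma IsStrictlyVertical.exists_le_im {γ : ℝ → ℂ} (hγ : ContDiffOn ℝ 2 γ (Icc 0 1))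
    (h : IsStrictlyVertical γ) : ∃ c : ℝ, 0 < c ∧ ∀ t, c ≤ (unitExt (curveVelocity γ) t).im := by
  obtain ⟨δ, hδ, harg⟩ := h
  obtain ⟨t₀, ht₀, hmin⟩ := isCompact_Icc.exists_isMinOn (nonempty_Icc.2 zero_le_one)
    (Complex.continuous_im.comp_continuousOn (contDiffOn_curveVelocity hγ).continuousOn)
  refine ⟨(curveVelocity γ t₀).im, ?_, fun t => hmin (projIcc (0 : ℝ) 1 zero_le_one t).2⟩
  obtain ⟨h1, h2⟩ := harg t₀ ht₀
  have h0 : curveVelocity γ t₀ ≠ 0 := fun h0 => by rw [h0, Complex.arg_zero] at h1; linarith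
  rw [← Complex.norm_mul_sin_arg]
  exact mul_pos (norm_pos_iff.2 h0) (Real.sin_pos_of_pos_of_lt_pi (by linarith) (by linarith))

/-- The fundamental theorem of calculus along the curve. -/
lemma curve_sub_eq {γ : ℝ → ℂ} (hγ : ContDiffOn ℝ 2 γ (Icc 0 1)) {s t : ℝ}
    (hs : s ∈ Icc (0 : ℝ) 1) (ht : t ∈ Icc (0 : ℝ) 1) :
    γ t - γ s = ((t - s : ℝ) : ℂ) * avg (unitExt (curveVelocity γ)) s t := by
  obtain ⟨M, hM⟩ := exists_lipBdd_unitExt (contDiffOn_curveVelocity hγ)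
  rw [← LipBdd.integral_eq_avg]
  have hsub : uIcc s t ⊆ Icc 0 1 := uIcc_subset_Icc hs ht
  refine (intervalIntegral.integral_eq_sub_of_hasDeriv_right (hγ.continuousOn.mono hsub)
    (fun x hx => ?_) (hM.intervalIntegrable s t)).symm
  have hx' : x ∈ Ioo (0 : ℝ) 1 :=
    ⟨(le_min hs.1 ht.1).trans_lt hx.1, hx.2.trans_le (max_le hs.2 ht.2)⟩
  have hn : Icc (0 : ℝ) 1 ∈ 𝓝 x := Icc_mem_nhds hx'.1 hx'.2
  rw [unitExt_of_mem _ (Ioo_subset_Icc_self hx')]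
  exact ((hγ.differentiableOn (by norm_num) x (Ioo_subset_Icc_self hx')).hasDerivWithinAt.hasDerivAt
    hn).hasDerivWithinAt

lemma arcIntegral_eq (γ : ℝ → ℂ) (g : ℂ → ℂ) {s t : ℝ} (hs : s ∈ Icc (0 : ℝ) 1)
    (ht : t ∈ Icc (0 : ℝ) 1) : arcIntegral γ g s t =
      ((t - s : ℝ) : ℂ) * avg (unitExt fun u => g (γ u) * curveVelocity γ u) s t := by
  rw [← LipBdd.integral_eq_avg, arcIntegral]
  refine intervalIntegral.integral_congr fun u hu => ?_
  exact (unitExt_of_mem (fun u => g (γ u) * curveVelocity γ u) (uIcc_subset_Icc hs ht hu)).symm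

lemma arcIntegral_sub_const {γ : ℝ → ℂ} (hγ : ContDiffOn ℝ 2 γ (Icc 0 1)) {g : ℂ → ℂ} {M : ℝ}
    (hp : LipBdd M (unitExt fun u => g (γ u) * curveVelocity γ u)) (k : ℂ) {s t : ℝ}
    (hs : s ∈ Icc (0 : ℝ) 1) (ht : t ∈ Icc (0 : ℝ) 1) :
    arcIntegral γ (fun z => g z - k) s t = arcIntegral γ g s t - k * (γ t - γ s) := by
  obtain ⟨M', hv⟩ := exists_lipBdd_unitExt (contDiffOn_curveVelocity hγ)
  rw [arcIntegral_eq γ g hs ht, curve_sub_eq hγ hs ht, ← LipBdd.integral_eq_avg,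
    ← LipBdd.integral_eq_avg, ← intervalIntegral.integral_const_mul,
    ← intervalIntegral.integral_sub (hp.intervalIntegrable s t)
      ((hv.intervalIntegrable s t).const_mul k), arcIntegral]
  refine intervalIntegral.integral_congr fun u hu => ?_
  have hu' := uIcc_subset_Icc hs ht hu
  simp only [unitExt_of_mem _ hu']
  ring

/-- The integrand of `K₊` in the parameter of the curve: `cot w - i = 2 i / (exp (2 i w) - 1)`. -/
lemma cotIntegrand_eq {γ : ℝ → ℂ} (hγ : ContDiffOn ℝ 2 γ (Icc 0 1)) {c M ε : ℝ} {p : ℝ → ℂ}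
    (hc : 0 < c) (hv : LipBdd M (unitExt (curveVelocity γ)))
    (hvc : ∀ t, c ≤ (unitExt (curveVelocity γ) t).im) (hε : 0 < ε) (F : ℝ → ℂ) {s t h : ℝ}
    (hs : s ∈ Icc (0 : ℝ) 1) (ht : t ∈ Icc (0 : ℝ) 1) (hh : 0 < h) (hhε : h < ε) :
    cotIntegrand γ ε (γ s) (fun t => Complex.exp (expY ε p s t) * F t) h t =
      2 * Complex.I * ε * (curveKernel ε (unitExt (curveVelocity γ)) p s h t * F t) := by
  have hne := exp_displaced_sub_one_ne_zero hc hv hvc hε s t hh hhε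
  have hεc : (ε : ℂ) ≠ 0 := Complex.ofReal_ne_zero.2 hε.ne'
  set w : ℂ := Real.pi * (γ t - γ s - h) / ε with hw
  have e : 2 * Complex.I * w = expX ε (unitExt (curveVelocity γ)) s t -
      2 * Real.pi * Complex.I * h / ε := by
    rw [expX, ← curve_sub_eq hγ hs ht, hw]; ring
  have hcot : Complex.cot w - Complex.I = 2 * Complex.I / (Complex.exp (2 * Complex.I * w) - 1) := by
    rw [← e] at hne
    have h2 : Complex.I * (1 - Complex.exp (2 * Complex.I * w)) ≠ 0 :=
      mul_ne_zero Complex.I_ne_zero (by rw [← neg_sub]; exact neg_ne_zero.2 hne)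
    rw [Complex.cot_eq_exp_ratio, eq_div_iff hne, sub_mul, div_mul_eq_mul_div, sub_eq_iff_eq_add,
      div_eq_iff h2]
    linear_combination (Complex.exp (2 * Complex.I * w) ^ 2 - 1) * Complex.I_sq
  rw [cotIntegrand, curveKernel, hcot, e, unitExt_of_mem _ ht]
  field_simp

/-- The singular integral along the curve exists and is given by `curveOperator`. -/
lemma hasCotIntegral_curveOperator {γ : ℝ → ℂ} (hγ : ContDiffOn ℝ 2 γ (Icc 0 1))
    {a b c M ε N : ℝ} {p F G : ℝ → ℂ} (hb : 0 < b) (hba : b < a) (ha : a < 1) (hc : 0 < c)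
    (hv : LipBdd M (unitExt (curveVelocity γ)))
    (hvc : ∀ t, c ≤ (unitExt (curveVelocity γ) t).im) (hp : LipBdd M p) (hε : 0 < ε)
    (hF : HolderUnit a b N F) {s : ℝ} (hs : s ∈ Ioo (0 : ℝ) 1)
    (hG : ∀ t ∈ Icc (0 : ℝ) 1, G t = Complex.exp (expY ε p s t) * F t) :
    HasCotIntegral γ ε (γ s) G (curveOperator a ε (unitExt (curveVelocity γ)) p F s) := by
  obtain ⟨h1, h2⟩ := tendsto_integral_curveKernel hb hba ha hF hc hv hvc hp hε hs
  have small : ∀ᶠ h in 𝓝[>] (0 : ℝ), h ∈ Ioo 0 ε := Ioo_mem_nhdsGT hε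
  have key : ∀ h ∈ Ioo 0 ε, ∀ t ∈ Icc (0 : ℝ) 1, cotIntegrand γ ε (γ s) G h t =
      2 * Complex.I * ε * (curveKernel ε (unitExt (curveVelocity γ)) p s h t * F t) := by
    intro h hh t ht
    rw [← cotIntegrand_eq hγ hc hv hvc hε F (Ioo_subset_Icc_self hs) ht hh.1 hh.2]
    simp only [cotIntegrand, hG t ht]
  have hεc : (ε : ℂ) ≠ 0 := Complex.ofReal_ne_zero.2 hε.ne'
  refine ⟨?_, h2.congr' ?_⟩
  · filter_upwards [h1, small] with h i1 hh
    refine (i1.const_mul (2 * Complex.I * ε)).congr fun t ht => ?_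
    rw [uIoc_of_le zero_le_one] at ht
    exact (key h hh t (Ioc_subset_Icc_self ht)).symm
  · filter_upwards [small] with h hh
    have h3 : ∫ t in (0 : ℝ)..1, cotIntegrand γ ε (γ s) G h t = ∫ t in (0 : ℝ)..1,
        2 * Complex.I * ε * (curveKernel ε (unitExt (curveVelocity γ)) p s h t * F t) :=
      intervalIntegral.integral_congr fun t ht => key h hh t (by rwa [uIcc_of_le zero_le_one] at ht)
    rw [h3, intervalIntegral.integral_const_mul, ← mul_assoc, one_div_mul_cancel (by simp [hεc]),
      one_mul]

/-! ### The norm of the weighted Hölder space -/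

lemma norm_weightedFun_le {γ : ℝ → ℂ} {a b : ℝ} {f : ℂ → ℂ} (hf : MemWeightedHolder γ a b f)
    {φ : ℂ} (hφ : φ ∈ openCurve γ) : ‖weightedFun γ a f φ‖ ≤ (holderNorm γ a b f).toReal := by
  have h : ‖weightedFun γ a f φ‖ₑ ≤ holderNorm γ a b f :=
    (le_iSup₂ (f := fun φ (_ : φ ∈ openCurve γ) => ‖weightedFun γ a f φ‖ₑ) φ hφ).trans le_self_add
  rw [← toReal_enorm]
  exact ENNReal.toReal_mono hf.ne h

lemma norm_weightedFun_sub_le {γ : ℝ → ℂ} {a b : ℝ} (hb : 0 < b) {f : ℂ → ℂ}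
    (hf : MemWeightedHolder γ a b f) {φ φ' : ℂ} (hφ : φ ∈ openCurve γ) (hφ' : φ' ∈ openCurve γ) :
    ‖weightedFun γ a f φ - weightedFun γ a f φ'‖ ≤
      (holderNorm γ a b f).toReal * ‖φ - φ'‖ ^ b := by
  by_cases hne : φ = φ'
  · subst hne; simp [Real.zero_rpow hb.ne']
  have h : edist (weightedFun γ a f φ) (weightedFun γ a f φ') / edist φ φ' ^ b ≤
      holderNorm γ a b f := by
    refine le_trans ?_ le_add_self
    refine le_trans ?_ (le_iSup₂ (f := fun φ (_ : φ ∈ openCurve γ) => ⨆ φ' ∈ openCurve γ,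
      edist (weightedFun γ a f φ) (weightedFun γ a f φ') / edist φ φ' ^ b) φ hφ)
    exact le_iSup₂ (f := fun φ' (_ : φ' ∈ openCurve γ) =>
      edist (weightedFun γ a f φ) (weightedFun γ a f φ') / edist φ φ' ^ b) φ' hφ'
  have h2 := ENNReal.toReal_mono hf.ne h
  rw [ENNReal.toReal_div, ← ENNReal.toReal_rpow, edist_dist, edist_dist,
    ENNReal.toReal_ofReal dist_nonneg, ENNReal.toReal_ofReal dist_nonneg, dist_eq_norm,
    dist_eq_norm, div_le_iff₀ (Real.rpow_pos_of_pos (norm_pos_iff.2 (sub_ne_zero.2 hne)) b)] at h2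
  exact h2

lemma holderNorm_le {γ : ℝ → ℂ} {a b N : ℝ} (hb : 0 < b) (hN : 0 ≤ N) {g : ℂ → ℂ}
    (h1 : ∀ φ ∈ openCurve γ, ‖weightedFun γ a g φ‖ ≤ N)
    (h2 : ∀ φ ∈ openCurve γ, ∀ φ' ∈ openCurve γ,
      ‖weightedFun γ a g φ - weightedFun γ a g φ'‖ ≤ N * ‖φ - φ'‖ ^ b) :
    holderNorm γ a b g ≤ ENNReal.ofReal (2 * N) := by
  rw [two_mul, ENNReal.ofReal_add hN hN]
  refine add_le_add (iSup₂_le fun φ hφ => ?_) (iSup₂_le fun φ hφ => iSup₂_le fun φ' hφ' => ?_)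
  · rw [← ofReal_norm]; exact ENNReal.ofReal_le_ofReal (h1 φ hφ)
  · refine ENNReal.div_le_of_le_mul ?_
    rw [edist_dist, edist_dist, ENNReal.ofReal_rpow_of_nonneg dist_nonneg hb.le,
      ← ENNReal.ofReal_mul hN, dist_eq_norm, dist_eq_norm]
    exact ENNReal.ofReal_le_ofReal (h2 φ hφ φ' hφ')

/-- The factor by which the weight `|φ - ζ₁|^e |φ - ζ₂|^e` on the curve differs from the weight
`t^e (1 - t)^e` on the unit interval. -/
def weightRatio (e : ℝ) (v : ℝ → ℂ) (t : ℝ) : ℝ := (‖avg v 0 t‖ * ‖avg v t 1‖) ^ e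

section Transfer

variable {c M : ℝ} {v : ℝ → ℂ}

lemma exists_weightRatio_bound (hc : 0 < c) (hv : LipBdd M v) (hvc : ∀ t, c ≤ (v t).im) (e : ℝ) :
    ∃ L : ℝ, 0 ≤ L ∧ (∀ t, |weightRatio e v t| ≤ L) ∧
      ∀ s t, |weightRatio e v s - weightRatio e v t| ≤ L * |s - t| := by
  have hM := hv.nonneg
  obtain ⟨K, hK0, hK⟩ := exists_rpow_lipschitz (M := M * M) (mul_pos hc hc) e
  have mem : ∀ t, ‖avg v 0 t‖ * ‖avg v t 1‖ ∈ Icc (c * c) (M * M) := fun t =>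
    ⟨mul_le_mul (le_norm_avg hv hvc _ _) (le_norm_avg hv hvc _ _) hc.le (norm_nonneg _),
      mul_le_mul (hv.norm_avg_le _ _) (hv.norm_avg_le _ _) (norm_nonneg _) hM⟩
  have lip : ∀ s t, |weightRatio e v s - weightRatio e v t| ≤ K * (2 * M * M) * |s - t| := by
    intro s t
    refine (hK _ (mem s) _ (mem t)).trans ?_
    rw [mul_assoc]
    gcongr
    have e1 : ‖avg v 0 s‖ * ‖avg v s 1‖ - ‖avg v 0 t‖ * ‖avg v t 1‖ =
        (‖avg v 0 s‖ - ‖avg v 0 t‖) * ‖avg v s 1‖ + ‖avg v 0 t‖ * (‖avg v s 1‖ - ‖avg v t 1‖) := by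
      ring
    have h1 := (abs_norm_sub_norm_le (avg v 0 s) (avg v 0 t)).trans (hv.norm_avg_sub_avg_le 0 s 0 t)
    have h2 := (abs_norm_sub_norm_le (avg v s 1) (avg v t 1)).trans (hv.norm_avg_sub_avg_le s 1 t 1)
    rw [sub_self, abs_zero, zero_add] at h1
    rw [sub_self, abs_zero, add_zero] at h2
    rw [e1]
    refine (abs_add_le _ _).trans ?_
    rw [abs_mul, abs_mul, abs_norm, abs_norm]
    have h3 := hv.norm_avg_le s 1
    have h4 := hv.norm_avg_le 0 t
    calc _ ≤ M * |s - t| * M + M * (M * |s - t|) := by gcongr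
      _ = _ := by ring
  refine ⟨K * (2 * M * M) + (|weightRatio e v 0| + K * (M * M)), by positivity, fun t => ?_,
    fun s t => (lip s t).trans ?_⟩
  · have h1 := hK _ (mem t) _ (mem 0)
    have h2 : |‖avg v 0 t‖ * ‖avg v t 1‖ - ‖avg v 0 0‖ * ‖avg v 0 1‖| ≤ M * M := by
      rw [abs_le]
      constructor <;> nlinarith [(mem t).1, (mem t).2, (mem 0).1, (mem 0).2]
    have h3 : |weightRatio e v t - weightRatio e v 0| ≤ K * (M * M) := h1.trans (by gcongr)
    have h4 := abs_sub_abs_le_abs_sub (weightRatio e v t) (weightRatio e v 0)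
    have h5 : 0 ≤ K * (2 * M * M) := by positivity
    linarith
  · have : 0 ≤ |weightRatio e v 0| + K * (M * M) := by positivity
    gcongr
    linarith

lemma HolderUnit.weightRatio_mul {a b L N e : ℝ} {F : ℝ → ℂ} (hb : b ≤ 1) (hL : 0 ≤ L)
    (h1 : ∀ t, |weightRatio e v t| ≤ L)
    (h2 : ∀ s t, |weightRatio e v s - weightRatio e v t| ≤ L * |s - t|)
    (hF : HolderUnit a b N F) :
    HolderUnit a b (2 * L * N) (fun t => (weightRatio e v t : ℂ) * F t) := by
  refine hF.mul_left (fun t _ => h1 t) fun s hs t ht => (h2 s t).trans ?_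
  gcongr
  refine le_rpow_of_le_one (abs_nonneg _) ?_ hb
  rw [abs_le]
  constructor <;> linarith [hs.1, hs.2, ht.1, ht.2]

lemma weightedFun_curve {γ : ℝ → ℂ} (hγv : ∀ s ∈ Icc (0 : ℝ) 1, ∀ t ∈ Icc (0 : ℝ) 1,
      γ t - γ s = ((t - s : ℝ) : ℂ) * avg v s t) (a : ℝ) (f : ℂ → ℂ) {t : ℝ}
    (ht : t ∈ Ioo (0 : ℝ) 1) :
    weightedFun γ a f (γ t) = (wt a t : ℂ) * ((weightRatio a v t : ℂ) * f (γ t)) := by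
  have ht' := Ioo_subset_Icc_self ht
  have h1t : 0 ≤ 1 - t := sub_nonneg.2 ht'.2
  have e1 : ‖γ t - γ 0‖ = t * ‖avg v 0 t‖ := by
    rw [hγv 0 ⟨le_rfl, zero_le_one⟩ t ht', norm_mul, Complex.norm_real, sub_zero,
      Real.norm_of_nonneg ht'.1]
  have e2 : ‖γ t - γ 1‖ = (1 - t) * ‖avg v t 1‖ := by
    rw [norm_sub_rev, hγv t ht' 1 ⟨zero_le_one, le_rfl⟩, norm_mul, Complex.norm_real,
      Real.norm_of_nonneg h1t]
  rw [weightedFun, e1, e2, Real.mul_rpow ht'.1 (norm_nonneg _), Real.mul_rpow h1t (norm_nonneg _),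
    wt, weightRatio, Real.mul_rpow (norm_nonneg _) (norm_nonneg _)]
  push_cast
  ring

/-- Up to constants, the norm of `C_{a,b}(γ)` is the norm of the weighted Hölder space of the unit
interval. -/
lemma exists_holderNorm_transfer {γ : ℝ → ℂ} {a b : ℝ} (hb : 0 < b) (hb1 : b ≤ 1)
    (hγv : ∀ s ∈ Icc (0 : ℝ) 1, ∀ t ∈ Icc (0 : ℝ) 1,
      γ t - γ s = ((t - s : ℝ) : ℂ) * avg v s t)
    (hc : 0 < c) (hv : LipBdd M v) (hvc : ∀ t, c ≤ (v t).im) :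
    ∃ C : ℝ, 0 ≤ C ∧
      (∀ f, MemWeightedHolder γ a b f →
        HolderUnit a b (C * (holderNorm γ a b f).toReal) (fun t => f (γ t))) ∧
      ∀ N F g, HolderUnit a b N F → (∀ s ∈ Ioo (0 : ℝ) 1, g (γ s) = F s) →
        holderNorm γ a b g ≤ ENNReal.ofReal (C * N) := by
  have hM := hv.nonneg
  obtain ⟨L₁, hL₁, h1, h1'⟩ := exists_weightRatio_bound hc hv hvc a
  obtain ⟨L₂, hL₂, h2, h2'⟩ := exists_weightRatio_bound hc hv hvc (-a)
  have hdist : ∀ s ∈ Ioo (0 : ℝ) 1, ∀ t ∈ Ioo (0 : ℝ) 1, ‖γ s - γ t‖ = |s - t| * ‖avg v t s‖ :=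
    fun s hs t ht => by
      rw [hγv t (Ioo_subset_Icc_self ht) s (Ioo_subset_Icc_self hs), norm_mul, Complex.norm_real,
        Real.norm_eq_abs]
  have hMb : 0 ≤ M ^ b := by positivity
  have hcb : 0 ≤ c ^ (-b) := by positivity
  refine ⟨2 * L₂ * (1 + M ^ b) + 2 * (2 * L₁ * (1 + c ^ (-b))), by positivity, fun f hf => ?_,
    fun N F g hF hg => ?_⟩
  · set N := (holderNorm γ a b f).toReal with hN
    have hN0 : 0 ≤ N := ENNReal.toReal_nonneg
    have hG : HolderUnit a b ((1 + M ^ b) * N) (fun t => (weightRatio a v t : ℂ) * f (γ t)) := by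
      refine ⟨fun t ht => ?_, fun s hs t ht => ?_⟩
      · rw [← weightedFun_curve hγv a f ht]
        refine (norm_weightedFun_le hf (mem_image_of_mem γ ht)).trans ?_
        nlinarith
      · rw [← weightedFun_curve hγv a f ht, ← weightedFun_curve hγv a f hs]
        refine (norm_weightedFun_sub_le hb hf (mem_image_of_mem γ hs)
          (mem_image_of_mem γ ht)).trans ?_
        rw [hdist s hs t ht, Real.mul_rpow (abs_nonneg _) (norm_nonneg _)]
        have h3 : ‖avg v t s‖ ^ b ≤ M ^ b :=
          Real.rpow_le_rpow (norm_nonneg _) (hv.norm_avg_le _ _) hb.le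
        calc N * (|s - t| ^ b * ‖avg v t s‖ ^ b) ≤ N * (|s - t| ^ b * (1 + M ^ b)) := by
              gcongr; linarith
          _ = _ := by ring
    have hF := HolderUnit.weightRatio_mul hb1 hL₂ h2 h2' hG
    have e : (fun t => (weightRatio (-a) v t : ℂ) * ((weightRatio a v t : ℂ) * f (γ t))) =
        fun t => f (γ t) := by
      funext t
      have hx : 0 < ‖avg v 0 t‖ * ‖avg v t 1‖ := mul_pos
        (hc.trans_le (le_norm_avg hv hvc _ _)) (hc.trans_le (le_norm_avg hv hvc _ _))
      rw [← mul_assoc, ← Complex.ofReal_mul, weightRatio, weightRatio, ← Real.rpow_add hx,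
        neg_add_cancel, Real.rpow_zero, Complex.ofReal_one, one_mul]
    rw [e] at hF
    refine hF.mono ?_
    have : 0 ≤ 2 * (2 * L₁ * (1 + c ^ (-b))) * N := by positivity
    linarith
  · have hN := hF.nonneg
    have hG := HolderUnit.weightRatio_mul hb1 hL₁ h1 h1' hF
    have hw : ∀ s ∈ Ioo (0 : ℝ) 1, weightedFun γ a g (γ s) =
        (wt a s : ℂ) * ((weightRatio a v s : ℂ) * F s) := fun s hs => by
      rw [weightedFun_curve hγv a g hs, hg s hs]
    refine (holderNorm_le (N := 2 * L₁ * (1 + c ^ (-b)) * N) hb (by positivity) ?_ ?_).trans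
      (ENNReal.ofReal_le_ofReal ?_)
    · rintro _ ⟨s, hs, rfl⟩
      rw [hw s hs]
      refine (hG.1 s hs).trans ?_
      have : 0 ≤ 2 * L₁ * c ^ (-b) * N := by positivity
      linarith
    · rintro _ ⟨s, hs, rfl⟩ _ ⟨t, ht, rfl⟩
      rw [hw s hs, hw t ht]
      refine (hG.2 s hs t ht).trans ?_
      have h3 : |s - t| ≤ c⁻¹ * ‖γ s - γ t‖ := by
        rw [hdist s hs t ht, ← div_eq_inv_mul, le_div_iff₀ hc]
        exact mul_le_mul_of_nonneg_left (le_norm_avg hv hvc _ _) (abs_nonneg _)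
      have h4 : |s - t| ^ b ≤ c ^ (-b) * ‖γ s - γ t‖ ^ b := by
        refine (Real.rpow_le_rpow (abs_nonneg _) h3 hb.le).trans (le_of_eq ?_)
        rw [Real.mul_rpow (by positivity) (norm_nonneg _), Real.inv_rpow hc.le, Real.rpow_neg hc.le]
      have h5 : 0 ≤ ‖γ s - γ t‖ ^ b := by positivity
      calc _ ≤ 2 * L₁ * N * (c ^ (-b) * ‖γ s - γ t‖ ^ b) := by gcongr
        _ ≤ 2 * L₁ * N * ((1 + c ^ (-b)) * ‖γ s - γ t‖ ^ b) := by gcongr; linarith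
        _ = _ := by ring
    · have : 0 ≤ 2 * L₂ * (1 + M ^ b) * N := by positivity
      linarith

lemma injOn_of_le_im {γ : ℝ → ℂ} (hγv : ∀ s ∈ Icc (0 : ℝ) 1, ∀ t ∈ Icc (0 : ℝ) 1,
      γ t - γ s = ((t - s : ℝ) : ℂ) * avg v s t)
    (hc : 0 < c) (hv : LipBdd M v) (hvc : ∀ t, c ≤ (v t).im) : InjOn γ (Icc 0 1) := by
  intro s hs t ht h
  have h1 := hγv s hs t ht
  rw [h, sub_self, eq_comm, mul_eq_zero] at h1
  rcases h1 with h1 | h1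
  · exact (sub_eq_zero.1 (Complex.ofReal_eq_zero.1 h1)).symm
  · have := le_norm_avg hv hvc s t
    rw [h1, norm_zero] at this
    linarith

end Transfer

/-! ### The exponential factors and the operator norms -/

lemma exp_neg_le_mul_div {c ε τ : ℝ} (hc : 0 < c) (hε : 0 < ε) (hτ : 0 ≤ τ) :
    Real.exp (-(c * (τ / ε))) ≤ (1 + 1 / c) * (ε / (ε + τ)) := by
  have hx : 0 ≤ c * (τ / ε) := by positivity
  have h1 := Real.add_one_le_exp (c * (τ / ε))
  rw [Real.exp_neg]
  calc (Real.exp (c * (τ / ε)))⁻¹ ≤ (c * (τ / ε) + 1)⁻¹ := by gcongr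
    _ ≤ (1 + 1 / c) * (ε / (ε + τ)) := by
      rw [inv_le_iff_one_le_mul₀ (by positivity)]
      have e : (1 + 1 / c) * (ε / (ε + τ)) * (c * (τ / ε) + 1) =
          1 + (c * τ / (ε + τ) + ε / (c * (ε + τ))) := by
        field_simp
        ring
      rw [e]
      have : 0 ≤ c * τ / (ε + τ) + ε / (c * (ε + τ)) := by positivity
      linarith

lemma HasHolderOpNormLE.mono {γ : ℝ → ℂ} {a b M M' : ℝ} {T : (ℂ → ℂ) → (ℂ → ℂ) → Prop}
    (h : HasHolderOpNormLE γ a b T M) (hM : M ≤ M') : HasHolderOpNormLE γ a b T M' := by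
  intro f hf
  obtain ⟨g, hg, hle⟩ := h f hf
  exact ⟨g, hg, hle.trans (by gcongr)⟩

/-- The bound of `exists_curveOperator_bound`, carried over to the curve. -/
lemma exists_hasHolderOpNormLE {γ : ℝ → ℂ} (hγ : ContDiffOn ℝ 2 γ (Icc 0 1)) {a b c M : ℝ}
    {p : ℝ → ℂ} (hb : 0 < b) (hba : b < a) (ha : a < 1) (hc : 0 < c)
    (hv : LipBdd M (unitExt (curveVelocity γ)))
    (hvc : ∀ t, c ≤ (unitExt (curveVelocity γ) t).im) (hp : LipBdd M p) {C₀ : ℝ} (hC₀ : 0 ≤ C₀) :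
    ∃ C : ℝ, 0 ≤ C ∧ ∀ ε : ℝ, 0 < ε → ε ≤ 1 → ∀ (B : ℝ → ℝ) (A : ℝ),
      (∀ τ, 0 ≤ τ → ε / (ε + τ) ≤ B τ) →
      (∀ s ∈ Icc (0 : ℝ) 1, ∀ t ∈ Icc (0 : ℝ) 1, s < t →
        ‖Complex.exp (expY ε p s t)‖ ≤ C₀ * B |t - s|) →
      (∀ s ∈ Icc (0 : ℝ) 1, ∀ t ∈ Icc (0 : ℝ) 1, t < s →
        ‖Complex.exp (expY ε p s t - expX ε (unitExt (curveVelocity γ)) s t)‖ ≤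
          C₀ * B |t - s|) →
      (∀ s ∈ Ioo (0 : ℝ) 1, IntegrableOn (fun t => 1 / ε * B |t - s| * (wt a t)⁻¹) (Ioo 0 1) ∧
        ∫ t in Ioo (0 : ℝ) 1, 1 / ε * B |t - s| * (wt a t)⁻¹ ≤ A) →
      ∀ T : (ℂ → ℂ) → (ℂ → ℂ) → Prop,
        (∀ f g, (∀ s ∈ Ioo (0 : ℝ) 1, ∀ G : ℝ → ℂ,
          (∀ t ∈ Icc (0 : ℝ) 1, G t = Complex.exp (expY ε p s t) * f (γ t)) →
            HasCotIntegral γ ε (γ s) G (g (γ s))) → T f g) →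
        HasHolderOpNormLE γ a b T (C * (1 + A * ε ^ (-b))) := by
  have hγv : ∀ s ∈ Icc (0 : ℝ) 1, ∀ t ∈ Icc (0 : ℝ) 1, γ t - γ s =
      ((t - s : ℝ) : ℂ) * avg (unitExt (curveVelocity γ)) s t := fun s hs t ht =>
    curve_sub_eq hγ hs ht
  obtain ⟨C₁, hC₁, h₁⟩ := exists_curveOperator_bound hb hba ha hc hv hvc hp hC₀
  obtain ⟨C₂, hC₂, hto, hfrom⟩ := exists_holderNorm_transfer (a := a) hb (hba.trans ha).le hγv hc
    hv hvc
  refine ⟨C₂ * C₁ * C₂, by positivity, fun ε hε hε1 B A hB hpos hneg hA T hT f hf => ?_⟩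
  have hF := hto f hf
  have hop := h₁ ε hε hε1 B A hB hpos hneg hA _ _ hF
  have hinj : InjOn γ (Ioo 0 1) := (injOn_of_le_im hγv hc hv hvc).mono Ioo_subset_Icc_self
  set Op := curveOperator a ε (unitExt (curveVelocity γ)) p (fun t => f (γ t)) with hOp
  have hg : ∀ s ∈ Ioo (0 : ℝ) 1, (Op ∘ Function.invFunOn γ (Ioo 0 1)) (γ s) = Op s :=
    fun s hs => congrArg Op (hinj.leftInvOn_invFunOn hs)
  -- The curve is injective, so that a function of the parameter is a function on the curve.
  refine ⟨Op ∘ Function.invFunOn γ (Ioo 0 1), hT f _ fun s hs G hG => ?_, ?_⟩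
  · rw [hg s hs]
    exact hasCotIntegral_curveOperator hγ hb hba ha hc hv hvc hp hε hF hs hG
  · refine (hfrom _ _ _ hop hg).trans (le_of_eq ?_)
    rw [show C₂ * (C₁ * (1 + A * ε ^ (-b)) * (C₂ * (holderNorm γ a b f).toReal)) =
      C₂ * C₁ * C₂ * (1 + A * ε ^ (-b)) * (holderNorm γ a b f).toReal by ring,
      ENNReal.ofReal_mul' ENNReal.toReal_nonneg, ENNReal.ofReal_toReal hf.ne]

lemma mul_im_curve_sub_le {γ : ℝ → ℂ} (hγ : ContDiffOn ℝ 2 γ (Icc 0 1)) {c M : ℝ}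
    (hv : LipBdd M (unitExt (curveVelocity γ)))
    (hvc : ∀ t, c ≤ (unitExt (curveVelocity γ) t).im) {s t : ℝ} (hs : s ∈ Icc (0 : ℝ) 1)
    (ht : t ∈ Icc (0 : ℝ) 1) (hst : s ≤ t) : c * (t - s) ≤ (γ t - γ s).im := by
  rw [curve_sub_eq hγ hs ht, Complex.im_ofReal_mul, mul_comm]
  exact mul_le_mul_of_nonneg_left (hv.le_im_avg hvc s t) (sub_nonneg.2 hst)

lemma re_two_I_div_mul (ε : ℝ) (z : ℂ) : (2 * Complex.I / ε * z).re = -(2 * z.im / ε) := by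
  have : 2 * Complex.I / ε * z = ((2 / ε : ℝ) : ℂ) * (Complex.I * z) := by push_cast; ring
  rw [this, Complex.re_ofReal_mul, Complex.I_mul_re]
  ring

/-- On a strictly canonical curve both exponential factors of the kernel of `K₊` decay
exponentially on the scale `ε`. -/
lemma norm_exp_le_of_strictlyCanonical {γ : ℝ → ℂ} {κ : ℂ → ℂ}
    (hγ : ContDiffOn ℝ 2 γ (Icc 0 1)) {c M δ₂ δ₃ : ℝ} (hδ₂ : 0 < δ₂) (hδ₃ : 0 < δ₃)
    (hv : LipBdd M (unitExt (curveVelocity γ)))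
    (hvc : ∀ t, c ≤ (unitExt (curveVelocity γ) t).im)
    (hp : LipBdd M (unitExt fun u => κ (γ u) * curveVelocity γ u))
    (hcan : ∀ s t : ℝ, 0 ≤ s → s ≤ t → t ≤ 1 →
      δ₂ * (γ t - γ s).im ≤ (arcIntegral γ κ s t).im ∧
      (arcIntegral γ (fun z => κ z - (Real.pi : ℂ)) s t).im ≤ -δ₃ * (γ t - γ s).im)
    {ε : ℝ} (hε : 0 < ε) {s t : ℝ} (hs : s ∈ Icc (0 : ℝ) 1) (ht : t ∈ Icc (0 : ℝ) 1) :
    (s < t → ‖Complex.exp (expY ε (unitExt fun u => κ (γ u) * curveVelocity γ u) s t)‖ ≤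
      Real.exp (-(min (2 * δ₂ * c) (2 * δ₃ * c) * (|t - s| / ε)))) ∧
    (t < s → ‖Complex.exp (expY ε (unitExt fun u => κ (γ u) * curveVelocity γ u) s t -
      expX ε (unitExt (curveVelocity γ)) s t)‖ ≤
      Real.exp (-(min (2 * δ₂ * c) (2 * δ₃ * c) * (|t - s| / ε)))) := by
  have hx : 0 ≤ |t - s| / ε := by positivity
  refine ⟨fun hst => ?_, fun hst => ?_⟩
  · rw [Complex.norm_exp, expY, ← arcIntegral_eq γ κ hs ht, re_two_I_div_mul, Real.exp_le_exp,
      neg_le_neg_iff]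
    have h1 := (hcan s t hs.1 hst.le ht.2).1
    have h2 := mul_im_curve_sub_le hγ hv hvc hs ht hst.le
    have h3 : δ₂ * (c * (t - s)) ≤ (arcIntegral γ κ s t).im := by nlinarith
    calc _ ≤ 2 * δ₂ * c * (|t - s| / ε) := by gcongr; exact min_le_left _ _
      _ = 2 * (δ₂ * (c * (t - s))) / ε := by rw [abs_of_pos (sub_pos.2 hst)]; ring
      _ ≤ _ := by gcongr
  · have e : expY ε (unitExt fun u => κ (γ u) * curveVelocity γ u) s t -
        expX ε (unitExt (curveVelocity γ)) s t =
        2 * Complex.I / ε * -arcIntegral γ (fun z => κ z - (Real.pi : ℂ)) t s := by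
      have : arcIntegral γ (fun z => κ z - (Real.pi : ℂ)) s t =
          -arcIntegral γ (fun z => κ z - (Real.pi : ℂ)) t s := intervalIntegral.integral_symm _ _
      rw [← this, arcIntegral_sub_const hγ hp _ hs ht, expY, expX, ← arcIntegral_eq γ κ hs ht,
        ← curve_sub_eq hγ hs ht]
      ring
    rw [Complex.norm_exp, e, re_two_I_div_mul, Real.exp_le_exp, Complex.neg_im, neg_le_neg_iff]
    have h1 := (hcan t s ht.1 hst.le hs.2).2
    have h2 := mul_im_curve_sub_le hγ hv hvc ht hs hst.le
    have h3 : δ₃ * (c * (s - t)) ≤ -(arcIntegral γ (fun z => κ z - (Real.pi : ℂ)) t s).im := by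
      nlinarith
    calc _ ≤ 2 * δ₃ * c * (|t - s| / ε) := by gcongr; exact min_le_right _ _
      _ = 2 * (δ₃ * (c * (s - t))) / ε := by rw [abs_of_neg (sub_neg.2 hst)]; ring
      _ ≤ _ := by gcongr

/-- The bound for `K₊`, with the majorant `B τ = ε / (ε + τ)`. Of the branch `κ` only its analyticity
enters, besides the inequalities that define strictly canonical curves. -/
theorem exists_kPlus_bound {κ : ℂ → ℂ} {γ : ℝ → ℂ} {D : Set ℂ} (hκ : AnalyticOnNhd ℂ κ D)
    (hγ : ContDiffOn ℝ 2 γ (Icc 0 1)) (hγD : MapsTo γ (Icc 0 1) D) {a b : ℝ} (hb : 0 < b)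
    (hba : b < a) (ha : a < 1) (hcan : IsStrictlyCanonical γ κ) :
    ∃ C : ℝ, 0 < C ∧ ∀ ε : ℝ, 0 < ε → ε ≤ 1 →
      HasHolderOpNormLE γ a b (IsKPlus γ κ ε) (C * ε ^ (-a - b)) := by
  obtain ⟨hvert, δ₂, δ₃, hδ₂, hδ₃, hcan⟩ := hcan
  obtain ⟨c, hc, hvc⟩ := hvert.exists_le_im hγ
  have hκγ : ContDiffOn ℝ 1 (fun u => κ (γ u)) (Icc 0 1) := fun t ht =>
    ((hκ (γ t) (hγD ht)).contDiffAt.restrict_scalars ℝ).comp_contDiffWithinAt t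
      ((hγ.of_le (by norm_num)) t ht)
  obtain ⟨M₁, hv⟩ := exists_lipBdd_unitExt (contDiffOn_curveVelocity hγ)
  obtain ⟨M₂, hp⟩ := exists_lipBdd_unitExt (hκγ.mul (contDiffOn_curveVelocity hγ))
  replace hv := hv.mono (le_max_left M₁ M₂)
  replace hp := hp.mono (le_max_right M₁ M₂)
  set d := min (2 * δ₂ * c) (2 * δ₃ * c) with hd
  have hd0 : 0 < d := lt_min (by positivity) (by positivity)
  obtain ⟨C, hC, hop⟩ := exists_hasHolderOpNormLE hγ hb hba ha hc hv hvc hp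
    (C₀ := 1 + 1 / d) (by positivity)
  obtain ⟨C₅, hC₅, h₅⟩ := exists_integral_inv_add_mul_inv_wt_le (hb.trans hba) ha
  refine ⟨C * (1 + C₅) + 1, by positivity, fun ε hε hε1 => ?_⟩
  have dec := fun s (hs : s ∈ Icc (0 : ℝ) 1) t (ht : t ∈ Icc (0 : ℝ) 1) =>
    norm_exp_le_of_strictlyCanonical hγ hδ₂ hδ₃ hv hvc hp hcan hε hs ht
  have e : ∀ s t : ℝ, 1 / ε * (ε / (ε + |t - s|)) * (wt a t)⁻¹ =
      1 / (ε + |t - s|) * (wt a t)⁻¹ := fun s t => by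
    have : ε + |t - s| ≠ 0 := by positivity
    field_simp
  refine (hop ε hε hε1 (fun τ => ε / (ε + τ)) (C₅ * ε ^ (-a)) (fun τ _ => le_rfl)
    (fun s hs t ht hst => ((dec s hs t ht).1 hst).trans
      (exp_neg_le_mul_div hd0 hε (abs_nonneg _)))
    (fun s hs t ht hst => ((dec s hs t ht).2 hst).trans
      (exp_neg_le_mul_div hd0 hε (abs_nonneg _)))
    (fun s _ => by simp only [e]; exact h₅ ε hε s) (IsKPlus γ κ ε)
    fun f g h s hs => h s hs _ fun t ht => ?_).mono ?_
  · rw [expY, ← arcIntegral_eq γ κ (Ioo_subset_Icc_self hs) ht]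
  · have h1 : 1 ≤ ε ^ (-a - b) :=
      Real.one_le_rpow_of_pos_of_le_one_of_nonpos hε hε1 (by linarith)
    have h2 : ε ^ (-a) * ε ^ (-b) = ε ^ (-a - b) := by rw [← Real.rpow_add hε]; ring_nf
    rw [mul_assoc C₅, h2]
    nlinarith [mul_le_mul_of_nonneg_left h1 hC]

/-- The bound for `L₊`, which is `K₊` with `p = 0`, with the majorant `B = 1`. -/
theorem exists_lPlus_bound {γ : ℝ → ℂ} (hγ : ContDiffOn ℝ 2 γ (Icc 0 1)) {a b : ℝ} (hb : 0 < b)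
    (hba : b < a) (ha : a < 1) (hvert : IsStrictlyVertical γ) :
    ∃ C : ℝ, 0 < C ∧ ∀ ε : ℝ, 0 < ε → ε ≤ 1 →
      HasHolderOpNormLE γ a b (IsLPlus γ ε) (C * ε ^ (-1 - a)) := by
  obtain ⟨c, hc, hvc⟩ := hvert.exists_le_im hγ
  obtain ⟨M, hv⟩ := exists_lipBdd_unitExt (contDiffOn_curveVelocity hγ)
  have hp : LipBdd M (fun _ => 0) :=
    ⟨fun s t => by simpa using mul_nonneg hv.nonneg (abs_nonneg _), fun t => by
      simpa using hv.nonneg⟩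
  have hY : ∀ ε s t, expY ε (fun _ => 0) s t = 0 := fun ε s t => by simp [expY, avg]
  obtain ⟨C, hC, hop⟩ := exists_hasHolderOpNormLE hγ hb hba ha hc hv hvc hp (C₀ := 1) zero_le_one
  have iw := integrableOn_inv_wt (hb.trans hba).le ha
  set W := ∫ t in Ioo (0 : ℝ) 1, (wt a t)⁻¹ with hW
  have hW0 : 0 ≤ W := setIntegral_nonneg measurableSet_Ioo
    fun t ht => inv_nonneg.2 (wt_pos a ht).le
  refine ⟨C * (1 + W) + 1, by positivity, fun ε hε hε1 => ?_⟩
  refine (hop ε hε hε1 (fun _ => 1) (1 / ε * 1 * W)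
    (fun τ hτ => div_le_one_of_le₀ (by linarith) (by linarith))
    (fun s _ t _ _ => by rw [hY]; simp) (fun s _ t _ hst => ?_)
    (fun s _ => ⟨iw.const_mul _, by rw [integral_const_mul]⟩) (IsLPlus γ ε)
    fun f g h s hs => h s hs _ fun t _ => ?_).mono ?_
  · rw [hY, zero_sub, Complex.norm_exp, Complex.neg_re, expX_re, neg_neg, mul_one,
      Real.exp_le_one_iff]
    have h1 := hc.le.trans (hv.le_im_avg hvc s t)
    exact mul_nonpos_of_nonneg_of_nonpos (by positivity)
      (mul_nonpos_of_nonpos_of_nonneg (by linarith) h1)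
  · rw [hY, Complex.exp_zero, one_mul]
  · have h1 : 1 ≤ ε ^ (-1 - a) :=
      Real.one_le_rpow_of_pos_of_le_one_of_nonpos hε hε1 (by linarith)
    have h2 : 1 / ε * ε ^ (-b) ≤ ε ^ (-1 - a) := by
      rw [one_div, ← Real.rpow_neg_one, ← Real.rpow_add hε]
      exact Real.rpow_le_rpow_of_exponent_ge hε hε1 (by linarith)
    calc C * (1 + 1 / ε * 1 * W * ε ^ (-b)) = C * (1 + W * (1 / ε * ε ^ (-b))) := by ring
      _ ≤ C * (ε ^ (-1 - a) + W * ε ^ (-1 - a)) := by gcongr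
      _ ≤ _ := by linarith

end

theorem proposition3p2
    (V : ℝ → ℝ) (hVper : Function.Periodic V 1)
    (hV : MemLp V 2 (volume.restrict (Icc (0 : ℝ) 1)))
    (W : ℂ → ℂ) (E : ℝ)
    (D : Set ℂ) (hD : IsOpen D) (hW : DifferentiableOn ℂ W D)
    (κ : ℂ → ℂ) (hκ : IsComplexMomentumBranch V W E D κ)
    (γ : ℝ → ℂ) (hγ : ContDiffOn ℝ 2 γ (Icc 0 1)) (hγD : MapsTo γ (Icc 0 1) D)
    (a b : ℝ) (hb : 0 < b) (hba : b < a) (ha : a < 1) :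
    (IsStrictlyCanonical γ κ →
      ∃ C : ℝ, 0 < C ∧ ∀ ε : ℝ, 0 < ε → ε ≤ 1 →
        HasHolderOpNormLE γ a b (IsKPlus γ κ ε) (C * ε ^ (-a - b))) ∧
    (IsStrictlyVertical γ →
      ∃ C : ℝ, 0 < C ∧ ∀ ε : ℝ, 0 < ε → ε ≤ 1 →
        HasHolderOpNormLE γ a b (IsLPlus γ ε) (C * ε ^ (-1 - a))) := by
  exact ⟨exists_kPlus_bound hκ.1 hγ hγD hb hba ha, exists_lPlus_bound hγ hb hba ha⟩
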